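/- A \emph{tile} is a closed rhombus in the plane with sides of length $1$ and alternate angles $60^\circ$ and $120^\circ$. Call two distinct tiles \emph{adjacent} if they have a side in common, and \emph{neighbours} if they have a point in common. A \emph{run} of a set $T$ of tiles is a sequence of at least two distinct tiles of $T$ in which consecutive tiles share a side, all these shared sides being parallel. A \emph{tredoku tiling} is a finite set $T$ of more than four tiles such that: 1. any two tiles of $T$ are linked by a sequence of tiles of $T$ in which consecutive tiles are adjacent; 2. if two distinct tiles of $T$ have a point in common, then their intersection is either a single point that is a vertex of both or a segment that is a side of both; 3. if any one tile is removed from $T$, any two remaining tiles are linked by a sequence of remaining tiles in which consecutive tiles are neighbours; 4. if two tiles $A,B\in T$ share a side $p$, then there is a third tile $C\in T$ that shares with $A$ or $B$ a side parallel to $p$; 5. no run of $T$ has more than three tiles; 6. $T$ has no holes, i.e. the complement in the plane of the union of the tiles of $T$ is connected. A \emph{$\tau.\rho$ tiling} is a tredoku tiling with exactly $\tau$ tiles and exactly $\rho$ runs of three tiles (a run and its reversal being counted once); it is \emph{verdant} if $\tau=2\rho+1$. A tredoku tiling $T$ is a \emph{single merging} of tredoku tilings $T_1$ and $T_2$ if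 $T=T_1\cup T_2$ and $T_1$ and $T_2$ have exactly one tile in common. \textbf{Corollary (verdant tilings).} Verdant $\tau.\rho$ tilings exist for $(\tau,\rho)=(5,2),(7,3),(9,4),(11,5),(13,6),(17,8)$ and for no other pair $(\tau,\rho)$. Those with $\rho\ge 4$ arise from $5.2$ and $7.3$ tilings by single mergings, as follows. Every $9.4$ tiling is a single merging of two $5.2$ tilings. Every $11.5$ tiling is a single merging of a $5.2$ tiling and a $7.3$ tiling. Every $13.6$ tiling is a single merging of two $7.3$ tilings. Every $17.8$ tiling is of the form $A\cup B\cup C$, where $A$ and $C$ are $7.3$ tilings, $B$ is a $5.2$ tiling, $A\cup B$ is a single merging of $A$ and $B$, $B\cup C$ is a single merging of $B$ and $C$, and $A\cup B\cup C$ is a single merging of $A\cup B$ and $C$. -/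

import Mathlib

open scoped Affine

namespace Tredoku

/-- The sixth root of unity `exp (i π / 3)`, i.e. rotation of the plane `ℂ` through 60 degrees. -/
noncomputable def omega : ℂ := ⟨1 / 2, Real.sqrt 3 / 2⟩

/-- The (closed, filled) parallelogram with corner `p` and side vectors `u` and `omega * u`.
For `‖u‖ = 1` it is a unit rhombus with alternate angles 60 and 120 degrees, with a 60 degree angle
at `p`; every such rhombus is of this form. -/
def rhombus (p u : ℂ) : Set ℂ :=
  {z | ∃ s t : ℝ, 0 ≤ s ∧ s ≤ 1 ∧ 0 ≤ t ∧ t ≤ 1 ∧ z = p + s * u + t * (omega * u)}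

/-- A tile: a unit rhombus in the plane with angles 60 and 120 degrees, in any position. -/
def IsTile (A : Set ℂ) : Prop := ∃ p u : ℂ, ‖u‖ = 1 ∧ A = rhombus p u

/-- `v` is one of the four vertices of the tile `A`. -/
def IsVertex (A : Set ℂ) (v : ℂ) : Prop :=
  ∃ p u : ℂ, ‖u‖ = 1 ∧ A = rhombus p u ∧
    (v = p ∨ v = p + u ∨ v = p + omega * u ∨ v = p + u + omega * u)

/-- The segment `e` is one of the four sides of the tile `A`. -/
def IsSide (A e : Set ℂ) : Prop :=
  ∃ p u : ℂ, ‖u‖ = 1 ∧ A = rhombus p u ∧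
    (e = segment ℝ p (p + u) ∨ e = segment ℝ p (p + omega * u) ∨
      e = segment ℝ (p + u) (p + u + omega * u) ∨
      e = segment ℝ (p + omega * u) (p + u + omega * u))

/-- Two sides are parallel (a side is parallel to itself). -/
def ParallelSides (e f : Set ℂ) : Prop := affineSpan ℝ e ∥ affineSpan ℝ f

/-- Adjacency: two different tiles share a side. -/
def adjacencyGraph : SimpleGraph (Set ℂ) where
  Adj A B := A ≠ B ∧ ∃ e, IsSide A e ∧ IsSide B e
  symm := ⟨fun _ _ ⟨h, e, h₁, h₂⟩ => ⟨h.symm, e, h₂, h₁⟩⟩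
  loopless := ⟨fun _ h => h.1 rfl⟩

/-- Neighbours: two different tiles touch, i.e. have a point in common. -/
def neighbourGraph : SimpleGraph (Set ℂ) where
  Adj A B := A ≠ B ∧ (A ∩ B).Nonempty
  symm := ⟨fun A B h => ⟨h.1.symm, Set.inter_comm A B ▸ h.2⟩⟩
  loopless := ⟨fun _ h => h.1 rfl⟩

/-- A run of `T`: a sequence of at least two different tiles of `T` in which consecutive tiles share
a side, all of these shared sides being parallel (to a common segment `d`). -/
def IsRun (T : Set (Set ℂ)) (l : List (Set ℂ)) : Prop :=
  2 ≤ l.length ∧ l.Nodup ∧ (∀ A ∈ l, A ∈ T) ∧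
    ∃ d : Set ℂ, l.IsChain fun A B => ∃ e, IsSide A e ∧ IsSide B e ∧ ParallelSides e d

/-- The runs of three tiles of `T`, each recorded as the set of its tiles. -/
def runs (T : Set (Set ℂ)) : Set (Set (Set ℂ)) :=
  {R | ∃ A B C : Set ℂ, IsRun T [A, B, C] ∧ R = {A, B, C}}

/-- Tredoku tilings (without holes): finite sets `T` of more than four tiles with the properties
below. -/
structure IsTredoku (T : Set (Set ℂ)) : Prop where
  finite : T.Finite
  isTile : ∀ A ∈ T, IsTile A
  four_lt : 4 < T.ncard
  /-- `T` is connected through shared sides. -/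
  connected : (adjacencyGraph.induce T).Connected
  /-- Two tiles that touch do so only at a vertex or along a common side. -/
  touch : ∀ A ∈ T, ∀ B ∈ T, A ≠ B → (A ∩ B).Nonempty →
    (∃ v, IsVertex A v ∧ IsVertex B v ∧ A ∩ B = {v}) ∨
      (∃ e, IsSide A e ∧ IsSide B e ∧ A ∩ B = e)
  /-- Removing one tile does not disconnect `T`, where connection by a vertex is allowed. -/
  connected_remove : ∀ A ∈ T, (neighbourGraph.induce (T \ {A})).Connected
  /-- If `A` and `B` share a side `p`, a third tile shares a side parallel to `p` with one of
  them. -/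
  run_extends : ∀ A ∈ T, ∀ B ∈ T, A ≠ B → ∀ p, IsSide A p → IsSide B p →
    ∃ C ∈ T, C ≠ A ∧ C ≠ B ∧
      ∃ q, IsSide C q ∧ (IsSide A q ∨ IsSide B q) ∧ ParallelSides q p
  /-- No run has more than three tiles. -/
  run_le : ∀ l, IsRun T l → l.length ≤ 3
  /-- There are no holes: the complement of the covered region is connected. -/
  no_holes : IsConnected (⋃₀ T)ᶜ

/-- `T` is a `τ.ρ` tiling: a tredoku tiling with `τ` tiles and `ρ` runs. -/
def IsTiling (τ ρ : ℕ) (T : Set (Set ℂ)) : Prop :=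
  IsTredoku T ∧ T.ncard = τ ∧ (runs T).ncard = ρ

/-- The tredoku tiling `T` is a single merging of the tredoku tilings `T₁` and `T₂`: it is their
union, and they have exactly one tile in common. -/
def IsSingleMerging (T T₁ T₂ : Set (Set ℂ)) : Prop :=
  IsTredoku T ∧ IsTredoku T₁ ∧ IsTredoku T₂ ∧ T = T₁ ∪ T₂ ∧ ∃ X, T₁ ∩ T₂ = {X}

end Tredoku

/-! A tile that shares a side with a lozenge of a triangular lattice is itself a lozenge of that
lattice. Since a tredoku tiling is connected through sides, it is a set of lozenges in a single
lattice. Run extension and the bound on runs say that every shared side belongs to exactly one run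
of three, and such a run contains two shared sides. So a verdant tiling has at most `2ρ = τ - 1`
pairs of adjacent tiles; being connected, its adjacency graph is a tree (`bridged_of_card`).

The absence of holes enters through a mod 2 version of the Jordan curve theorem: the tiles at a
vertex are linked through tiles at that same vertex (`linked_at`). Combined with the tree property
this has two consequences. A tile next to a connected part of the tiling meets it only along one
side, so its two other vertices are fresh (`fresh_of_bridged`). The middle of a run has a neighbour
in its other direction, for otherwise its removal would disconnect the tiling (`braced_of_bridged`).
These facts are collected in `Good`.

In a good set one can walk from the middle of a run to the middle of a run in the other direction
until a crossing is reached, that is, a lozenge that is the middle of two runs. A finite check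
around a crossing (`isShallow_origin`) shows that such a walk has at most one step
(`AllGood.short_chain`). Freshness and this bound keep the exhaustive search from a crossing finite.
Up to rotation and translation it finds every verdant tiling, and each outcome is tested for its
size and for the claimed merging (`searchAt_origin`, `search_sound`).

Conversely, attaching lozenges one by one with two fresh vertices each creates no overlap and no
hole (`isShelling_sound`). With a check of runs and bracing this certifies explicit lists as tilings
(`isTiling_sound`), both the examples and the parts of the mergings. -/

namespace Tredoku

/-! ### Lozenges of the triangular lattice and their adjacency -/

/-- The three directions `1`, `ω`, `ω²` of the sides of the triangular lattice. -/
inductive Dir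
  | a
  | b
  | c
  deriving DecidableEq

/-- Lattice vertices: `(x, y)` stands for `x + y ω`. -/
abbrev Vtx := ℤ × ℤ

/-- The lozenge `(u, m)` is the union of the upward triangle with corner `u` and of the downward
triangle that shares its side of direction `m`. -/
abbrev Loz := Vtx × Dir

/-- The end of the lattice edge that starts at `w` in direction `i`. -/
def tip : Dir → Vtx → Vtx
  | .a, w => (w.1 + 1, w.2)
  | .b, w => (w.1, w.2 + 1)
  | .c, w => (w.1 - 1, w.2 + 1)

/-- The corner of the downward triangle of a lozenge. The downward triangle with corner `d` has
the vertices `d + 1`, `d + ω`, `d + 1 + ω`. -/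
def dn : Loz → Vtx
  | (u, .a) => (u.1, u.2 - 1)
  | (u, .b) => (u.1 - 1, u.2)
  | (u, .c) => u

/-- Start of the lower side of direction `i`. -/
def lo : Dir → Loz → Vtx
  | .a, l => l.1
  | .b, l => l.1
  | .c, l => ((dn l).1 + 1, (dn l).2)

/-- Start of the upper side of direction `i`. -/
def up : Dir → Loz → Vtx
  | .a, l => ((dn l).1, (dn l).2 + 1)
  | .b, l => ((dn l).1 + 1, (dn l).2)
  | .c, l => (l.1.1 + 1, l.1.2)

/-- The vertex of a lozenge that is not on its upward triangle. -/
def apex : Loz → Vtx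
  | (u, .a) => (u.1 + 1, u.2 - 1)
  | (u, .b) => (u.1 - 1, u.2 + 1)
  | (u, .c) => (u.1 + 1, u.2 + 1)

/-- The four vertices of a lozenge. -/
def verts (l : Loz) : List Vtx :=
  [l.1, (l.1.1 + 1, l.1.2), (l.1.1, l.1.2 + 1), apex l]

/-- The upper side of direction `i` of `A` is the lower side of `B`. -/
def StepUp (i : Dir) (A B : Loz) : Prop :=
  i ≠ A.2 ∧ i ≠ B.2 ∧ up i A = lo i B

instance (i : Dir) (A B : Loz) : Decidable (StepUp i A B) :=
  inferInstanceAs (Decidable (_ ∧ _ ∧ _))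

/-- Two lozenges that share a side of direction `i` and lie on different sides of it. -/
def AdjIn (i : Dir) (A B : Loz) : Prop := StepUp i A B ∨ StepUp i B A

/-- Two lozenges that share a side and lie on different sides of it. -/
def LAdj (A B : Loz) : Prop := ∃ i, AdjIn i A B

theorem AdjIn.symm {i : Dir} {A B : Loz} (h : AdjIn i A B) : AdjIn i B A := Or.symm h

theorem LAdj.symm {A B : Loz} (h : LAdj A B) : LAdj B A := h.imp fun _ h => h.symm

theorem StepUp.ne {i : Dir} {A B : Loz} (h : StepUp i A B) : A ≠ B := by
  rintro rfl
  obtain ⟨⟨x, y⟩, m⟩ := A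
  cases i <;> cases m <;> simp [StepUp, up, lo, dn] at h
  omega

theorem AdjIn.ne {i : Dir} {A B : Loz} (h : AdjIn i A B) : A ≠ B :=
  h.elim (fun h => h.ne) fun h => h.ne.symm

theorem LAdj.ne {A B : Loz} (h : LAdj A B) : A ≠ B := h.elim fun _ h => h.ne

/-- The direction of the sides of `l` other than `i`. -/
def oth : Dir → Dir → Dir
  | .a, .b => .c
  | .a, .c => .b
  | .b, .a => .c
  | .b, .c => .a
  | .c, .a => .b
  | .c, .b => .a
  -- Default for equal arguments, without meaning: a lozenge has no side in the direction of its
  -- short diagonal.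
  | x, _ => x

theorem oth_ne_left {i m : Dir} (h : i ≠ m) : oth i m ≠ i := by
  cases i <;> cases m <;> simp_all [oth]

theorem oth_ne_right {i m : Dir} (h : i ≠ m) : oth i m ≠ m := by
  cases i <;> cases m <;> simp_all [oth]

theorem eq_or_eq_oth {i m j : Dir} (h : i ≠ m) (hj : j ≠ m) : j = i ∨ j = oth i m := by
  cases i <;> cases m <;> cases j <;> simp_all [oth]

theorem oth_oth {i m : Dir} (h : i ≠ m) : oth (oth i m) m = i := by
  cases i <;> cases m <;> simp_all [oth]

/-- No two lozenges of `L` overlap. -/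
def Packed (L : Set Loz) : Prop :=
  ∀ A ∈ L, ∀ B ∈ L, (A.1 = B.1 ∨ dn A = dn B) → A = B

/-- Both lozenges contain the triangle just above the common edge: the upward one for `a` and `b`,
the downward one for `c`. -/
theorem eq_or_eq_of_lo_eq {i : Dir} {A B : Loz} (h : lo i A = lo i B) :
    A.1 = B.1 ∨ dn A = dn B := by
  obtain ⟨⟨x, y⟩, m⟩ := A
  obtain ⟨⟨x', y'⟩, m'⟩ := B
  cases i <;> simp_all [lo, Prod.ext_iff]

theorem eq_or_eq_of_up_eq {i : Dir} {A B : Loz} (h : up i A = up i B) :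
    A.1 = B.1 ∨ dn A = dn B := by
  obtain ⟨⟨x, y⟩, m⟩ := A
  obtain ⟨⟨x', y'⟩, m'⟩ := B
  cases i <;> simp_all [up, Prod.ext_iff]

theorem Packed.up_unique {L : Set Loz} (hL : Packed L) {i : Dir} {A B C : Loz} (hB : B ∈ L)
    (hC : C ∈ L) (h : StepUp i A B) (h' : StepUp i A C) : B = C :=
  hL _ hB _ hC (eq_or_eq_of_lo_eq (h.2.2.symm.trans h'.2.2))

theorem Packed.down_unique {L : Set Loz} (hL : Packed L) {i : Dir} {A B C : Loz} (hB : B ∈ L)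
    (hC : C ∈ L) (h : StepUp i B A) (h' : StepUp i C A) : B = C :=
  hL _ hB _ hC (eq_or_eq_of_up_eq (h.2.2.trans h'.2.2.symm))

theorem Packed.mono {L L' : Set Loz} (hL : Packed L) (h : L' ⊆ L) : Packed L' :=
  fun A hA B hB => hL A (h hA) B (h hB)

/-- `A` and `B` are linked by a chain of lozenges of `S`, each sharing a side with the next. -/
def Linked (S : Set Loz) : Loz → Loz → Prop :=
  Relation.ReflTransGen fun X Y => X ∈ S ∧ Y ∈ S ∧ LAdj X Y

theorem Linked.symm {S : Set Loz} {A B : Loz} (h : Linked S A B) : Linked S B A := by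
  induction h with
  | refl => exact Relation.ReflTransGen.refl
  | tail _ h ih => exact Relation.ReflTransGen.head ⟨h.2.1, h.1, h.2.2.symm⟩ ih

theorem Linked.trans {S : Set Loz} {A B C : Loz} (h : Linked S A B) (h' : Linked S B C) :
    Linked S A C := Relation.ReflTransGen.trans h h'

theorem Linked.mono {S S' : Set Loz} (hS : S ⊆ S') {A B : Loz} (h : Linked S A B) :
    Linked S' A B :=
  Relation.ReflTransGen.mono (fun _ _ h => ⟨hS h.1, hS h.2.1, h.2.2⟩) _ _ h

theorem Linked.single {S : Set Loz} {A B : Loz} (hA : A ∈ S) (hB : B ∈ S) (h : LAdj A B) :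
    Linked S A B := Relation.ReflTransGen.single ⟨hA, hB, h⟩

/-- Any two lozenges of `S` are linked in `S`. -/
def Conn (S : Set Loz) : Prop := ∀ A ∈ S, ∀ B ∈ S, Linked S A B

theorem Conn.insert {S : Set Loz} (hS : Conn S) {A D : Loz} (hA : A ∈ S) (h : LAdj A D) :
    Conn (Insert.insert D S) := by
  have key : ∀ B ∈ S, Linked (Insert.insert D S) B D := fun B hB =>
    ((hS B hB A hA).mono (Set.subset_insert _ _)).trans
      (Linked.single (Set.mem_insert_of_mem _ hA) (Set.mem_insert _ _) h)
  intro B hB C hC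
  rcases hB with rfl | hB
  · rcases hC with rfl | hC
    · exact Relation.ReflTransGen.refl
    · exact (key C hC).symm
  · rcases hC with rfl | hC
    · exact key B hB
    · exact (hS B hB C hC).mono (Set.subset_insert _ _)

/-- Every lozenge of `S` that is next to another one belongs to a run of exactly three in the
direction of the common side. -/
def RunsOfThree (L : Set Loz) : Prop :=
  ∀ i, ∀ A ∈ L, ∀ B ∈ L, StepUp i A B →
    ((∃ C ∈ L, StepUp i B C) ∧ ¬ ∃ C ∈ L, StepUp i C A) ∨
      ((∃ C ∈ L, StepUp i C A) ∧ ¬ ∃ C ∈ L, StepUp i B C)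

/-- `B` is the middle of a run of direction `i`. -/
def IsMid (L : Set Loz) (i : Dir) (B : Loz) : Prop :=
  (∃ A ∈ L, StepUp i A B) ∧ ∃ C ∈ L, StepUp i B C

/-- Every middle of a run has a neighbour in the other direction. -/
def Braced (L : Set Loz) : Prop :=
  ∀ i, ∀ B ∈ L, IsMid L i B → ∃ D ∈ L, AdjIn (oth i B.2) B D

/-- The vertices of `D` off its side of direction `i` at `w` belong to no lozenge of `K`. -/
def FreshAt (K : Set Loz) (i : Dir) (w : Vtx) (D : Loz) : Prop :=
  ∀ x ∈ verts D, x ≠ w → x ≠ tip i w → ∀ B ∈ K, x ∉ verts B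

/-- The combinatorial properties of verdant tilings. -/
structure Good (L : Set Loz) : Prop where
  finite : L.Finite
  packed : Packed L
  conn : Conn L
  runs : RunsOfThree L
  braced : Braced L
  -- Every connected part `K` is allowed, because the part already built when the search reaches `D`
  -- depends on the order of the work list.
  fresh_up : ∀ K ⊆ L, Conn K → ∀ A ∈ K, ∀ D ∈ L, D ∉ K → ∀ i, StepUp i A D →
    FreshAt K i (up i A) D
  fresh_down : ∀ K ⊆ L, Conn K → ∀ A ∈ K, ∀ D ∈ L, D ∉ K → ∀ i, StepUp i D A →
    FreshAt K i (lo i A) D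

theorem lo_mem_verts {i : Dir} {l : Loz} (h : i ≠ l.2) : lo i l ∈ verts l := by
  obtain ⟨⟨x, y⟩, m⟩ := l
  cases i <;> cases m <;> simp_all [lo, verts, dn, apex]

theorem up_mem_verts {i : Dir} {l : Loz} (h : i ≠ l.2) : up i l ∈ verts l := by
  obtain ⟨⟨x, y⟩, m⟩ := l
  cases i <;> cases m <;> simp_all [up, verts, dn, apex]

theorem tip_lo_mem_verts {i : Dir} {l : Loz} (h : i ≠ l.2) : tip i (lo i l) ∈ verts l := by
  obtain ⟨⟨x, y⟩, m⟩ := l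
  cases i <;> cases m <;> simp_all [lo, verts, dn, apex, tip]

theorem tip_up_mem_verts {i : Dir} {l : Loz} (h : i ≠ l.2) : tip i (up i l) ∈ verts l := by
  obtain ⟨⟨x, y⟩, m⟩ := l
  cases i <;> cases m <;> simp_all [up, verts, dn, apex, tip]

/-! ### Boolean search and Boolean tests on lists of lozenges -/

/-- The lozenges above the lattice edge of direction `i` at `w`. -/
def above : Dir → Vtx → List Loz
  | .a, w => [(w, .b), (w, .c)]
  | .b, w => [(w, .a), (w, .c)]
  | .c, w => [((w.1 - 1, w.2 + 1), .a), (w, .b)]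

/-- The lozenges below the lattice edge of direction `i` at `w`. -/
def below : Dir → Vtx → List Loz
  | .a, w => [((w.1 + 1, w.2 - 1), .b), ((w.1, w.2 - 1), .c)]
  | .b, w => [((w.1 - 1, w.2 + 1), .a), ((w.1 - 1, w.2), .c)]
  | .c, w => [((w.1 - 1, w.2), .a), ((w.1 - 1, w.2), .b)]

/-- Equality of integers as a Boolean that the kernel evaluates fast. -/
def intEq : ℤ → ℤ → Bool
  | .ofNat m, .ofNat n => Nat.beq m n
  | .negSucc m, .negSucc n => Nat.beq m n
  | _, _ => false

/-- Equality of vertices as a Boolean. -/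
def vtxEq (x y : Vtx) : Bool := intEq x.1 y.1 && intEq x.2 y.2

/-- Equality of directions as a Boolean. -/
def dirEq : Dir → Dir → Bool
  | .a, .a => true
  | .b, .b => true
  | .c, .c => true
  | _, _ => false

/-- Equality of lozenges as a Boolean. -/
def lozEq (A B : Loz) : Bool := vtxEq A.1 B.1 && dirEq A.2 B.2

/-- Membership of a lozenge in a list as a Boolean. -/
def lozMem (A : Loz) (K : List Loz) : Bool := K.any (lozEq A)

/-- Decidable form of `StepUp`. -/
def stepUp (i : Dir) (A B : Loz) : Bool :=
  vtxEq (up i A) (lo i B) && !dirEq i A.2 && !dirEq i B.2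

/-- Decidable form of `FreshAt` for lists. -/
def freshAt (K : List Loz) (i : Dir) (w : Vtx) (D : Loz) : Bool :=
  (verts D).all fun x =>
    vtxEq x w || vtxEq x (tip i w) || K.all fun B => !((verts B).any (vtxEq x))

/-- The lozenges that may be attached above `A`. -/
def ups (K : List Loz) (i : Dir) (A : Loz) : List Loz :=
  (above i (up i A)).filter (freshAt K i (up i A))

/-- The lozenges that may be attached below `A`. -/
def downs (K : List Loz) (i : Dir) (A : Loz) : List Loz :=
  (below i (lo i A)).filter (freshAt K i (lo i A))

/-- Whether `F` holds for all ways to make `A` the middle of a run of direction `i`. -/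
def midAll (K : List Loz) (i : Dir) (A : Loz) (F : Loz → Loz → Bool) : Bool :=
  (ups K i A).all fun B => (downs (B :: K) i A).all fun C => F B C

/-- Depth first search for all tilings that contain the lozenges `K`, where the entries `(A, i, f)`
of the work list stand for lozenges `A` whose runs of direction `i` have not been looked at.
If `f = 2` then `A` has to be the middle of such a run; if `f = 1` then `A` has to be the middle of
such a run or next to a middle that is the middle of two runs. -/
def search (goal : List Loz → Bool) : ℕ → List Loz → List (Loz × Dir × ℕ) → Bool
  -- Running out of fuel counts as failure, so success certifies that the search was exhaustive.
  | 0, _, _ => false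
  | _ + 1, K, [] => goal K
  | n + 1, K, (A, i, f) :: W =>
    -- Three cases: `A` has no neighbour in direction `i`, is the middle of its run, or is an end of
    -- it. In the last case the new middle `B` inherits the raised flag `f + 1`.
    (f != 0 || search goal n K W) &&
    midAll K i A (fun B C =>
      search goal n (C :: B :: K) ((B, oth i B.2, 0) :: (C, oth i C.2, 0) :: W)) &&
    (f == 2 || ((ups K i A).all (fun B => (ups (B :: K) i B).all fun C =>
      search goal n (C :: B :: K) ((B, oth i B.2, f + 1) :: (C, oth i C.2, 0) :: W)) &&
    (downs K i A).all (fun B => (downs (B :: K) i B).all fun C =>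
      search goal n (C :: B :: K) ((B, oth i B.2, f + 1) :: (C, oth i C.2, 0) :: W))))

/-- The search from a lozenge `X` that has four neighbours. -/
def searchAt (goal : List Loz → Bool) (n : ℕ) (X : Loz) (i : Dir) : Bool :=
  midAll [X] i X fun B C => midAll [C, B, X] (oth i X.2) X fun D E =>
    search goal n [E, D, C, B, X] [(D, oth (oth i X.2) D.2, 0), (E, oth (oth i X.2) E.2, 0),
      (B, oth i B.2, 0), (C, oth i C.2, 0)]

/-- Around a lozenge `X` with four neighbours there are no two lozenges `Y`, `Z`, where `Y` is next
to `X` and `Z` is next to `Y`, that are the middles of further runs. -/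
def isShallow (X : Loz) (i : Dir) : Bool :=
  midAll [X] i X fun B C => midAll [C, B, X] (oth i X.2) X fun D E =>
    [(B, i), (C, i), (D, oth i X.2), (E, oth i X.2)].all fun Y =>
      midAll [E, D, C, B, X] (oth Y.2 Y.1.2) Y.1 fun Z Z' => [Z, Z'].all fun z =>
        -- With the constant `false`, the innermost test says that no admissible pair is left.
        midAll [Z', Z, E, D, C, B, X] (oth (oth Y.2 Y.1.2) z.2) z fun _ _ => false

/-- Whether `D` may be attached to a lozenge of `K`. -/
def attachable (K : List Loz) (D : Loz) : Bool :=
  [Dir.a, Dir.b, Dir.c].any fun i => K.any fun A =>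
    (stepUp i A D && freshAt K i (up i A) D) ||
      (stepUp i D A && freshAt K i (lo i A) D)

/-- Every lozenge of the list is attached to the preceding ones. -/
def isShelling : List Loz → Bool
  | [] => true
  | [_] => true
  | D :: K => isShelling K && attachable K D

/-- Rearrange a list into a shelling, if possible. -/
def grow (S : List Loz) : ℕ → List Loz → List Loz
  | 0, K => K
  | n + 1, K =>
    match S.find? fun D => !lozMem D K && attachable K D with
    | some D => grow S n (D :: K)
    | none => K

def dirs : List Dir := [.a, .b, .c]

def hasUp (K : List Loz) (i : Dir) (A : Loz) : Bool := K.any fun B => stepUp i A B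

def hasDown (K : List Loz) (i : Dir) (A : Loz) : Bool := K.any fun B => stepUp i B A

/-- Whether a lozenge has a neighbour in direction `i`. -/
def hasIn (K : List Loz) (i : Dir) (A : Loz) : Bool := hasUp K i A || hasDown K i A

/-- Decidable form of `RunsOfThree`. -/
def runsOfThree (K : List Loz) : Bool :=
  dirs.all fun i => K.all fun A => K.all fun B => !stepUp i A B ||
    (hasUp K i B ^^ hasDown K i A)

/-- Decidable form of `IsMid`. -/
def isMid (K : List Loz) (i : Dir) (B : Loz) : Bool := hasUp K i B && hasDown K i B

/-- Decidable form of `Braced`. -/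
def braced (K : List Loz) : Bool :=
  dirs.all fun i => K.all fun B => !isMid K i B || hasIn K (oth i B.2) B

/-- The number of runs of three. -/
def midCount (K : List Loz) : ℕ := ((dirs.product K).filter fun q => isMid K q.1 q.2).length

/-- A sufficient condition for the lozenges of `S` to form a tredoku tiling. -/
def isTiling (S : List Loz) (τ ρ : ℕ) : Bool :=
  let K := grow S S.length (S.take 1)
  decide (K.length = τ) && isShelling K && decide (midCount K = ρ) && runsOfThree K && braced K &&
    K.all (fun A => lozMem A S) && S.all (fun A => lozMem A K) && decide (4 < K.length)

/-- The lozenges of `K` that have four neighbours. -/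
def crossings (K : List Loz) : List Loz :=
  K.filter fun X => (dirs.filter fun i => isMid K i X).length == 2

/-- The runs of `K` through the lozenge `X`. -/
def star (K : List Loz) (X : Loz) : List Loz :=
  K.filter fun A => dirs.any fun i => stepUp i A X || stepUp i X A

/-- The part of `K` that belongs to the crossing `X`. -/
def part (K : List Loz) (X : Loz) : List Loz :=
  -- The two runs that cross at `X`, and each further run whose middle is a neighbour of `X`.
  -- Repetitions are harmless, since lists are compared by membership.
  (X :: star K X ++ ((star K X).filter fun Y => dirs.any fun i => isMid K i Y).flatMap
    (star K))

/-- The intersection of the lists consists of one lozenge. -/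
def meetOnce (A B : List Loz) : Bool :=
  A.any fun X => lozMem X B && A.all fun Y => !lozMem Y B || lozEq Y X

def covers (K A B : List Loz) : Bool :=
  K.all (fun X => lozMem X A || lozMem X B) && A.all (fun X => lozMem X K) &&
    B.all fun X => lozMem X K

/-- `K` is the single merging of a part of type `τ.ρ` and a part of type `τ'.ρ'`. -/
def isMerging (K : List Loz) (τ ρ τ' ρ' : ℕ) : Bool :=
  let P := (crossings K).map (part K)
  P.any fun A => isTiling A τ ρ && P.any fun B =>
    isTiling B τ' ρ' && covers K A B && meetOnce A B

/-- `K` is a chain of three parts. -/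
def isDoubleMerging (K : List Loz) : Bool :=
  let P := (crossings K).map (part K)
  P.any fun B => isTiling B 5 2 && P.any fun A => isTiling A 7 3 && meetOnce A B &&
    isTiling (A ++ B) 11 5 && P.any fun C =>
      isTiling C 7 3 && isTiling (B ++ C) 11 5 && meetOnce B C && covers K (A ++ B) C &&
        meetOnce (A ++ B) C

/-- What is claimed about the tilings with a crossing. -/
def decomposes (K : List Loz) : Bool :=
  match K.length with
  | 5 => true
  | 7 => true
  | 9 => isMerging K 5 2 5 2
  | 11 => isMerging K 5 2 7 3
  | 13 => isMerging K 7 3 7 3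
  | 17 => isDoubleMerging K
  | _ => false

/-! ### Meaning of the Boolean tests and uniqueness of attachment -/

theorem intEq_iff {m n : ℤ} : intEq m n = true ↔ m = n := by
  cases m <;> cases n <;> simp [intEq]

theorem vtxEq_iff {x y : Vtx} : vtxEq x y = true ↔ x = y := by
  simp [vtxEq, intEq_iff, Prod.ext_iff]

theorem dirEq_iff {i j : Dir} : dirEq i j = true ↔ i = j := by
  cases i <;> cases j <;> simp [dirEq]

theorem lozEq_iff {A B : Loz} : lozEq A B = true ↔ A = B := by
  simp [lozEq, vtxEq_iff, dirEq_iff, Prod.ext_iff]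

theorem lozMem_iff {A : Loz} {K : List Loz} : lozMem A K = true ↔ A ∈ K := by
  simp [lozMem, lozEq_iff]

theorem stepUp_iff {i : Dir} {A B : Loz} : stepUp i A B = true ↔ StepUp i A B := by
  simp only [stepUp, StepUp, Bool.and_eq_true, vtxEq_iff, Bool.not_eq_true', ← Bool.not_eq_true,
    dirEq_iff]
  tauto

theorem freshAt_iff {K : List Loz} {i : Dir} {w : Vtx} {D : Loz} :
    freshAt K i w D = true ↔ FreshAt {B | B ∈ K} i w D := by
  simp only [freshAt, FreshAt, List.all_eq_true, Bool.or_eq_true, vtxEq_iff, Bool.not_eq_true',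
    ← Bool.not_eq_true, List.any_eq_true, Set.mem_ofPred_eq]
  refine forall₂_congr fun x _ => ?_
  constructor
  · rintro (h | h) h1 h2 B hB hx
    · tauto
    · exact h B hB ⟨x, hx, rfl⟩
  · intro h
    by_cases h1 : x = w ∨ x = tip i w
    · exact Or.inl h1
    · refine Or.inr fun B hB ⟨y, hy, hxy⟩ => ?_
      subst hxy
      exact h (fun h => h1 (Or.inl h)) (fun h => h1 (Or.inr h)) B hB hy

theorem mem_above {i : Dir} {A B : Loz} (h : StepUp i A B) : B ∈ above i (up i A) := by
  obtain ⟨⟨x, y⟩, m⟩ := A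
  obtain ⟨⟨x', y'⟩, m'⟩ := B
  obtain ⟨h1, h2, h3⟩ := h
  rw [h3]
  cases i <;> cases m' <;> simp_all [above, lo, dn]

theorem mem_below {i : Dir} {A B : Loz} (h : StepUp i B A) : B ∈ below i (lo i A) := by
  obtain ⟨⟨x, y⟩, m⟩ := A
  obtain ⟨⟨x', y'⟩, m'⟩ := B
  obtain ⟨h1, h2, h3⟩ := h
  generalize lo i ((x, y), m) = w at h3
  subst h3
  cases i <;> cases m' <;> simp_all [below, up, dn]

/-- A pair of lattice neighbours is the pair of ends of only one edge, written with only one start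
and direction. -/
theorem edge_unique {i j : Dir} {w e : Vtx} (h1 : e = w ∨ e = tip i w)
    (h2 : tip j e = w ∨ tip j e = tip i w) : j = i ∧ e = w := by
  obtain ⟨x, y⟩ := w
  obtain ⟨x', y'⟩ := e
  cases i <;> cases j <;> simp only [tip, Prod.mk.injEq, reduceCtorEq, true_and, false_and] at * <;>
    omega

theorem lo_ne_up {i : Dir} {D : Loz} (h : i ≠ D.2) : lo i D ≠ up i D := by
  obtain ⟨⟨x, y⟩, m⟩ := D
  cases i <;> cases m <;> simp_all [lo, up, dn]

/-- The ends of a side shared by `B` and `D` are vertices of a lozenge of `K`, hence not fresh,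
hence ends of the attaching edge. -/
theorem FreshAt.edge_unique {K : Set Loz} {i j : Dir} {w : Vtx} {D B : Loz}
    (h : FreshAt K i w D) (hB : B ∈ K) (hj : AdjIn j B D) :
    j = i ∧ (if StepUp j B D then lo j D else up j D) = w := by
  split_ifs with hs
  · have h1 := lo_mem_verts hs.2.1
    have h2 := tip_lo_mem_verts hs.2.1
    have h3 := up_mem_verts hs.1
    have h4 := tip_up_mem_verts hs.1
    rw [hs.2.2] at h3 h4
    apply Tredoku.edge_unique
    · by_contra hc
      exact h _ h1 (fun h => hc (Or.inl h)) (fun h => hc (Or.inr h)) _ hB h3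
    · by_contra hc
      exact h _ h2 (fun h => hc (Or.inl h)) (fun h => hc (Or.inr h)) _ hB h4
  · replace hs := hj.resolve_left hs
    have h1 := up_mem_verts hs.1
    have h2 := tip_up_mem_verts hs.1
    have h3 := lo_mem_verts hs.2.1
    have h4 := tip_lo_mem_verts hs.2.1
    rw [← hs.2.2] at h3 h4
    apply Tredoku.edge_unique
    · by_contra hc
      exact h _ h1 (fun h => hc (Or.inl h)) (fun h => hc (Or.inr h)) _ hB h3
    · by_contra hc
      exact h _ h2 (fun h => hc (Or.inl h)) (fun h => hc (Or.inr h)) _ hB h4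

/-- A lozenge that is attached to a packed set has only one neighbour there. -/
theorem Packed.adj_unique {K : Set Loz} (hK : Packed K) {A B D : Loz} {i j : Dir} (hA : A ∈ K)
    (hB : B ∈ K) (h : (StepUp i A D ∧ FreshAt K i (up i A) D) ∨
      (StepUp i D A ∧ FreshAt K i (lo i A) D)) (hj : AdjIn j B D) : B = A ∧ j = i := by
  rcases h with ⟨h, hf⟩ | ⟨h, hf⟩
  · obtain ⟨rfl, he⟩ := hf.edge_unique hB hj
    split_ifs at he with hs
    · exact ⟨hK.down_unique hB hA hs h, rfl⟩
    · exact absurd (h.2.2.symm.trans he.symm) (lo_ne_up h.2.1)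
  · obtain ⟨rfl, he⟩ := hf.edge_unique hB hj
    split_ifs at he with hs
    · exact absurd (he.trans h.2.2.symm) (lo_ne_up h.1)
    · exact ⟨hK.up_unique hB hA (hj.resolve_left hs) h, rfl⟩

theorem Good.fresh {L : Set Loz} (hL : Good L) {K : Set Loz} (hK : K ⊆ L) (hc : Conn K)
    {A D : Loz} {i : Dir} (hA : A ∈ K) (hD : D ∈ L) (hDK : D ∉ K) (h : AdjIn i A D) :
    (StepUp i A D ∧ FreshAt K i (up i A) D) ∨ (StepUp i D A ∧ FreshAt K i (lo i A) D) :=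
  h.imp (fun h => ⟨h, hL.fresh_up K hK hc A hA D hD hDK i h⟩)
    fun h => ⟨h, hL.fresh_down K hK hc A hA D hD hDK i h⟩

theorem Good.adj_unique {L : Set Loz} (hL : Good L) {K : Set Loz} (hK : K ⊆ L) (hc : Conn K)
    {A B D : Loz} {i j : Dir} (hA : A ∈ K) (hD : D ∈ L) (hDK : D ∉ K) (h : AdjIn i A D)
    (hB : B ∈ K) (hj : AdjIn j B D) : B = A ∧ j = i :=
  (hL.packed.mono hK).adj_unique hA hB (hL.fresh hK hc hA hD hDK h) hj

theorem AdjIn.ne_left {i : Dir} {A B : Loz} (h : AdjIn i A B) : i ≠ A.2 :=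
  h.elim (fun h => h.1) fun h => h.2.1

theorem IsMid.ne {L : Set Loz} {i : Dir} {B : Loz} (h : IsMid L i B) : i ≠ B.2 :=
  h.2.elim fun _ h => h.2.1

/-! ### Soundness of the search -/

/-- What the flag `f` of an entry `(A, i, f)` of the work list says. -/
def FlagHolds (L : Set Loz) (A : Loz) (i : Dir) (f : ℕ) : Prop :=
  f = 0 ∨ (f = 1 ∧ (IsMid L i A ∨
    ∃ M ∈ L, AdjIn i A M ∧ IsMid L i M ∧ IsMid L (oth i M.2) M)) ∨ (f = 2 ∧ IsMid L i A)

/-- The invariant of the search for `L`. -/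
structure SearchInv (L : Set Loz) (K : List Loz) (W : List (Loz × Dir × ℕ)) : Prop where
  sub : ∀ A ∈ K, A ∈ L
  conn : Conn {A | A ∈ K}
  ne : K ≠ []
  nodup : K.Nodup
  keys : (W.map fun e => (e.1, e.2.1)).Nodup
  entry : ∀ A i f, (A, i, f) ∈ W → A ∈ K ∧ i ≠ A.2 ∧ (∀ B ∈ L, AdjIn i A B → B ∉ K) ∧
    FlagHolds L A i f
  closed : ∀ A ∈ K, ∀ B ∈ L, ∀ j, AdjIn j A B → B ∈ K ∨ ∃ f, (A, j, f) ∈ W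

theorem SearchInv.perm {L : Set Loz} {K : List Loz} {W W' : List (Loz × Dir × ℕ)}
    (h : SearchInv L K W) (hW : W.Perm W') : SearchInv L K W' where
  sub := h.sub
  conn := h.conn
  ne := h.ne
  nodup := h.nodup
  keys := (hW.map _).nodup_iff.1 h.keys
  entry A i f hm := h.entry A i f (hW.mem_iff.2 hm)
  closed A hA B hB j hj := (h.closed A hA B hB j hj).imp id fun ⟨f, hf⟩ => ⟨f, hW.mem_iff.1 hf⟩

theorem SearchInv.pop {L : Set Loz} {K : List Loz} {W : List (Loz × Dir × ℕ)} {A : Loz} {i : Dir}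
    {f : ℕ} (h : SearchInv L K ((A, i, f) :: W)) (hA : ∀ B ∈ L, ¬ AdjIn i A B) :
    SearchInv L K W where
  sub := h.sub
  conn := h.conn
  ne := h.ne
  nodup := h.nodup
  keys := (List.nodup_cons.1 h.keys).2
  entry B j g hm := h.entry B j g (List.mem_cons_of_mem _ hm)
  closed B hB C hC j hj := by
    refine (h.closed B hB C hC j hj).imp id fun ⟨g, hg⟩ => ⟨g, ?_⟩
    rcases List.mem_cons.1 hg with hg | hg
    · cases hg
      exact absurd hj (hA C hC)
    · exact hg

theorem setOf_mem_cons (A : Loz) (K : List Loz) :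
    {B | B ∈ A :: K} = insert A {B | B ∈ K} := by
  ext B
  simp

/-- The step common to all branches in which `A` has a neighbour: the run through `A` is completed
by `B` and `C`. Each of them is attached to a connected part, so it has only one neighbour there.
Therefore no other open entry is affected, and the only new open directions are the cross directions
of `B` and `C`. -/
theorem SearchInv.push {L : Set Loz} (hL : Good L) {K : List Loz} {W : List (Loz × Dir × ℕ)}
    {A B C P : Loz} {i : Dir} {f g : ℕ} (h : SearchInv L K ((A, i, f) :: W))
    (hB : B ∈ L) (hC : C ∈ L) (hAB : AdjIn i A B) (hP : P = A ∨ P = B) (hPC : AdjIn i P C)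
    (hCK : C ∉ K) (hCB : C ≠ B) (hA' : ∀ D ∈ L, AdjIn i A D → D = B ∨ D = C)
    (hB' : ∀ D ∈ L, AdjIn i B D → D = A ∨ D = C) (hC' : ∀ D ∈ L, AdjIn i C D → D = A ∨ D = B)
    (hg : FlagHolds L B (oth i B.2) g) :
    SearchInv L (C :: B :: K) ((B, oth i B.2, g) :: (C, oth i C.2, 0) :: W) := by
  obtain ⟨hAK, hiA, hAn, -⟩ := h.entry A i f (List.mem_cons_self ..)
  have hBK : B ∉ K := hAn B hB hAB
  have hKL : {A | A ∈ K} ⊆ L := h.sub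
  have hK1 : {A | A ∈ B :: K} ⊆ L := by
    rw [setOf_mem_cons]
    exact Set.insert_subset hB hKL
  have hc1 : Conn {A | A ∈ B :: K} := by
    rw [setOf_mem_cons]
    exact h.conn.insert hAK ⟨i, hAB⟩
  have hP1 : P ∈ B :: K := by
    rcases hP with rfl | rfl
    · exact List.mem_cons_of_mem _ hAK
    · exact List.mem_cons_self ..
  have hC1 : C ∉ B :: K := by simp [hCK, hCB]
  have uB : ∀ {X j}, X ∈ K → AdjIn j X B → X = A ∧ j = i := fun hX hj =>
    hL.adj_unique hKL h.conn hAK hB hBK hAB hX hj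
  have uC : ∀ {X j}, X ∈ B :: K → AdjIn j X C → X = P ∧ j = i := fun hX hj =>
    hL.adj_unique hK1 hc1 hP1 hC hC1 hPC hX hj
  have hiB : i ≠ B.2 := hAB.symm.ne_left
  have hiC : i ≠ C.2 := hPC.symm.ne_left
  have hkeys := List.nodup_cons.1 h.keys
  have hW : ∀ {X j e}, (X, j, e) ∈ W → X ∈ K := fun hm =>
    (h.entry _ _ _ (List.mem_cons_of_mem _ hm)).1
  refine ⟨?_, ?_, by simp, ?_, ?_, ?_, ?_⟩
  · intro X hX
    rcases List.mem_cons.1 hX with rfl | hX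
    · exact hC
    · exact hK1 hX
  · rw [setOf_mem_cons]
    exact hc1.insert hP1 ⟨i, hPC⟩
  · exact List.nodup_cons.2 ⟨hC1, List.nodup_cons.2 ⟨hBK, h.nodup⟩⟩
  · simp only [List.map_cons, List.nodup_cons, List.mem_cons, List.mem_map, not_or, not_exists,
      not_and, Prod.mk.injEq, Prod.forall]
    refine ⟨⟨fun hBC => absurd hBC.symm hCB, ?_⟩, ?_, hkeys.2⟩
    · rintro x y m j e hm rfl
      exact absurd (hW hm) hBK
    · rintro x y m j e hm rfl
      exact absurd (hW hm) hCK
  · intro X j e hXj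
    rcases List.mem_cons.1 hXj with hm | hXj'
    · cases hm
      refine ⟨by simp, oth_ne_right hiB, ?_, hg⟩
      intro D hD hj hDK
      rcases List.mem_cons.1 hDK with rfl | hDK
      · exact oth_ne_left hiB (uC (List.mem_cons_self ..) hj).2
      rcases List.mem_cons.1 hDK with rfl | hDK
      · exact hj.ne rfl
      · exact oth_ne_left hiB (uB hDK hj.symm).2
    rcases List.mem_cons.1 hXj' with hm | hXW
    · cases hm
      refine ⟨by simp, oth_ne_right hiC, ?_, Or.inl rfl⟩
      intro D hD hj hDK
      rcases List.mem_cons.1 hDK with rfl | hDK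
      · exact hj.ne rfl
      · exact oth_ne_left hiC (uC hDK hj.symm).2
    · obtain ⟨h1, h2, h3, h4⟩ := h.entry X j e (List.mem_cons_of_mem _ hXW)
      refine ⟨by simp [h1], h2, ?_, h4⟩
      intro D hD hj hDK
      -- The keys of the work list are distinct, so the entry just treated does not occur again.
      have hne : ¬ (X = A ∧ j = i) := by
        rintro ⟨rfl, rfl⟩
        exact hkeys.1 (List.mem_map.2 ⟨_, hXW, rfl⟩)
      rcases List.mem_cons.1 hDK with rfl | hDK
      · obtain ⟨rfl, rfl⟩ := uC (List.mem_cons_of_mem _ h1) hj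
        rcases hP with rfl | rfl
        · exact hne ⟨rfl, rfl⟩
        · exact hBK h1
      rcases List.mem_cons.1 hDK with rfl | hDK
      · exact hne (uB h1 hj)
      · exact h3 D hD hj hDK
  · intro X hX Y hY j hj
    have cross : ∀ {Z}, i ≠ Z.2 → X = Z → j ≠ i → j = oth i Z.2 := by
      rintro Z hZ rfl hji
      exact (eq_or_eq_oth hZ hj.ne_left).resolve_left hji
    by_cases hji : j = i
    · subst hji
      rcases List.mem_cons.1 hX with rfl | hX
      · left
        rcases hC' Y hY hj with rfl | rfl <;> simp [hAK]
      rcases List.mem_cons.1 hX with rfl | hX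
      · left
        rcases hB' Y hY hj with rfl | rfl <;> simp [hAK]
      · rcases h.closed X hX Y hY j hj with h1 | ⟨e, he⟩
        · exact Or.inl (by simp [h1])
        rcases List.mem_cons.1 he with he | he
        · cases he
          left
          rcases hA' Y hY hj with rfl | rfl <;> simp
        · exact Or.inr ⟨e, by simp [he]⟩
    · rcases List.mem_cons.1 hX with hXC | hX
      · have := cross hiC hXC hji
        subst hXC
        exact Or.inr ⟨0, by simp [← this]⟩
      rcases List.mem_cons.1 hX with hXB | hX
      · have := cross hiB hXB hji
        subst hXB
        exact Or.inr ⟨g, by simp [← this]⟩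
      · rcases h.closed X hX Y hY j hj with h1 | ⟨e, he⟩
        · exact Or.inl (by simp [h1])
        rcases List.mem_cons.1 he with he | he
        · cases he
          exact absurd rfl hji
        · exact Or.inr ⟨e, by simp [he]⟩

theorem Good.mem_ups {L : Set Loz} (hL : Good L) {K : List Loz} (hK : {A | A ∈ K} ⊆ L)
    (hc : Conn {A | A ∈ K}) {A B : Loz} {i : Dir} (hA : A ∈ K) (hB : B ∈ L) (hBK : B ∉ K)
    (h : StepUp i A B) : B ∈ ups K i A :=
  List.mem_filter.2 ⟨mem_above h, freshAt_iff.2 (hL.fresh_up _ hK hc A hA B hB hBK i h)⟩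

theorem Good.mem_downs {L : Set Loz} (hL : Good L) {K : List Loz} (hK : {A | A ∈ K} ⊆ L)
    (hc : Conn {A | A ∈ K}) {A B : Loz} {i : Dir} (hA : A ∈ K) (hB : B ∈ L) (hBK : B ∉ K)
    (h : StepUp i B A) : B ∈ downs K i A :=
  List.mem_filter.2 ⟨mem_below h, freshAt_iff.2 (hL.fresh_down _ hK hc A hA B hB hBK i h)⟩

theorem SearchInv.sub_cons {L : Set Loz} {K : List Loz} {W : List (Loz × Dir × ℕ)}
    (h : SearchInv L K W) {B : Loz} (hB : B ∈ L) : {X | X ∈ B :: K} ⊆ L := by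
  rw [setOf_mem_cons]
  exact Set.insert_subset hB h.sub

theorem SearchInv.conn_cons {L : Set Loz} {K : List Loz} {W : List (Loz × Dir × ℕ)}
    (h : SearchInv L K W) {A B : Loz} {i : Dir} (hA : A ∈ K) (hAB : AdjIn i A B) :
    Conn {X | X ∈ B :: K} := by
  rw [setOf_mem_cons]
  exact h.conn.insert hA ⟨i, hAB⟩

theorem SearchInv.mid {L : Set Loz} (hL : Good L) {K : List Loz} {W : List (Loz × Dir × ℕ)}
    {A : Loz} {i : Dir} {f : ℕ} (h : SearchInv L K ((A, i, f) :: W)) (hA : IsMid L i A)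
    {F : Loz → Loz → Bool} (hF : midAll K i A F = true) :
    ∃ B ∈ L, ∃ C ∈ L, StepUp i A B ∧ StepUp i C A ∧ F B C = true ∧
      SearchInv L (C :: B :: K) ((B, oth i B.2, 0) :: (C, oth i C.2, 0) :: W) := by
  obtain ⟨⟨C, hC, hCA⟩, B, hB, hAB⟩ := hA
  obtain ⟨hAK, -, hAn, -⟩ := h.entry A i f (List.mem_cons_self ..)
  have hCB : C ≠ B := by
    rintro rfl
    have hA0 := h.sub A hAK
    rcases hL.runs i A hA0 C hC hAB with ⟨-, h⟩ | ⟨-, h⟩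
    · exact h ⟨C, hC, hCA⟩
    · exact h ⟨A, hA0, hCA⟩
  have hBK := hAn B hB (Or.inl hAB)
  have hCK := hAn C hC (Or.inr hCA)
  refine ⟨B, hB, C, hC, hAB, hCA, ?_, ?_⟩
  · rw [midAll, List.all_eq_true] at hF
    have h1 := hF B (hL.mem_ups h.sub h.conn hAK hB hBK hAB)
    rw [List.all_eq_true] at h1
    exact h1 C (hL.mem_downs (h.sub_cons hB) (h.conn_cons hAK (Or.inl hAB))
      (List.mem_cons_of_mem _ hAK) hC (by simp [hCB, hCK]) hCA)
  · have hAL := h.sub A hAK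
    have nB : ¬ ∃ D ∈ L, StepUp i B D := by
      rcases hL.runs i A hAL B hB hAB with ⟨-, h⟩ | ⟨-, h⟩
      · exact absurd ⟨C, hC, hCA⟩ h
      · exact h
    have nC : ¬ ∃ D ∈ L, StepUp i D C := by
      rcases hL.runs i C hC A hAL hCA with ⟨-, h⟩ | ⟨-, h⟩
      · exact h
      · exact absurd ⟨B, hB, hAB⟩ h
    refine h.push hL hB hC (Or.inl hAB) (Or.inl rfl) (Or.inr hCA) hCK hCB ?_ ?_ ?_ (Or.inl rfl)
    · rintro D hD (hd | hd)
      · exact Or.inl (hL.packed.up_unique hD hB hd hAB)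
      · exact Or.inr (hL.packed.down_unique hD hC hd hCA)
    · rintro D hD (hd | hd)
      · exact absurd ⟨D, hD, hd⟩ nB
      · exact Or.inl (hL.packed.down_unique hD hAL hd hAB)
    · rintro D hD (hd | hd)
      · exact Or.inl (hL.packed.up_unique hD hAL hd hCA)
      · exact absurd ⟨D, hD, hd⟩ nC

/-- The middle of a run is the middle of a second run, or it is the end of a run whose middle is
the middle of a second run. -/
def ShortChains (L : Set Loz) : Prop :=
  ∀ M ∈ L, ∀ i, IsMid L i M → IsMid L (oth i M.2) M ∨
    ∃ N ∈ L, AdjIn (oth i M.2) M N ∧ IsMid L (oth i M.2) N ∧ IsMid L (oth (oth i M.2) N.2) N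

/-- With no open entries the list is closed under adjacency in `L`, and `L` is connected. -/
theorem SearchInv.eq {L : Set Loz} (hL : Good L) {K : List Loz} (h : SearchInv L K []) :
    L = {A | A ∈ K} := by
  refine Set.Subset.antisymm (fun B hB => ?_) h.sub
  obtain ⟨A, hA⟩ := List.exists_mem_of_ne_nil K h.ne
  have := hL.conn A (h.sub A hA) B hB
  induction this with
  | refl => exact hA
  | tail _ h1 ih =>
    obtain ⟨h2, h3, j, hj⟩ := h1
    rcases h.closed _ (ih h2) _ h3 j hj with h | ⟨f, hf⟩
    · exact h
    · simp at hf

/-- Follows the lozenges of `L` through the clauses of `search`. The flag excludes the branches that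
`search` leaves out, and `ShortChains` justifies the first raising of the flag. -/
theorem search_sound {L : Set Loz} (hL : Good L) (hs : ShortChains L) {goal : List Loz → Bool} :
    ∀ (n : ℕ) (K : List Loz) (W : List (Loz × Dir × ℕ)), SearchInv L K W →
      search goal n K W = true → ∃ K' : List Loz, K'.Nodup ∧ L = {A | A ∈ K'} ∧ goal K' = true
  | 0, _, _, _, h => by simp [search] at h
  | n + 1, K, [], hi, h => ⟨K, hi.nodup, hi.eq hL, by simpa [search] using h⟩
  | n + 1, K, (A, i, f) :: W, hi, h => by
    simp only [search, Bool.and_eq_true, Bool.or_eq_true, bne_iff_ne, beq_iff_eq, ne_eq] at h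
    obtain ⟨⟨h1, h2⟩, h3⟩ := h
    obtain ⟨hAK, hiA, hAn, hf⟩ := hi.entry A i f (List.mem_cons_self ..)
    have hAL := hi.sub A hAK
    by_cases hex : ∃ B ∈ L, AdjIn i A B
    swap
    · have hf0 : f = 0 := by
        rcases hf with hf | ⟨-, ⟨⟨B, hB, hb⟩, -⟩ | ⟨M, hM, hm, -⟩⟩ | ⟨-, ⟨B, hB, hb⟩, -⟩
        · exact hf
        · exact absurd ⟨B, hB, Or.inr hb⟩ hex
        · exact absurd ⟨M, hM, hm⟩ hex
        · exact absurd ⟨B, hB, Or.inr hb⟩ hex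
      refine search_sound hL hs n K W (hi.pop fun B hB hb => hex ⟨B, hB, hb⟩) ?_
      exact h1.resolve_left (fun h => h hf0)
    by_cases hmid : IsMid L i A
    · obtain ⟨B, -, C, -, -, -, h4, h5⟩ := hi.mid hL hmid h2
      exact search_sound hL hs n _ _ h5 h4
    have hf2 : f ≠ 2 := by
      rcases hf with hf | ⟨hf, -⟩ | ⟨-, h⟩
      · omega
      · omega
      · exact absurd h hmid
    have h3 := h3.resolve_left hf2
    -- Raising `0` to `1` is `ShortChains` for `B`. Raising `1` to `2` uses that `A`, not being a
    -- middle, has only one neighbour in direction `i`, so `B` is the crossing that the flag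
    -- promised.
    have hflag : ∀ B ∈ L, AdjIn i A B → IsMid L i B → FlagHolds L B (oth i B.2) (f + 1) := by
      intro B hB hAB hBm
      rcases hf with rfl | ⟨rfl, h | ⟨M, hM, hAM, hMi, hMo⟩⟩ | ⟨-, h⟩
      · exact Or.inr (Or.inl ⟨rfl, hs B hB i hBm⟩)
      · exact absurd h hmid
      · have : B = M := by
          rcases hAB with hb | hb <;> rcases hAM with hm | hm
          · exact hL.packed.up_unique hB hM hb hm
          · exact absurd ⟨⟨M, hM, hm⟩, B, hB, hb⟩ hmid
          · exact absurd ⟨⟨B, hB, hb⟩, M, hM, hm⟩ hmid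
          · exact hL.packed.down_unique hB hM hb hm
        subst this
        exact Or.inr (Or.inr ⟨rfl, hMo⟩)
      · exact absurd h hmid
    obtain ⟨B, hB, hAB⟩ := hex
    have hBK := hAn B hB hAB
    rcases hAB with hAB | hAB
    · obtain ⟨⟨C, hC, hBC⟩, nA⟩ := (hL.runs i A hAL B hB hAB).resolve_right
        fun h => hmid ⟨h.1, B, hB, hAB⟩
      have nC : ¬ ∃ D ∈ L, StepUp i C D := by
        rcases hL.runs i B hB C hC hBC with ⟨-, h⟩ | ⟨-, h⟩
        · exact absurd ⟨A, hAL, hAB⟩ h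
        · exact h
      have hCB : C ≠ B := hBC.ne.symm
      have hCA : C ≠ A := by
        rintro rfl
        exact nC ⟨B, hB, hAB⟩
      -- Otherwise `B` would have the two neighbours `A` and `C` in the connected part `K`.
      have hCK : C ∉ K := fun hCK =>
        hCA (hL.adj_unique hi.sub hi.conn hAK hB hBK (Or.inl hAB) hCK (Or.inr hBC)).1
      have h4 := List.all_eq_true.1 h3.1 B (hL.mem_ups hi.sub hi.conn hAK hB hBK hAB)
      have h5 := List.all_eq_true.1 h4 C (hL.mem_ups (hi.sub_cons hB)
        (hi.conn_cons hAK (Or.inl hAB)) (List.mem_cons_self ..) hC (by simp [hCB, hCK]) hBC)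
      refine search_sound hL hs n _ _ (hi.push hL hB hC (Or.inl hAB) (Or.inr rfl) (Or.inl hBC)
        hCK hCB ?_ ?_ ?_ (hflag B hB (Or.inl hAB) ⟨⟨A, hAL, hAB⟩, C, hC, hBC⟩)) h5
      · rintro D hD (hd | hd)
        · exact Or.inl (hL.packed.up_unique hD hB hd hAB)
        · exact absurd ⟨D, hD, hd⟩ nA
      · rintro D hD (hd | hd)
        · exact Or.inr (hL.packed.up_unique hD hC hd hBC)
        · exact Or.inl (hL.packed.down_unique hD hAL hd hAB)
      · rintro D hD (hd | hd)
        · exact absurd ⟨D, hD, hd⟩ nC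
        · exact Or.inr (hL.packed.down_unique hD hB hd hBC)
    · obtain ⟨⟨C, hC, hBC⟩, nA⟩ := (hL.runs i B hB A hAL hAB).resolve_left
        fun h => hmid ⟨⟨B, hB, hAB⟩, h.1⟩
      have nC : ¬ ∃ D ∈ L, StepUp i D C := by
        rcases hL.runs i C hC B hB hBC with ⟨-, h⟩ | ⟨-, h⟩
        · exact h
        · exact absurd ⟨A, hAL, hAB⟩ h
      have hCB : C ≠ B := hBC.ne
      have hCA : C ≠ A := by
        rintro rfl
        exact nC ⟨B, hB, hAB⟩
      have hCK : C ∉ K := fun hCK =>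
        hCA (hL.adj_unique hi.sub hi.conn hAK hB hBK (Or.inr hAB) hCK (Or.inl hBC)).1
      have h4 := List.all_eq_true.1 h3.2 B (hL.mem_downs hi.sub hi.conn hAK hB hBK hAB)
      have h5 := List.all_eq_true.1 h4 C (hL.mem_downs (hi.sub_cons hB)
        (hi.conn_cons hAK (Or.inr hAB)) (List.mem_cons_self ..) hC (by simp [hCB, hCK]) hBC)
      refine search_sound hL hs n _ _ (hi.push hL hB hC (Or.inr hAB) (Or.inr rfl) (Or.inr hBC)
        hCK hCB ?_ ?_ ?_ (hflag B hB (Or.inr hAB) ⟨⟨C, hC, hBC⟩, A, hAL, hAB⟩)) h5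
      · rintro D hD (hd | hd)
        · exact absurd ⟨D, hD, hd⟩ nA
        · exact Or.inl (hL.packed.down_unique hD hB hd hAB)
      · rintro D hD (hd | hd)
        · exact Or.inl (hL.packed.up_unique hD hAL hd hAB)
        · exact Or.inr (hL.packed.down_unique hD hC hd hBC)
      · rintro D hD (hd | hd)
        · exact Or.inr (hL.packed.up_unique hD hB hd hBC)
        · exact absurd ⟨D, hD, hd⟩ nC

theorem Conn.singleton (X : Loz) : Conn {X} := by
  rintro A rfl B rfl
  exact Relation.ReflTransGen.refl

/-- Flag `2` in both directions records that `X` is a crossing. -/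
theorem SearchInv.start {L : Set Loz} {X : Loz} {i : Dir} (hX : X ∈ L) (hi : IsMid L i X)
    (ho : IsMid L (oth i X.2) X) :
    SearchInv L [X] [(X, i, 2), (X, oth i X.2, 2)] where
  sub := by simp [hX]
  conn := by
    have : {A | A ∈ [X]} = {X} := by ext; simp
    rw [this]
    exact Conn.singleton X
  ne := by simp
  nodup := by simp
  keys := by simpa using (oth_ne_left hi.ne).symm
  entry := by
    intro A j f hm
    have hn : ∀ B ∈ L, AdjIn j X B → B ∉ [X] := by
      intro B _ hB h
      rw [List.mem_singleton] at h
      exact hB.ne h.symm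
    simp only [List.mem_cons, Prod.mk.injEq, List.not_mem_nil, or_false] at hm
    rcases hm with ⟨rfl, rfl, rfl⟩ | ⟨rfl, rfl, rfl⟩
    · exact ⟨by simp, hi.ne, hn, Or.inr (Or.inr ⟨rfl, hi⟩)⟩
    · exact ⟨by simp, ho.ne, hn, Or.inr (Or.inr ⟨rfl, ho⟩)⟩
  closed := by
    intro A hA B hB j hj
    rw [List.mem_singleton] at hA
    subst hA
    right
    refine ⟨2, ?_⟩
    rcases eq_or_eq_oth hi.ne hj.ne_left with rfl | rfl <;> simp

theorem SearchInv.start_mid {L : Set Loz} (hL : Good L) {X : Loz} {i : Dir} (hX : X ∈ L)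
    (hi : IsMid L i X) (ho : IsMid L (oth i X.2) X) {F : Loz → Loz → Loz → Loz → Bool}
    (hF : (midAll [X] i X fun B C => midAll [C, B, X] (oth i X.2) X fun D E => F B C D E) = true) :
    ∃ B ∈ L, ∃ C ∈ L, ∃ D ∈ L, ∃ E ∈ L, StepUp i X B ∧ StepUp i C X ∧ StepUp (oth i X.2) X D ∧
      StepUp (oth i X.2) E X ∧ F B C D E = true ∧
      SearchInv L [E, D, C, B, X] [(D, oth (oth i X.2) D.2, 0), (E, oth (oth i X.2) E.2, 0),
        (B, oth i B.2, 0), (C, oth i C.2, 0)] := by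
  obtain ⟨B, hB, C, hC, h1, h2, h3, h4⟩ := (SearchInv.start hX hi ho).mid hL hi hF
  have h5 : SearchInv L [C, B, X] [(X, oth i X.2, 2), (B, oth i B.2, 0), (C, oth i C.2, 0)] :=
    h4.perm (by
      refine (List.Perm.cons _ (List.Perm.swap _ _ _)).trans (List.Perm.swap _ _ _))
  obtain ⟨D, hD, E, hE, h6, h7, h8, h9⟩ := h5.mid hL ho h3
  exact ⟨B, hB, C, hC, D, hD, E, hE, h1, h2, h6, h7, h8, h9⟩

theorem searchAt_sound {L : Set Loz} (hL : Good L) (hs : ShortChains L) {X : Loz} {i : Dir}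
    (hX : X ∈ L) (hi : IsMid L i X) (ho : IsMid L (oth i X.2) X) {goal : List Loz → Bool} {n : ℕ}
    (h : searchAt goal n X i = true) :
    ∃ K : List Loz, K.Nodup ∧ L = {A | A ∈ K} ∧ goal K = true := by
  obtain ⟨B, -, C, -, D, -, E, -, -, -, -, -, h1, h2⟩ := SearchInv.start_mid hL hX hi ho h
  exact search_sound hL hs _ _ _ h2 h1

/-! ### Rotations and translations of the lattice -/

/-- Translation of a lozenge. -/
def shift (w : Vtx) (l : Loz) : Loz := ((w.1 + l.1.1, w.2 + l.1.2), l.2)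

/-- The action on directions of the rotation through 120 degrees. -/
def rotDir : Dir → Dir
  | .a => .c
  | .b => .a
  | .c => .b

/-- Rotation of a lozenge through 120 degrees about the origin. -/
def rot (l : Loz) : Loz := ((-l.1.1 - l.1.2 - 1, l.1.1), rotDir l.2)

/-- Rotation followed by translation. -/
def frame (w : Vtx) (k : ℕ) (l : Loz) : Loz := shift w (rot^[k] l)

theorem adjIn_shift {w : Vtx} {i : Dir} {A B : Loz} :
    AdjIn i (shift w A) (shift w B) ↔ AdjIn i A B := by
  obtain ⟨⟨x, y⟩, m⟩ := A
  obtain ⟨⟨x', y'⟩, m'⟩ := B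
  cases i <;> cases m <;> cases m' <;>
    simp only [AdjIn, StepUp, shift, up, lo, dn, ne_eq, reduceCtorEq, not_true_eq_false,
      not_false_eq_true, true_and, false_and, Prod.mk.injEq] <;> omega

/-- Stated for the unoriented `AdjIn`, because the rotation exchanges upper and lower sides for some
directions. The `-1` in `rot` arises because the image of the vertex `u + ω` becomes the corner of
the new upward triangle. -/
theorem adjIn_rot {i : Dir} {A B : Loz} :
    AdjIn (rotDir i) (rot A) (rot B) ↔ AdjIn i A B := by
  obtain ⟨⟨x, y⟩, m⟩ := A
  obtain ⟨⟨x', y'⟩, m'⟩ := B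
  cases i <;> cases m <;> cases m' <;>
    simp only [AdjIn, StepUp, rot, rotDir, up, lo, dn, ne_eq, reduceCtorEq, not_true_eq_false,
      not_false_eq_true, true_and, false_and, Prod.mk.injEq] <;> omega

theorem oth_rotDir (i m : Dir) : oth (rotDir i) (rotDir m) = rotDir (oth i m) := by
  cases i <;> cases m <;> rfl

theorem adjIn_rot_iterate {k : ℕ} {i : Dir} {A B : Loz} :
    AdjIn (rotDir^[k] i) (rot^[k] A) (rot^[k] B) ↔ AdjIn i A B := by
  induction k with
  | zero => rfl
  | succ k ih => rw [Function.iterate_succ_apply', Function.iterate_succ_apply',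
      Function.iterate_succ_apply', adjIn_rot, ih]

theorem adjIn_frame {w : Vtx} {k : ℕ} {i : Dir} {A B : Loz} :
    AdjIn (rotDir^[k] i) (frame w k A) (frame w k B) ↔ AdjIn i A B :=
  adjIn_shift.trans adjIn_rot_iterate

theorem oth_rotDir_iterate (k : ℕ) (i m : Dir) :
    oth (rotDir^[k] i) (rotDir^[k] m) = rotDir^[k] (oth i m) := by
  induction k with
  | zero => rfl
  | succ k ih => simp only [Function.iterate_succ_apply', oth_rotDir, ih]

theorem frame_snd (w : Vtx) (k : ℕ) (l : Loz) : (frame w k l).2 = rotDir^[k] l.2 := by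
  simp only [frame, shift]
  induction k with
  | zero => rfl
  | succ k ih => simp only [Function.iterate_succ_apply', rot, ih]

theorem shift_surjective (w : Vtx) : Function.Surjective (shift w) := fun l =>
  ⟨((l.1.1 - w.1, l.1.2 - w.2), l.2), by simp [shift]⟩

theorem rotDir_surjective : Function.Surjective rotDir := by
  rintro ⟨⟩
  exacts [⟨.b, rfl⟩, ⟨.c, rfl⟩, ⟨.a, rfl⟩]

theorem rot_surjective : Function.Surjective rot := fun l => by
  obtain ⟨m, hm⟩ := rotDir_surjective l.2
  refine ⟨((l.1.2, -l.1.1 - l.1.2 - 1), m), ?_⟩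
  simp only [rot, hm]
  ext <;> simp
  ring

theorem frame_surjective (w : Vtx) (k : ℕ) : Function.Surjective (frame w k) :=
  (shift_surjective w).comp (rot_surjective.iterate k)

theorem frame_injective (w : Vtx) (k : ℕ) : Function.Injective (frame w k) := by
  have h1 : Function.Injective (shift w) := fun A B h => by
    simp only [shift, Prod.mk.injEq, add_right_inj] at h
    exact Prod.ext (Prod.ext h.1.1 h.1.2) h.2
  have h2 : Function.Injective rot := fun A B h => by
    obtain ⟨⟨x, y⟩, m⟩ := A
    obtain ⟨⟨x', y'⟩, m'⟩ := B
    simp only [rot, Prod.mk.injEq] at h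
    have : m = m' := by
      cases m <;> cases m' <;> simp_all [rotDir]
    rw [this, h.1.2]
    have : y = y' := by omega
    rw [this]
  exact h1.comp (h2.iterate k)

/-- Recovers the oriented notion from unoriented adjacency: in a packed set two different neighbours
across parallel sides lie at opposite sides. -/
theorem isMid_of_adjIn {L : Set Loz} (hL : Packed L) {i : Dir} {A B C : Loz} (hA : A ∈ L)
    (hC : C ∈ L) (hAC : A ≠ C) (h1 : AdjIn i B A) (h2 : AdjIn i B C) : IsMid L i B := by
  rcases h1 with h1 | h1 <;> rcases h2 with h2 | h2
  · exact absurd (hL.up_unique hA hC h1 h2) hAC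
  · exact ⟨⟨C, hC, h2⟩, A, hA, h1⟩
  · exact ⟨⟨A, hA, h1⟩, C, hC, h2⟩
  · exact absurd (hL.down_unique hA hC h1 h2) hAC

/-- All images of `L` under rotations and translations are good. -/
def AllGood (L : Set Loz) : Prop := ∀ w k, Good {l | frame w k l ∈ L}

theorem StepUp.asymm {i : Dir} {A B : Loz} (h : StepUp i A B) (h' : StepUp i B A) : False := by
  obtain ⟨⟨x, y⟩, m⟩ := A
  obtain ⟨⟨x', y'⟩, m'⟩ := B
  revert h h'
  cases i <;> cases m <;> cases m' <;>
    simp only [StepUp, up, lo, dn, ne_eq, reduceCtorEq, not_true_eq_false,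
      not_false_eq_true, true_and, false_and, Prod.mk.injEq, false_imp_iff] <;> omega

theorem IsMid.frame {L : Set Loz} {w : Vtx} {k : ℕ} (hp : Packed {l | frame w k l ∈ L}) {i : Dir}
    {B : Loz} (h : IsMid L (rotDir^[k] i) (frame w k B)) : IsMid {l | frame w k l ∈ L} i B := by
  obtain ⟨⟨A, hA, hAB⟩, C, hC, hBC⟩ := h
  obtain ⟨A, rfl⟩ := frame_surjective w k A
  obtain ⟨C, rfl⟩ := frame_surjective w k C
  refine isMid_of_adjIn hp hA hC ?_ (adjIn_frame.1 (Or.inr hAB)) (adjIn_frame.1 (Or.inl hBC))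
  rintro rfl
  exact hAB.asymm hBC

theorem isMid_frame_iff {L : Set Loz} {w : Vtx} {k : ℕ} (hL : Packed L)
    (hp : Packed {l | frame w k l ∈ L}) {i : Dir} {B : Loz} :
    IsMid L (rotDir^[k] i) (Tredoku.frame w k B) ↔ IsMid {l | Tredoku.frame w k l ∈ L} i B := by
  refine ⟨fun h => h.frame hp, ?_⟩
  rintro ⟨⟨A, hA, hAB⟩, C, hC, hBC⟩
  have h1 := adjIn_frame (w := w) (k := k).2 (Or.inr hAB : AdjIn i B A)
  have h2 := adjIn_frame (w := w) (k := k).2 (Or.inl hBC : AdjIn i B C)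
  refine isMid_of_adjIn hL hA hC (fun h => ?_) h1 h2
  exact hAB.asymm (by rwa [← frame_injective w k h] at hBC)

/-- The rotations permute the three shapes of lozenges transitively, so every crossing can be moved
to one fixed lozenge. -/
theorem exists_frame (X : Loz) : ∃ w k, frame w k ((0, 0), .c) = X := by
  have : ∃ k, (rot^[k] ((0, 0), .c)).2 = X.2 := by
    obtain ⟨u, m⟩ := X
    cases m
    exacts [⟨2, rfl⟩, ⟨1, rfl⟩, ⟨0, rfl⟩]
  obtain ⟨k, hk⟩ := this
  refine ⟨(X.1.1 - (rot^[k] ((0, 0), .c)).1.1, X.1.2 - (rot^[k] ((0, 0), .c)).1.2), k, ?_⟩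
  simp only [frame, shift, hk]
  ext <;> simp

/-! ### Crossings in good sets, and the two computations -/

theorem isShallow_origin : isShallow ((0, 0), .c) .a = true := by decide +kernel

/-- The whole classification is in this evaluation. The fuel `60` only has to be large enough for
every branch to finish. -/
theorem searchAt_origin : searchAt decomposes 60 ((0, 0), .c) .a = true := by decide +kernel

theorem Good.mid_eq {L : Set Loz} (hL : Good L) {i : Dir} {A B C D : Loz}
    (hB : B ∈ L) (hC : C ∈ L) (hD : D ∈ L) (h1 : StepUp i A B) (h2 : StepUp i C A)
    (h : AdjIn i A D) : D = B ∨ D = C :=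
  h.imp (fun h => hL.packed.up_unique hD hB h h1) fun h => hL.packed.down_unique hD hC h h2

/-- Follows the nested `midAll` of `isShallow` with the actual lozenges of `L`; the innermost test
would have to return `true` for the constant `false`. -/
theorem Good.not_deep_origin {L : Set Loz} (hL : Good L) {Y Z : Loz} {i : Dir}
    (hX : ((0, 0), .c) ∈ L) (hY : Y ∈ L) (hZ : Z ∈ L)
    (h1 : IsMid L .a ((0, 0), .c)) (h2 : IsMid L .b ((0, 0), .c)) (hXY : AdjIn i ((0, 0), .c) Y)
    (hYm : IsMid L (oth i Y.2) Y) (hYZ : AdjIn (oth i Y.2) Y Z)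
    (hZm : IsMid L (oth (oth i Y.2) Z.2) Z) : False := by
  obtain ⟨B, hB, C, hC, D, hD, E, hE, hXB, hCX, hXD, hEX, hF, hi⟩ :=
    SearchInv.start_mid hL hX h1 h2 isShallow_origin
  have key : ∀ W, SearchInv L [E, D, C, B, ((0, 0), .c)] ((Y, oth i Y.2, 0) :: W) →
      (Y, i) ∈ [(B, Dir.a), (C, Dir.a), (D, Dir.b), (E, Dir.b)] → False := by
    intro W hW hm
    obtain ⟨P, hP, Q, hQ, hYP, hQY, h3, h4⟩ := hW.mid hL hYm (List.all_eq_true.1 hF _ hm)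
    have key' : ∀ W, SearchInv L [Q, P, E, D, C, B, ((0, 0), .c)]
        ((Z, oth (oth i Y.2) Z.2, 0) :: W) → Z ∈ [P, Q] → False := by
      intro W hW hm
      obtain ⟨_, -, _, -, -, -, h5, -⟩ := hW.mid hL hZm (List.all_eq_true.1 h3 _ hm)
      simp at h5
    rcases hL.mid_eq hP hQ hZ hYP hQY hYZ with rfl | rfl
    · exact key' _ h4 (by simp)
    · exact key' _ (h4.perm (List.Perm.swap _ _ _)) (by simp)
  rcases eq_or_eq_oth h1.ne hXY.ne_left with rfl | hi'
  · rcases hL.mid_eq hB hC hY hXB hCX hXY with rfl | rfl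
    · exact key _ (hi.perm (List.perm_middle (l₁ := [_, _]))) (by simp)
    · exact key _ (hi.perm (List.perm_middle (l₁ := [_, _, _]))) (by simp)
  · have : i = .b := hi'
    subst this
    rcases hL.mid_eq hD hE hY hXD hEX hXY with rfl | rfl
    · exact key _ hi (by simp)
    · exact key _ (hi.perm (List.perm_middle (l₁ := [_]))) (by simp)

/-- `X` is the middle of two runs. -/
def IsCrossing (L : Set Loz) (X : Loz) : Prop := ∀ i, i ≠ X.2 → IsMid L i X

theorem isCrossing_iff {L : Set Loz} {X : Loz} {i : Dir} (hi : i ≠ X.2) :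
    IsCrossing L X ↔ IsMid L i X ∧ IsMid L (oth i X.2) X := by
  refine ⟨fun h => ⟨h i hi, h _ (oth_ne_right hi)⟩, fun h j hj => ?_⟩
  rcases eq_or_eq_oth hi hj with rfl | rfl
  exacts [h.1, h.2]

theorem rotDir_iterate_injective (k : ℕ) : Function.Injective rotDir^[k] :=
  Function.Injective.iterate (fun i j h => by cases i <;> cases j <;> simp_all [rotDir]) k

theorem IsCrossing.frame {L : Set Loz} {w : Vtx} {k : ℕ} (hp : Packed {l | frame w k l ∈ L})
    {X : Loz} (h : IsCrossing L (frame w k X)) : IsCrossing {l | frame w k l ∈ L} X :=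
  fun i hi => IsMid.frame hp (h _ (by
    rw [frame_snd]
    exact fun h => hi (rotDir_iterate_injective k h)))

theorem AllGood.not_deep {L : Set Loz} (hL : AllGood L) {X Y Z : Loz} {i : Dir}
    (hX : X ∈ L) (hY : Y ∈ L) (hZ : Z ∈ L) (h : IsCrossing L X) (hXY : AdjIn i X Y)
    (hYm : IsMid L (oth i Y.2) Y) (hYZ : AdjIn (oth i Y.2) Y Z)
    (hZm : IsMid L (oth (oth i Y.2) Z.2) Z) : False := by
  obtain ⟨w, k, rfl⟩ := exists_frame X
  obtain ⟨Y, rfl⟩ := frame_surjective w k Y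
  obtain ⟨Z, rfl⟩ := frame_surjective w k Z
  obtain ⟨i, rfl⟩ := rotDir_surjective.iterate k i
  have hG := hL w k
  rw [frame_snd, oth_rotDir_iterate] at hYm hYZ hZm
  rw [frame_snd, oth_rotDir_iterate] at hZm
  have hc := h.frame hG.packed
  exact hG.not_deep_origin hX hY hZ (hc .a (by simp)) (hc .b (by simp)) (adjIn_frame.1 hXY)
    (hYm.frame hG.packed) (adjIn_frame.1 hYZ) (hZm.frame hG.packed)

theorem AllGood.good {L : Set Loz} (hL : AllGood L) : Good L := by
  have := hL (0, 0) 0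
  simpa [frame, shift] using this

/-- If `M` is not a crossing, its braced neighbour `D` in the other direction is the middle of that
run. The walk goes on from `D` outside the connected part visited so far, so it ends at a crossing
by induction on the number of unvisited lozenges. If that crossing were a lozenge `N` beyond `D`,
then `N`, `D`, `M` would form the configuration excluded by `not_deep`; so `D` is the crossing. -/
theorem AllGood.short_chain {L : Set Loz} (hL : AllGood L) :
    ∀ (n : ℕ) (K : Set Loz), K ⊆ L → Conn K → (L \ K).ncard ≤ n → ∀ M ∈ K, ∀ i, IsMid L i M →
      (∀ N ∈ L, AdjIn (oth i M.2) M N → N ∉ K) → IsMid L (oth i M.2) M ∨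
        ∃ N ∈ L, AdjIn (oth i M.2) M N ∧ IsMid L (oth i M.2) N ∧
          IsMid L (oth (oth i M.2) N.2) N := by
  have hG := hL.good
  intro n
  induction n with
  | zero =>
    intro K hK hc hn M hM i hi hN
    obtain ⟨D, hD, hMD⟩ := hG.braced i M (hK hM) hi
    have h1 : (L \ K).ncard = 0 := by omega
    rw [Set.ncard_eq_zero (hG.finite.subset Set.sdiff_subset)] at h1
    have h2 : D ∈ L \ K := ⟨hD, hN D hD hMD⟩
    rw [h1] at h2
    exact absurd h2 (Set.notMem_empty D)
  | succ n ih =>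
    intro K hK hc hn M hM i hi hN
    obtain ⟨D, hD, hMD⟩ := hG.braced i M (hK hM) hi
    have hDK := hN D hD hMD
    by_cases hMm : IsMid L (oth i M.2) M
    · exact Or.inl hMm
    have hDm : IsMid L (oth i M.2) D := by
      rcases hMD with h | h
      · rcases hG.runs _ M (hK hM) D hD h with ⟨⟨C, hC, h'⟩, -⟩ | ⟨⟨C, hC, h'⟩, -⟩
        · exact ⟨⟨M, hK hM, h⟩, C, hC, h'⟩
        · exact absurd ⟨⟨C, hC, h'⟩, D, hD, h⟩ hMm
      · rcases hG.runs _ D hD M (hK hM) h with ⟨⟨C, hC, h'⟩, -⟩ | ⟨⟨C, hC, h'⟩, -⟩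
        · exact absurd ⟨⟨D, hD, h⟩, C, hC, h'⟩ hMm
        · exact ⟨⟨C, hC, h'⟩, M, hK hM, h⟩
    have hj := hMD.symm.ne_left
    have := ih (insert D K) (Set.insert_subset hD hK) (hc.insert hM ⟨_, hMD⟩) (by
        have h1 : L \ insert D K ⊂ L \ K :=
          ⟨Set.sdiff_subset_sdiff_right (Set.subset_insert _ _),
            fun h => (h ⟨hD, hDK⟩).2 (Set.mem_insert _ _)⟩
        have := Set.ncard_lt_ncard h1 (hG.finite.subset Set.sdiff_subset)
        omega) D (Set.mem_insert _ _) _ hDm (by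
        rintro N hNL hDN (rfl | hNK)
        · exact hDN.ne rfl
        · exact oth_ne_left hj
            (hG.adj_unique hK hc hM hD hDK hMD hNK hDN.symm).2)
    refine Or.inr ⟨D, hD, hMD, hDm, ?_⟩
    refine this.resolve_right ?_
    rintro ⟨N, hNL, hDN, hNm, hNo⟩
    have hjN := hDN.symm.ne_left
    -- The walk read backwards: `N` is the crossing, `D` its neighbour, and `M` a further middle
    -- next to `D`.
    refine hL.not_deep (X := N) (Y := D) (Z := M) (i := oth (oth i M.2) D.2) hNL hD (hK hM)
      ((isCrossing_iff hjN).2 ⟨hNm, hNo⟩) hDN.symm ?_ ?_ ?_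
    · rwa [oth_oth hj]
    · rw [oth_oth hj]
      exact hMD.symm
    · rw [oth_oth hj, oth_oth hi.ne]
      exact hi

theorem AllGood.shortChains {L : Set Loz} (hL : AllGood L) : ShortChains L := by
  intro M hM i hi
  refine hL.short_chain _ {M} (by simpa using hM) (Conn.singleton M) le_rfl M rfl i hi ?_
  rintro N - h rfl
  exact h.ne rfl

theorem AllGood.exists_crossing {L : Set Loz} (hL : AllGood L) (h : L.Nontrivial) :
    ∃ X ∈ L, IsCrossing L X := by
  have hG := hL.good
  have : ∃ M ∈ L, ∃ i, IsMid L i M := by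
    obtain ⟨A, hA, B, hB, hAB⟩ := h
    rcases Relation.ReflTransGen.cases_head (hG.conn A hA B hB) with rfl | ⟨C, ⟨-, hC, i, hi⟩, -⟩
    · exact absurd rfl hAB
    have key : ∀ A ∈ L, ∀ C ∈ L, StepUp i A C → ∃ M ∈ L, ∃ i, IsMid L i M := by
      intro A hA C hC h
      rcases hG.runs i A hA C hC h with ⟨⟨D, hD, h'⟩, -⟩ | ⟨⟨D, hD, h'⟩, -⟩
      · exact ⟨C, hC, i, ⟨A, hA, h⟩, D, hD, h'⟩
      · exact ⟨A, hA, i, ⟨D, hD, h'⟩, C, hC, h⟩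
    rcases hi with h | h
    · exact key A hA C hC h
    · exact key C hC A hA h
  obtain ⟨M, hM, i, hi⟩ := this
  rcases hL.shortChains M hM i hi with h | ⟨N, hN, h1, h2, h3⟩
  · exact ⟨M, hM, (isCrossing_iff hi.ne).2 ⟨hi, h⟩⟩
  · exact ⟨N, hN, (isCrossing_iff h2.ne).2 ⟨h2, h3⟩⟩

/-- Up to a rotation and a translation every verdant tiling is found by the search. -/
theorem AllGood.exists_list {L : Set Loz} (hL : AllGood L) (h : L.Nontrivial) :
    ∃ (w : Vtx) (k : ℕ) (K : List Loz), K.Nodup ∧ {l | frame w k l ∈ L} = {A | A ∈ K} ∧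
      decomposes K = true := by
  obtain ⟨X, hX, hc⟩ := hL.exists_crossing h
  obtain ⟨w, k, rfl⟩ := exists_frame X
  have hG := hL w k
  have hc' := hc.frame hG.packed
  have hs : ShortChains {l | frame w k l ∈ L} := by
    intro M hM i hi
    have hp := hL.good.packed
    have key := hL.shortChains _ hM _ ((isMid_frame_iff hp hG.packed).2 hi)
    rw [frame_snd, oth_rotDir_iterate, isMid_frame_iff hp hG.packed] at key
    refine key.imp id ?_
    rintro ⟨N, hN, h1, h2, h3⟩
    obtain ⟨N, rfl⟩ := frame_surjective w k N
    rw [frame_snd, oth_rotDir_iterate, isMid_frame_iff hp hG.packed] at h3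
    exact ⟨N, hN, adjIn_frame.1 h1, (isMid_frame_iff hp hG.packed).1 h2, h3⟩
  exact ⟨w, k, searchAt_sound hG hs hX (hc' .a (by simp)) (hc' .b (by simp)) searchAt_origin⟩

/-! ### Lattice coordinates, rhombi and their sides in the plane -/

/-- The point with lattice coordinates `x`, `y` in the frame with origin `p` and unit `u`. -/
noncomputable def pos (p u : ℂ) (x y : ℝ) : ℂ := p + u * (x + y * omega)

/-- The lattice vertex `v` in the frame with origin `p` and unit `u`. -/
noncomputable def pt (p u : ℂ) (v : Vtx) : ℂ := pos p u v.1 v.2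

/-- The lattice edge of direction `i` at `w`. -/
def seg (p u : ℂ) (i : Dir) (w : Vtx) : Set ℂ := segment ℝ (pt p u w) (pt p u (tip i w))

/-- The tile that is described by a lozenge. -/
def tile (p u : ℂ) : Loz → Set ℂ
  | (v, .a) => rhombus (pt p u (v.1 + 1, v.2 - 1)) (u * omega)
  | (v, .b) => rhombus (pt p u (v.1 + 1, v.2)) (u * omega ^ 2)
  | (v, .c) => rhombus (pt p u v) u

theorem omega_sq : omega ^ 2 = omega - 1 := by
  have h : Real.sqrt 3 * Real.sqrt 3 = 3 := Real.mul_self_sqrt (by norm_num)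
  apply Complex.ext
  · simp only [omega, sq, Complex.mul_re, Complex.sub_re, Complex.one_re]
    linarith
  · simp only [omega, sq, Complex.mul_im, Complex.sub_im, Complex.one_im]
    ring

/-- This form is positive definite, which makes `1` and `ω` independent over the reals and gives
distances in lattice coordinates. -/
theorem normSq_omega (a b : ℝ) :
    Complex.normSq (a + b * omega) = a ^ 2 + a * b + b ^ 2 := by
  have h : Real.sqrt 3 * Real.sqrt 3 = 3 := Real.mul_self_sqrt (by norm_num)
  simp only [omega, Complex.normSq_apply, Complex.add_re, Complex.add_im, Complex.mul_re,
    Complex.mul_im, Complex.ofReal_re, Complex.ofReal_im]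
  linear_combination b ^ 2 / 4 * h

theorem norm_omega : ‖omega‖ = 1 := by
  have := normSq_omega 0 1
  rw [← Complex.sq_norm] at this
  have h : ‖omega‖ ^ 2 = 1 := by simpa using this
  nlinarith [norm_nonneg omega]

theorem omega_coord {a b a' b' : ℝ} (h : (a + b * omega : ℂ) = a' + b' * omega) :
    a = a' ∧ b = b' := by
  have h1 := normSq_omega (a - a') (b - b')
  have h2 : ((a - a' : ℝ) + (b - b' : ℝ) * omega : ℂ) = 0 := by
    push_cast
    linear_combination h
  rw [h2, map_zero] at h1
  constructor <;> nlinarith [sq_nonneg (a - a' + (b - b')), sq_nonneg (a - a'), sq_nonneg (b - b')]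

theorem pos_injective {p u : ℂ} (hu : u ≠ 0) {x y x' y' : ℝ}
    (h : pos p u x y = pos p u x' y') : x = x' ∧ y = y' :=
  omega_coord (mul_left_cancel₀ hu (add_left_cancel h))

theorem pt_injective {p u : ℂ} (hu : u ≠ 0) : Function.Injective (pt p u) := fun v w h => by
  obtain ⟨h1, h2⟩ := pos_injective hu h
  exact Prod.ext (by exact_mod_cast h1) (by exact_mod_cast h2)

/-- First lattice coordinate. -/
noncomputable def cx (p u z : ℂ) : ℝ := ((z - p) / u).re - ((z - p) / u).im / Real.sqrt 3

/-- Second lattice coordinate. -/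
noncomputable def cy (p u z : ℂ) : ℝ := ((z - p) / u).im * 2 / Real.sqrt 3

theorem pos_coord {p u : ℂ} (hu : u ≠ 0) (z : ℂ) : pos p u (cx p u z) (cy p u z) = z := by
  have h3 : Real.sqrt 3 ≠ 0 := by positivity
  have : ((cx p u z : ℝ) + (cy p u z : ℝ) * omega : ℂ) = (z - p) / u := by
    apply Complex.ext
    · simp [cx, cy, omega]
      field_simp
      ring
    · simp [cx, cy, omega]
      field_simp
  rw [pos, this]
  field_simp
  ring

theorem cx_pos {p u : ℂ} (hu : u ≠ 0) (x y : ℝ) : cx p u (pos p u x y) = x :=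
  (pos_injective hu (pos_coord hu _)).1

theorem cy_pos {p u : ℂ} (hu : u ≠ 0) (x y : ℝ) : cy p u (pos p u x y) = y :=
  (pos_injective hu (pos_coord hu _)).2

theorem continuous_cx (p u : ℂ) : Continuous (cx p u) := by
  unfold cx
  fun_prop

theorem continuous_cy (p u : ℂ) : Continuous (cy p u) := by
  unfold cy
  fun_prop

/-- The closed triangles of the lattice, upward (`true`) and downward (`false`). -/
abbrev Tri := Vtx × Bool

/-- The points with coordinates `x`, `y` of a closed triangle. -/
def InTri : Tri → ℝ → ℝ → Prop
  | (v, true), x, y => (v.1 : ℝ) ≤ x ∧ (v.2 : ℝ) ≤ y ∧ x + y ≤ v.1 + v.2 + 1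
  | (v, false), x, y => x ≤ (v.1 : ℝ) + 1 ∧ y ≤ (v.2 : ℝ) + 1 ∧ (v.1 : ℝ) + v.2 + 1 ≤ x + y

/-- A lozenge consists of two triangles. -/
def Covers (l : Loz) (t : Tri) : Prop := t = (l.1, true) ∨ t = (dn l, false)

theorem pos_mem_rhombus {p u q v : ℂ} {x y : ℝ} :
    pos p u x y ∈ rhombus q v ↔ ∃ s t : ℝ, 0 ≤ s ∧ s ≤ 1 ∧ 0 ≤ t ∧ t ≤ 1 ∧
      pos p u x y = q + s * v + t * (omega * v) := Iff.rfl

theorem pos_mem_tile {p u : ℂ} (hu : u ≠ 0) {l : Loz} {x y : ℝ} :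
    pos p u x y ∈ tile p u l ↔ InTri (l.1, true) x y ∨ InTri (dn l, false) x y := by
  have ho := omega_sq
  obtain ⟨⟨v, w⟩, m⟩ := l
  cases m
  · have key : ∀ s t : ℝ, pt p u (v + 1, w - 1) + s * (u * omega) + t * (omega * (u * omega)) =
        pos p u (v + 1 - t) (w - 1 + s + t) := by
      intro s t
      simp only [pt, pos]
      push_cast
      linear_combination (t * u) * ho
    simp only [tile, pos_mem_rhombus, key, InTri, dn]
    push_cast
    constructor
    · rintro ⟨s, t, h1, h2, h3, h4, h⟩
      obtain ⟨rfl, rfl⟩ := pos_injective hu h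
      -- The line `s + t = 1` is the short diagonal, which separates the two triangles.
      rcases le_total (1 : ℝ) (s + t) with h | h
      · left; refine ⟨?_, ?_, ?_⟩ <;> linarith
      · right; refine ⟨?_, ?_, ?_⟩ <;> linarith
    · intro h
      refine ⟨x + y - v - w, v + 1 - x, ?_, ?_, ?_, ?_, ?_⟩
      · rcases h with h | h <;> linarith [h.1, h.2.1, h.2.2]
      · rcases h with h | h <;> linarith [h.1, h.2.1, h.2.2]
      · rcases h with h | h <;> linarith [h.1, h.2.1, h.2.2]
      · rcases h with h | h <;> linarith [h.1, h.2.1, h.2.2]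
      · congr 1 <;> ring
  · have key : ∀ s t : ℝ, pt p u (v + 1, w) + s * (u * omega ^ 2) + t * (omega * (u * omega ^ 2)) =
        pos p u (v + 1 - s - t) (w + s) := by
      intro s t
      simp only [pt, pos]
      push_cast
      linear_combination (s * u + t * u * omega + t * u) * ho
    simp only [tile, pos_mem_rhombus, key, InTri, dn]
    push_cast
    constructor
    · rintro ⟨s, t, h1, h2, h3, h4, h⟩
      obtain ⟨rfl, rfl⟩ := pos_injective hu h
      rcases le_total (s + t) (1 : ℝ) with h | h
      · left; refine ⟨?_, ?_, ?_⟩ <;> linarith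
      · right; refine ⟨?_, ?_, ?_⟩ <;> linarith
    · intro h
      refine ⟨y - w, v + w + 1 - x - y, ?_, ?_, ?_, ?_, ?_⟩
      · rcases h with h | h <;> linarith [h.1, h.2.1, h.2.2]
      · rcases h with h | h <;> linarith [h.1, h.2.1, h.2.2]
      · rcases h with h | h <;> linarith [h.1, h.2.1, h.2.2]
      · rcases h with h | h <;> linarith [h.1, h.2.1, h.2.2]
      · congr 1 <;> ring
  · have key : ∀ s t : ℝ, pt p u (v, w) + s * u + t * (omega * u) = pos p u (v + s) (w + t) := by
      intro s t
      simp only [pt, pos]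
      push_cast
      ring
    simp only [tile, pos_mem_rhombus, key, InTri, dn]
    constructor
    · rintro ⟨s, t, h1, h2, h3, h4, h⟩
      obtain ⟨rfl, rfl⟩ := pos_injective hu h
      rcases le_total (s + t) (1 : ℝ) with h | h
      · left; refine ⟨?_, ?_, ?_⟩ <;> linarith
      · right; refine ⟨?_, ?_, ?_⟩ <;> linarith
    · intro h
      refine ⟨x - v, y - w, ?_, ?_, ?_, ?_, ?_⟩
      · rcases h with h | h <;> linarith [h.1, h.2.1, h.2.2]
      · rcases h with h | h <;> linarith [h.1, h.2.1, h.2.2]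
      · rcases h with h | h <;> linarith [h.1, h.2.1, h.2.2]
      · rcases h with h | h <;> linarith [h.1, h.2.1, h.2.2]
      · congr 1 <;> ring

theorem mem_tile_iff {p u : ℂ} (hu : u ≠ 0) {l : Loz} {z : ℂ} :
    z ∈ tile p u l ↔ ∃ t, Covers l t ∧ InTri t (cx p u z) (cy p u z) := by
  conv_lhs => rw [← pos_coord hu z (p := p)]
  rw [pos_mem_tile hu]
  simp [Covers]

/-- A rhombus determines its acute corners. -/
theorem rhombus_injective {p u p' u' : ℂ} (hu : ‖u‖ = 1) (hu' : ‖u'‖ = 1)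
    (h : rhombus p u = rhombus p' u') :
    (p' = p ∧ u' = u) ∨ (p' = p + u + omega * u ∧ u' = -u) := by
  have h1 : p' ∈ rhombus p u := h ▸ ⟨0, 0, by norm_num⟩
  have h2 : p' + u' + omega * u' ∈ rhombus p u := by
    rw [h]
    exact ⟨1, 1, by norm_num⟩
  obtain ⟨s, t, hs0, hs1, ht0, ht1, e1⟩ := h1
  obtain ⟨s', t', hs0', hs1', ht0', ht1', e2⟩ := h2
  have e3 : u' * ((1 : ℝ) + (1 : ℝ) * omega) = u * ((s' - s : ℝ) + (t' - t : ℝ) * omega) := by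
    push_cast
    linear_combination e2 - e1
  have e4 := congrArg Complex.normSq e3
  rw [map_mul, map_mul, normSq_omega, normSq_omega, ← Complex.sq_norm, ← Complex.sq_norm, hu,
    hu'] at e4
  have hne : ((1 : ℝ) + (1 : ℝ) * omega : ℂ) ≠ 0 := by
    intro h
    have := normSq_omega 1 1
    rw [h, map_zero] at this
    norm_num at this
  -- The acute corners are at distance `√3`. As the coordinate differences are at most one in
  -- absolute value, they must be equal, and then both `1` or both `-1`.
  have e5 : (s' - s) ^ 2 + (s' - s) * (t' - t) + (t' - t) ^ 2 = 3 := by linarith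
  have ha : (s' - s) ^ 2 ≤ 1 := by nlinarith
  have hb : (t' - t) ^ 2 ≤ 1 := by nlinarith
  have hab : (s' - s) = (t' - t) := by
    have : (s' - s - (t' - t)) ^ 2 ≤ 0 := by linarith
    have := pow_eq_zero_iff (two_ne_zero) |>.1 (le_antisymm this (sq_nonneg _))
    linarith
  rw [← hab] at e5
  have : (s' - s - 1) * (s' - s + 1) = 0 := by linarith
  rcases mul_eq_zero.1 this with h3 | h3
  · left
    have q1 : s = 0 := by linarith
    have q2 : s' = 1 := by linarith
    have q3 : t = 0 := by linarith
    have q4 : t' = 1 := by linarith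
    subst q1 q2 q3 q4
    refine ⟨by simpa using e1, mul_right_cancel₀ hne ?_⟩
    rw [e3]
    norm_num
  · right
    have q1 : s = 1 := by linarith
    have q2 : s' = 0 := by linarith
    have q3 : t = 1 := by linarith
    have q4 : t' = 0 := by linarith
    subst q1 q2 q3 q4
    refine ⟨by simpa using e1, mul_right_cancel₀ hne ?_⟩
    rw [e3]
    push_cast
    ring

/-- `IsSide` allows any presentation of the rhombus; by `rhombus_injective` there are only two, one
from each acute corner, and they have the same sides. -/
theorem isSide_rhombus {p u : ℂ} (hu : ‖u‖ = 1) {e : Set ℂ} :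
    IsSide (rhombus p u) e ↔ (e = segment ℝ p (p + u) ∨ e = segment ℝ p (p + omega * u) ∨
      e = segment ℝ (p + u) (p + u + omega * u) ∨
      e = segment ℝ (p + omega * u) (p + u + omega * u)) := by
  refine ⟨?_, fun h => ⟨p, u, hu, rfl, h⟩⟩
  rintro ⟨q, v, hv, h, he⟩
  rcases rhombus_injective hu hv h with ⟨rfl, rfl⟩ | ⟨rfl, rfl⟩
  · exact he
  · have a1 : p + u + omega * u + -u = p + omega * u := by ring
    have a2 : p + u + omega * u + omega * -u = p + u := by ring
    have a3 : p + omega * u + omega * -u = p := by ring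
    rw [a1, a2, a3, segment_symm ℝ (p + u + omega * u), segment_symm ℝ (p + u + omega * u),
      segment_symm ℝ _ p, segment_symm ℝ _ p] at he
    tauto

theorem isVertex_rhombus {p u : ℂ} (hu : ‖u‖ = 1) {z : ℂ} :
    IsVertex (rhombus p u) z ↔
      (z = p ∨ z = p + u ∨ z = p + omega * u ∨ z = p + u + omega * u) := by
  refine ⟨?_, fun h => ⟨p, u, hu, rfl, h⟩⟩
  rintro ⟨q, v, hv, h, he⟩
  rcases rhombus_injective hu hv h with ⟨rfl, rfl⟩ | ⟨rfl, rfl⟩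
  · exact he
  · have a1 : p + u + omega * u + -u = p + omega * u := by ring
    have a2 : p + u + omega * u + omega * -u = p + u := by ring
    have a3 : p + omega * u + omega * -u = p := by ring
    rw [a1, a2, a3] at he
    tauto

/-- The lozenge `l` has the side of direction `i` at `w`. -/
def HasSide (l : Loz) (i : Dir) (w : Vtx) : Prop := i ≠ l.2 ∧ (w = lo i l ∨ w = up i l)

theorem isSide_tile {p u : ℂ} (hu : ‖u‖ = 1) {l : Loz} {e : Set ℂ} :
    IsSide (tile p u l) e ↔ ∃ i w, HasSide l i w ∧ e = seg p u i w := by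
  have ho := omega_sq
  have key : (∃ i w, HasSide l i w ∧ e = seg p u i w) ↔
      ∃ i, i ≠ l.2 ∧ (e = seg p u i (lo i l) ∨ e = seg p u i (up i l)) := by
    constructor
    · rintro ⟨i, w, ⟨h1, rfl | rfl⟩, rfl⟩
      · exact ⟨i, h1, Or.inl rfl⟩
      · exact ⟨i, h1, Or.inr rfl⟩
    · rintro ⟨i, h1, h | h⟩
      · exact ⟨i, _, ⟨h1, Or.inl rfl⟩, h⟩
      · exact ⟨i, _, ⟨h1, Or.inr rfl⟩, h⟩
  rw [key]
  have key2 : ∀ m : Dir, (∃ i, i ≠ m ∧ (e = seg p u i (lo i (l.1, m)) ∨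
      e = seg p u i (up i (l.1, m)))) ↔ ((Dir.a ≠ m ∧ (e = seg p u .a (lo .a (l.1, m)) ∨
      e = seg p u .a (up .a (l.1, m)))) ∨ (Dir.b ≠ m ∧ (e = seg p u .b (lo .b (l.1, m)) ∨
      e = seg p u .b (up .b (l.1, m)))) ∨ (Dir.c ≠ m ∧ (e = seg p u .c (lo .c (l.1, m)) ∨
      e = seg p u .c (up .c (l.1, m))))) := by
    intro m
    constructor
    · rintro ⟨⟨⟩, h⟩ <;> tauto
    · rintro (h | h | h)
      exacts [⟨_, h⟩, ⟨_, h⟩, ⟨_, h⟩]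
  obtain ⟨⟨x, y⟩, m⟩ := l
  rw [key2]
  have h1 : ‖u * omega‖ = 1 := by rw [norm_mul, hu, norm_omega, one_mul]
  have h2 : ‖u * omega ^ 2‖ = 1 := by rw [norm_mul, norm_pow, hu, norm_omega]; norm_num
  cases m
  · have c1 : pt p u (x + 1, y - 1) + u * omega = pt p u (x + 1, y) := by
      simp only [pt, pos]; push_cast; ring
    have c2 : pt p u (x + 1, y - 1) + omega * (u * omega) = pt p u (x, y) := by
      simp only [pt, pos]; push_cast; linear_combination u * ho
    have c3 : pt p u (x + 1, y) + omega * (u * omega) = pt p u (x, y + 1) := by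
      simp only [pt, pos]; push_cast; linear_combination u * ho
    rw [tile, isSide_rhombus h1, c1, c2, c3]
    simp only [lo, up, dn, seg, tip, ne_eq, reduceCtorEq, not_true_eq_false, false_and,
      not_false_eq_true, true_and, false_or, add_sub_cancel_right, sub_add_cancel]
    tauto
  · have c1 : pt p u (x + 1, y) + u * omega ^ 2 = pt p u (x, y + 1) := by
      simp only [pt, pos]; push_cast; linear_combination u * ho
    have c2 : pt p u (x + 1, y) + omega * (u * omega ^ 2) = pt p u (x, y) := by
      simp only [pt, pos]; push_cast; linear_combination (u * omega + u) * ho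
    have c3 : pt p u (x, y + 1) + omega * (u * omega ^ 2) = pt p u (x - 1, y + 1) := by
      simp only [pt, pos]; push_cast; linear_combination (u * omega + u) * ho
    rw [tile, isSide_rhombus h2, c1, c2, c3]
    simp only [lo, up, dn, seg, tip, ne_eq, reduceCtorEq, not_true_eq_false, false_and,
      not_false_eq_true, true_and, false_or, add_sub_cancel_right, sub_add_cancel]
    rw [segment_symm ℝ (pt p u (x, y)) (pt p u (x + 1, y)),
      segment_symm ℝ (pt p u (x - 1, y + 1)) (pt p u (x, y + 1))]
    tauto
  · have c1 : pt p u (x, y) + u = pt p u (x + 1, y) := by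
      simp only [pt, pos]; push_cast; ring
    have c2 : pt p u (x, y) + omega * u = pt p u (x, y + 1) := by
      simp only [pt, pos]; push_cast; ring
    have c3 : pt p u (x + 1, y) + omega * u = pt p u (x + 1, y + 1) := by
      simp only [pt, pos]; push_cast; ring
    rw [tile, isSide_rhombus hu, c1, c2, c3]
    simp only [lo, up, dn, seg, tip, ne_eq, reduceCtorEq, not_true_eq_false, false_and,
      not_false_eq_true, true_and, or_false]
    tauto

theorem isVertex_tile {p u : ℂ} (hu : ‖u‖ = 1) {l : Loz} {z : ℂ} :
    IsVertex (tile p u l) z ↔ ∃ v ∈ verts l, z = pt p u v := by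
  have ho := omega_sq
  obtain ⟨⟨x, y⟩, m⟩ := l
  have h1 : ‖u * omega‖ = 1 := by rw [norm_mul, hu, norm_omega, one_mul]
  have h2 : ‖u * omega ^ 2‖ = 1 := by rw [norm_mul, norm_pow, hu, norm_omega]; norm_num
  cases m
  · have c1 : pt p u (x + 1, y - 1) + u * omega = pt p u (x + 1, y) := by
      simp only [pt, pos]; push_cast; ring
    have c2 : pt p u (x + 1, y - 1) + omega * (u * omega) = pt p u (x, y) := by
      simp only [pt, pos]; push_cast; linear_combination u * ho
    have c3 : pt p u (x + 1, y) + omega * (u * omega) = pt p u (x, y + 1) := by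
      simp only [pt, pos]; push_cast; linear_combination u * ho
    rw [tile, isVertex_rhombus h1, c1, c2, c3]
    simp only [verts, apex, List.mem_cons, List.not_mem_nil, or_false, exists_eq_or_imp,
      exists_eq_left]
    tauto
  · have c1 : pt p u (x + 1, y) + u * omega ^ 2 = pt p u (x, y + 1) := by
      simp only [pt, pos]; push_cast; linear_combination u * ho
    have c2 : pt p u (x + 1, y) + omega * (u * omega ^ 2) = pt p u (x, y) := by
      simp only [pt, pos]; push_cast; linear_combination (u * omega + u) * ho
    have c3 : pt p u (x, y + 1) + omega * (u * omega ^ 2) = pt p u (x - 1, y + 1) := by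
      simp only [pt, pos]; push_cast; linear_combination (u * omega + u) * ho
    rw [tile, isVertex_rhombus h2, c1, c2, c3]
    simp only [verts, apex, List.mem_cons, List.not_mem_nil, or_false, exists_eq_or_imp,
      exists_eq_left]
    tauto
  · have c1 : pt p u (x, y) + u = pt p u (x + 1, y) := by
      simp only [pt, pos]; push_cast; ring
    have c2 : pt p u (x, y) + omega * u = pt p u (x, y + 1) := by
      simp only [pt, pos]; push_cast; ring
    have c3 : pt p u (x + 1, y) + omega * u = pt p u (x + 1, y + 1) := by
      simp only [pt, pos]; push_cast; ring
    rw [tile, isVertex_rhombus hu, c1, c2, c3]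
    simp only [verts, apex, List.mem_cons, List.not_mem_nil, or_false, exists_eq_or_imp,
      exists_eq_left]

theorem isTile_tile {p u : ℂ} (hu : ‖u‖ = 1) (l : Loz) : IsTile (tile p u l) := by
  have h1 : ‖u * omega‖ = 1 := by rw [norm_mul, hu, norm_omega, one_mul]
  have h2 : ‖u * omega ^ 2‖ = 1 := by rw [norm_mul, norm_pow, hu, norm_omega]; norm_num
  obtain ⟨v, m⟩ := l
  cases m
  exacts [⟨_, _, h1, rfl⟩, ⟨_, _, h2, rfl⟩, ⟨_, _, hu, rfl⟩]

/-- Along the first segment the ends of the second have parameters in `[0, 1]` that differ by one.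
-/
theorem segment_ends {a b c d : ℂ} (h : segment ℝ a b = segment ℝ c d) (hab : ‖b - a‖ = 1)
    (hcd : ‖d - c‖ = 1) : (c = a ∧ d = b) ∨ (c = b ∧ d = a) := by
  have h1 : c ∈ segment ℝ a b := h ▸ left_mem_segment ℝ c d
  have h2 : d ∈ segment ℝ a b := h ▸ right_mem_segment ℝ c d
  rw [segment_eq_image'] at h1 h2
  obtain ⟨s, hs, rfl⟩ := h1
  obtain ⟨t, ht, rfl⟩ := h2
  have e : a + t • (b - a) - (a + s • (b - a)) = (t - s) • (b - a) := by
    rw [sub_smul]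
    ring
  rw [e, norm_smul, hab, mul_one, Real.norm_eq_abs] at hcd
  rcases (abs_eq (by norm_num)).1 hcd with h | h
  · have h1 : s = 0 := by linarith [hs.1, ht.2]
    have h2 : t = 1 := by linarith
    subst h1 h2
    left
    simp
  · have h1 : s = 1 := by linarith [hs.2, ht.1]
    have h2 : t = 0 := by linarith
    subst h1 h2
    right
    simp

/-! ### Lattice edges as segments -/

/-- The three unit vectors of the lattice in a frame with unit `1`. -/
noncomputable def vec : Dir → ℂ
  | .a => 1
  | .b => omega
  | .c => omega - 1

theorem pt_tip (p u : ℂ) (i : Dir) (w : Vtx) : pt p u (tip i w) = pt p u w + u * vec i := by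
  cases i <;> simp only [pt, pos, tip, vec] <;> push_cast <;> ring

theorem norm_vec (i : Dir) : ‖vec i‖ = 1 := by
  cases i
  · simp [vec]
  · exact norm_omega
  · rw [vec, ← omega_sq, norm_pow, norm_omega, one_pow]

theorem norm_edge {p u : ℂ} (hu : ‖u‖ = 1) (i : Dir) (w : Vtx) :
    ‖pt p u (tip i w) - pt p u w‖ = 1 := by
  rw [pt_tip, add_sub_cancel_left, norm_mul, hu, norm_vec, one_mul]

theorem ne_zero_of_norm {u : ℂ} (hu : ‖u‖ = 1) : u ≠ 0 := by
  rintro rfl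
  simp at hu

theorem seg_injective {p u : ℂ} (hu : ‖u‖ = 1) {i j : Dir} {v w : Vtx}
    (h : seg p u i v = seg p u j w) : i = j ∧ v = w := by
  have hu0 := ne_zero_of_norm hu
  have key : ∀ {i j : Dir} {v w : Vtx}, (w = v ∧ tip j w = tip i v) ∨
      (w = tip i v ∧ tip j w = v) → i = j ∧ v = w := by
    rintro i j ⟨x, y⟩ ⟨x', y'⟩ h
    cases i <;> cases j <;> simp [tip] at h ⊢ <;> omega
  rcases segment_ends h (norm_edge hu _ _) (norm_edge hu _ _) with ⟨h1, h2⟩ | ⟨h1, h2⟩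
  · exact key (Or.inl ⟨pt_injective hu0 h1, pt_injective hu0 h2⟩)
  · exact key (Or.inr ⟨pt_injective hu0 h1, pt_injective hu0 h2⟩)

theorem direction_seg (p u : ℂ) (i : Dir) (w : Vtx) :
    vectorSpan ℝ (seg p u i w) = Submodule.span ℝ {u * vec i} := by
  rw [← direction_affineSpan, seg, ← convexHull_pair, affineSpan_convexHull,
    direction_affineSpan, vectorSpan_pair_rev, pt_tip, vsub_eq_sub, add_sub_cancel_left]

theorem vec_eq_of_smul {i j : Dir} {r : ℝ} (h : (r : ℂ) * vec i = vec j) : i = j := by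
  cases i <;> cases j <;> try rfl
  all_goals exfalso
  · have := omega_coord (a := r) (b := 0) (a' := 0) (b' := 1) (by simpa [vec] using h)
    linarith [this.2]
  · have := omega_coord (a := r) (b := 0) (a' := -1) (b' := 1) (by
      simp [vec] at h; push_cast; linear_combination h)
    linarith [this.2]
  · have := omega_coord (a := 0) (b := r) (a' := 1) (b' := 0) (by simpa [vec] using h)
    linarith [this.1]
  · have := omega_coord (a := 0) (b := r) (a' := -1) (b' := 1) (by
      simp [vec] at h; push_cast; linear_combination h)
    linarith [this.1]
  · have := omega_coord (a := -r) (b := r) (a' := 1) (b' := 0) (by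
      simp [vec] at h; push_cast; linear_combination h)
    linarith [this.1, this.2]
  · have := omega_coord (a := -r) (b := r) (a' := 0) (b' := 1) (by
      simp [vec] at h; push_cast; linear_combination h)
    linarith [this.1, this.2]

theorem parallelSides_seg {p u : ℂ} (hu : ‖u‖ = 1) {i j : Dir} {v w : Vtx} :
    ParallelSides (seg p u i v) (seg p u j w) ↔ i = j := by
  constructor
  · intro h
    have h1 := h.direction_eq
    rw [direction_affineSpan, direction_affineSpan, direction_seg, direction_seg] at h1
    have h2 : u * vec j ∈ Submodule.span ℝ {u * vec i} := by
      rw [h1]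
      exact Submodule.mem_span_singleton_self _
    obtain ⟨r, hr⟩ := Submodule.mem_span_singleton.1 h2
    refine vec_eq_of_smul (r := r) (mul_left_cancel₀ (ne_zero_of_norm hu) ?_)
    rw [← hr, Complex.real_smul]
    ring
  · rintro rfl
    rw [ParallelSides, seg, seg, ← convexHull_pair, ← convexHull_pair, affineSpan_convexHull,
      affineSpan_convexHull, AffineSubspace.affineSpan_pair_parallel_iff_vectorSpan_eq,
      vectorSpan_pair_rev, vectorSpan_pair_rev, pt_tip, pt_tip, vsub_eq_sub, vsub_eq_sub,
      add_sub_cancel_left, add_sub_cancel_left]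

theorem ParallelSides.trans {d e f : Set ℂ} (h : ParallelSides e d) (h' : ParallelSides f d) :
    ParallelSides e f := AffineSubspace.Parallel.trans h (AffineSubspace.Parallel.symm h')

/-- The points with coordinates `x`, `y` of a lattice edge. -/
def InSeg : Dir → Vtx → ℝ → ℝ → Prop
  | .a, w, x, y => y = w.2 ∧ (w.1 : ℝ) ≤ x ∧ x ≤ w.1 + 1
  | .b, w, x, y => x = w.1 ∧ (w.2 : ℝ) ≤ y ∧ y ≤ w.2 + 1
  | .c, w, x, y => x + y = w.1 + w.2 ∧ (w.1 : ℝ) - 1 ≤ x ∧ x ≤ w.1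

theorem pos_mem_seg {p u : ℂ} (hu : u ≠ 0) {i : Dir} {w : Vtx} {x y : ℝ} :
    pos p u x y ∈ seg p u i w ↔ InSeg i w x y := by
  rw [seg, segment_eq_image']
  have key : ∀ t : ℝ, pt p u w + t • (pt p u (tip i w) - pt p u w) = match i with
      | .a => pos p u (w.1 + t) w.2
      | .b => pos p u w.1 (w.2 + t)
      | .c => pos p u (w.1 - t) (w.2 + t) := by
    intro t
    rw [pt_tip, add_sub_cancel_left, Complex.real_smul]
    cases i <;> simp only [pt, pos, vec] <;> push_cast <;> ring
  simp only [Set.mem_image, Set.mem_Icc, key]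
  cases i <;> simp only [InSeg]
  · constructor
    · rintro ⟨t, ht, h⟩
      obtain ⟨h1, h2⟩ := pos_injective hu h
      exact ⟨h2.symm, by linarith, by linarith⟩
    · rintro ⟨rfl, h1, h2⟩
      exact ⟨x - w.1, ⟨by linarith, by linarith⟩, by congr 1; ring⟩
  · constructor
    · rintro ⟨t, ht, h⟩
      obtain ⟨h1, h2⟩ := pos_injective hu h
      exact ⟨h1.symm, by linarith, by linarith⟩
    · rintro ⟨rfl, h1, h2⟩
      exact ⟨y - w.2, ⟨by linarith, by linarith⟩, by congr 1; ring⟩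
  · constructor
    · rintro ⟨t, ht, h⟩
      obtain ⟨h1, h2⟩ := pos_injective hu h
      exact ⟨by linarith, by linarith, by linarith⟩
    · rintro ⟨h0, h1, h2⟩
      exact ⟨w.1 - x, ⟨by linarith, by linarith⟩, by congr 1 <;> linarith⟩

theorem pt_mem_seg {p u : ℂ} (hu : u ≠ 0) {i : Dir} {v w : Vtx} :
    pt p u v ∈ seg p u i w ↔ v = w ∨ v = tip i w := by
  rw [pt, pos_mem_seg hu]
  obtain ⟨x, y⟩ := v
  obtain ⟨x', y'⟩ := w
  cases i <;> simp only [InSeg, tip, Prod.mk.injEq] <;> norm_cast <;> omega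

/-! ### How triangles and lozenges meet -/

theorem tile_eq_of_covers {A B : Loz} (h1 : A.1 = B.1) (h2 : dn A = dn B) : A = B := by
  obtain ⟨⟨x, y⟩, m⟩ := A
  obtain ⟨⟨x', y'⟩, m'⟩ := B
  simp only at h1
  rw [h1] at h2 ⊢
  cases m <;> cases m' <;> simp only [dn, Prod.mk.injEq] at h2 ⊢ <;> omega

theorem Covers.overlap {A B : Loz} {t : Tri} (hA : Covers A t) (hB : Covers B t) :
    A.1 = B.1 ∨ dn A = dn B := by
  rcases hA with rfl | rfl <;> rcases hB with h | h <;> simp only [Prod.mk.injEq, and_true,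
    reduceCtorEq, and_false] at h
  · exact Or.inl h
  · exact Or.inr h

/-- The centre of a triangle lies in no other triangle. -/
theorem eq_of_centre {t t' : Tri} {x y : ℝ}
    (hx : x = t.1.1 + (if t.2 then 1 / 3 else 2 / 3)) (hy : y = t.1.2 + (if t.2 then 1 / 3 else 2 / 3))
    (h : InTri t' x y) : t' = t := by
  obtain ⟨⟨v, w⟩, b⟩ := t
  obtain ⟨⟨v', w'⟩, b'⟩ := t'
  have aux : ∀ {m n : ℤ}, (m : ℝ) < n + 1 → m ≤ n := fun {m n} h => by
    have : m < n + 1 := by exact_mod_cast h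
    omega
  cases b <;> cases b' <;> simp only [InTri, if_true, if_false, Bool.false_eq_true] at hx hy h <;>
    obtain ⟨h1, h2, h3⟩ := h <;> subst hx hy
  · have a1 : v ≤ v' := aux (by linarith)
    have a2 : w ≤ w' := aux (by linarith)
    have a3 : v' + w' ≤ v + w := aux (by push_cast; linarith)
    rw [show v' = v by omega, show w' = w by omega]
  · have a1 : v' ≤ v := aux (by linarith)
    have a2 : w' ≤ w := aux (by linarith)
    have a3 : v + w + 1 ≤ v' + w' := aux (by push_cast; linarith)
    omega
  · have a1 : v ≤ v' := aux (by linarith)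
    have a2 : w ≤ w' := aux (by linarith)
    have a3 : v' + w' + 1 ≤ v + w := aux (by push_cast; linarith)
    omega
  · have a1 : v' ≤ v := aux (by linarith)
    have a2 : w' ≤ w := aux (by linarith)
    have a3 : v + w ≤ v' + w' := aux (by push_cast; linarith)
    rw [show v' = v by omega, show w' = w by omega]

theorem inTri_centre (t : Tri) : InTri t (t.1.1 + (if t.2 then 1 / 3 else 2 / 3))
    (t.1.2 + (if t.2 then 1 / 3 else 2 / 3)) := by
  obtain ⟨⟨v, w⟩, b⟩ := t
  cases b <;> simp only [InTri, if_true, if_false, Bool.false_eq_true] <;>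
    refine ⟨?_, ?_, ?_⟩ <;> linarith

theorem covers_of_centre {p u : ℂ} (hu : u ≠ 0) {l : Loz} {t : Tri}
    (h : pos p u (t.1.1 + (if t.2 then 1 / 3 else 2 / 3))
      (t.1.2 + (if t.2 then 1 / 3 else 2 / 3)) ∈ tile p u l) : Covers l t := by
  rw [pos_mem_tile hu] at h
  rcases h with h | h
  · exact Or.inl (eq_of_centre rfl rfl h).symm
  · exact Or.inr (eq_of_centre rfl rfl h).symm

theorem tile_injective {p u : ℂ} (hu : u ≠ 0) : Function.Injective (tile p u) := by
  intro A B h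
  have key : ∀ t, Covers A t → Covers B t := by
    intro t ht
    refine covers_of_centre (p := p) hu (t := t) ?_
    rw [← h, pos_mem_tile hu]
    rcases ht with rfl | rfl
    · exact Or.inl (inTri_centre _)
    · exact Or.inr (inTri_centre _)
  have h1 := key _ (Or.inl rfl)
  have h2 := key _ (Or.inr rfl)
  simp only [Covers, Prod.mk.injEq, reduceCtorEq, and_false, or_false, and_true, false_or] at h1 h2
  exact tile_eq_of_covers h1 h2

/-- The vertices of a triangle. -/
def triVerts : Tri → List Vtx
  | (v, true) => [v, (v.1 + 1, v.2), (v.1, v.2 + 1)]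
  | (v, false) => [(v.1 + 1, v.2), (v.1, v.2 + 1), (v.1 + 1, v.2 + 1)]

theorem Covers.verts {l : Loz} {t : Tri} (h : Covers l t) {v : Vtx} (hv : v ∈ triVerts t) :
    v ∈ verts l := by
  obtain ⟨⟨x, y⟩, m⟩ := l
  rcases h with rfl | rfl
  · simp only [triVerts, Tredoku.verts, List.mem_cons, List.not_mem_nil, or_false] at hv ⊢
    tauto
  · cases m <;> simp only [triVerts, Tredoku.verts, apex, dn, List.mem_cons, List.not_mem_nil,
      or_false, sub_add_cancel] at hv ⊢ <;> tauto

theorem inTri_int {t : Tri} {v : Vtx} : InTri t v.1 v.2 ↔ v ∈ triVerts t := by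
  obtain ⟨⟨x, y⟩, b⟩ := t
  obtain ⟨x', y'⟩ := v
  cases b <;> simp only [InTri, triVerts, List.mem_cons, List.not_mem_nil, or_false,
    Prod.mk.injEq] <;> norm_cast <;> omega

theorem exists_covers {l : Loz} {v : Vtx} (hv : v ∈ verts l) :
    ∃ t, Covers l t ∧ v ∈ triVerts t := by
  obtain ⟨⟨x, y⟩, m⟩ := l
  simp only [verts, List.mem_cons, List.not_mem_nil, or_false] at hv
  rcases hv with rfl | rfl | rfl | rfl
  · exact ⟨_, Or.inl rfl, by simp [triVerts]⟩
  · exact ⟨_, Or.inl rfl, by simp [triVerts]⟩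
  · exact ⟨_, Or.inl rfl, by simp [triVerts]⟩
  · exact ⟨_, Or.inr rfl, by cases m <;> simp [triVerts, apex, dn]⟩

theorem pt_mem_tile {p u : ℂ} (hu : u ≠ 0) {l : Loz} {v : Vtx} :
    pt p u v ∈ tile p u l ↔ v ∈ verts l := by
  rw [pt, pos_mem_tile hu, inTri_int, inTri_int]
  constructor
  · rintro (h | h)
    · exact Covers.verts (Or.inl rfl) h
    · exact Covers.verts (Or.inr rfl) h
  · intro h
    obtain ⟨t, rfl | rfl, ht⟩ := exists_covers h
    exacts [Or.inl ht, Or.inr ht]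

/-- All triangles that contain a given point have a vertex in common. -/
theorem exists_common_vertex (x y : ℝ) : ∃ v : Vtx, ∀ t, InTri t x y → v ∈ triVerts t := by
  have hx := Int.floor_le x
  have hx' := Int.lt_floor_add_one x
  have hy := Int.floor_le y
  have hy' := Int.lt_floor_add_one y
  set a := ⌊x⌋
  set b := ⌊y⌋
  have aux : ∀ {m n : ℤ}, (m : ℝ) < n + 1 → m ≤ n := fun {m n} h => by
    have : m < n + 1 := by exact_mod_cast h
    omega
  -- The point lies in the half-open unit cell at `(a, b)`, whose diagonal is `x + y = a + b + 1`.
  -- The common vertex is the near corner below the diagonal, an end of the diagonal on it, and the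
  -- far corner above it.
  rcases lt_trichotomy (x + y) (a + b + 1) with h | h | h
  · refine ⟨(a, b), ?_⟩
    rintro ⟨⟨v, w⟩, _ | _⟩ ⟨h1, h2, h3⟩ <;> rw [← inTri_int] <;> simp only [InTri] at * <;>
      norm_cast
    · have a1 : a ≤ v + 1 := aux (by push_cast; linarith)
      have a2 : b ≤ w + 1 := aux (by push_cast; linarith)
      have a3 : v + w + 1 ≤ a + b := aux (by push_cast; linarith)
      exact ⟨a1, a2, a3⟩
    · have a1 : v ≤ a := aux (by linarith)
      have a2 : w ≤ b := aux (by linarith)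
      have a3 : a + b ≤ v + w + 1 := aux (by push_cast; linarith)
      exact ⟨a1, a2, a3⟩
  · refine ⟨(a + 1, b), ?_⟩
    rintro ⟨⟨v, w⟩, _ | _⟩ ⟨h1, h2, h3⟩ <;> rw [← inTri_int] <;> simp only [InTri] at * <;>
      norm_cast
    · have a1 : a + 1 ≤ v + 1 := aux (by push_cast; linarith)
      have a2 : b ≤ w + 1 := aux (by push_cast; linarith)
      have a3 : v + w + 1 ≤ a + 1 + b := aux (by push_cast; linarith)
      exact ⟨a1, a2, a3⟩
    · have a1 : v ≤ a := aux (by linarith)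
      have a2 : w ≤ b := aux (by linarith)
      have a3 : a + b ≤ v + w := aux (by push_cast; linarith)
      exact ⟨by omega, a2, by omega⟩
  · refine ⟨(a + 1, b + 1), ?_⟩
    rintro ⟨⟨v, w⟩, _ | _⟩ ⟨h1, h2, h3⟩ <;> rw [← inTri_int] <;> simp only [InTri] at * <;>
      norm_cast
    · have a1 : a ≤ v := aux (by linarith)
      have a2 : b ≤ w := aux (by linarith)
      have a3 : v + w + 1 ≤ a + b + 2 := aux (by push_cast; linarith)
      exact ⟨by omega, by omega, by omega⟩
    · have a1 : v ≤ a := aux (by linarith)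
      have a2 : w ≤ b := aux (by linarith)
      have a3 : a + b + 1 ≤ v + w := aux (by push_cast; linarith)
      exact ⟨by omega, by omega, by omega⟩

theorem inter_nonempty_iff {p u : ℂ} (hu : u ≠ 0) {A B : Loz} :
    (tile p u A ∩ tile p u B).Nonempty ↔ ∃ v ∈ verts A, v ∈ verts B := by
  constructor
  · rintro ⟨z, h1, h2⟩
    obtain ⟨v, hv⟩ := exists_common_vertex (cx p u z) (cy p u z)
    obtain ⟨t, ht, h1⟩ := (mem_tile_iff hu).1 h1
    obtain ⟨t', ht', h2⟩ := (mem_tile_iff hu).1 h2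
    exact ⟨v, ht.verts (hv t h1), ht'.verts (hv t' h2)⟩
  · rintro ⟨v, h1, h2⟩
    exact ⟨pt p u v, (pt_mem_tile hu).2 h1, (pt_mem_tile hu).2 h2⟩

/-- The triangle `t` has the lattice edge of direction `i` at `w`. -/
def TriEdge : Tri → Dir → Vtx → Prop
  | (v, true), .a, w => w = v
  | (v, true), .b, w => w = v
  | (v, true), .c, w => w = (v.1 + 1, v.2)
  | (v, false), .a, w => w = (v.1, v.2 + 1)
  | (v, false), .b, w => w = (v.1 + 1, v.2)
  | (v, false), .c, w => w = (v.1 + 1, v.2)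

/-- Two different triangles meet in a vertex or along an edge. -/
theorem inTri_inter {t t' : Tri} {x y : ℝ} (hne : t ≠ t') (h : InTri t x y) (h' : InTri t' x y) :
    (∃ v : Vtx, x = v.1 ∧ y = v.2) ∨
      ∃ i w, TriEdge t i w ∧ TriEdge t' i w ∧ InSeg i w x y := by
  have mixed : ∀ v w v' w' : ℤ, InTri ((v, w), true) x y → InTri ((v', w'), false) x y →
      (∃ v : Vtx, x = v.1 ∧ y = v.2) ∨
      ∃ i s, TriEdge ((v, w), true) i s ∧ TriEdge ((v', w'), false) i s ∧ InSeg i s x y := by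
    rintro v w v' w' ⟨h1, h2, h3⟩ ⟨h4, h5, h6⟩
    simp only at *
    have a1 : v ≤ v' + 1 := by exact_mod_cast (by linarith : (v : ℝ) ≤ v' + 1)
    have a2 : w ≤ w' + 1 := by exact_mod_cast (by linarith : (w : ℝ) ≤ w' + 1)
    have a3 : v' + w' + 1 ≤ v + w + 1 := by
      exact_mod_cast (by linarith : (v' : ℝ) + w' + 1 ≤ v + w + 1)
    obtain ⟨a, rfl⟩ : ∃ a, v' = v + a := ⟨v' - v, by ring⟩
    obtain ⟨b, rfl⟩ : ∃ b, w' = w + b := ⟨w' - w, by ring⟩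
    push_cast at h4 h5 h6
    -- The six positions of a downward triangle that touches a given upward one: the first three
    -- share an edge with it, the others only a vertex.
    have : (a = 0 ∧ b = 0) ∨ (a = 0 ∧ b = -1) ∨ (a = -1 ∧ b = 0) ∨ (a = -1 ∧ b = -1) ∨
      (a = 1 ∧ b = -1) ∨ (a = -1 ∧ b = 1) := by omega
    rcases this with ⟨rfl, rfl⟩ | ⟨rfl, rfl⟩ | ⟨rfl, rfl⟩ | ⟨rfl, rfl⟩ | ⟨rfl, rfl⟩ | ⟨rfl, rfl⟩ <;>
      push_cast at h4 h5 h6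
    · refine Or.inr ⟨.c, (v + 1, w), rfl, by simp [TriEdge], ?_, ?_, ?_⟩ <;> push_cast <;> linarith
    · refine Or.inr ⟨.a, (v, w), rfl, ?_, ?_, ?_, ?_⟩
      · simp [TriEdge]
      all_goals push_cast; linarith
    · refine Or.inr ⟨.b, (v, w), rfl, ?_, ?_, ?_, ?_⟩
      · simp [TriEdge]
      all_goals push_cast; linarith
    · exact Or.inl ⟨(v, w), by simp only; linarith, by simp only; linarith⟩
    · exact Or.inl ⟨(v + 1, w), by push_cast; linarith, by simp only; linarith⟩
    · exact Or.inl ⟨(v, w + 1), by simp only; linarith, by push_cast; linarith⟩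
  obtain ⟨⟨v, w⟩, b⟩ := t
  obtain ⟨⟨v', w'⟩, b'⟩ := t'
  cases b <;> cases b'
  · left
    obtain ⟨h1, h2, h3⟩ := h
    obtain ⟨h4, h5, h6⟩ := h'
    simp only at *
    -- Triangles of equal orientation meet in the region cut out by the extremes of their bounds; if
    -- they differ, integrality leaves at most one point of it. The same reasoning serves for upward
    -- triangles.
    have hs : min v v' + min w w' + 1 ≤ max (v + w) (v' + w') := by
      simp only [ne_eq, Prod.mk.injEq, and_true] at hne
      omega
    have hs' : ((min v v' : ℤ) : ℝ) + (min w w' : ℤ) + 1 ≤ (max (v + w) (v' + w') : ℤ) := by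
      exact_mod_cast hs
    have e1 : x ≤ ((min v v' : ℤ) : ℝ) + 1 := by
      rcases min_choice v v' with h | h <;> rw [h] <;> assumption
    have e2 : y ≤ ((min w w' : ℤ) : ℝ) + 1 := by
      rcases min_choice w w' with h | h <;> rw [h] <;> assumption
    have e3 : ((max (v + w) (v' + w') : ℤ) : ℝ) + 1 ≤ x + y := by
      rcases max_choice (v + w) (v' + w') with h | h <;> rw [h] <;> push_cast <;> assumption
    exact ⟨(min v v' + 1, min w w' + 1), by push_cast at *; linarith, by push_cast at *; linarith⟩
  · obtain h | ⟨i, s, h1, h2, h3⟩ := mixed _ _ _ _ h' h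
    exacts [Or.inl h, Or.inr ⟨i, s, h2, h1, h3⟩]
  · exact mixed _ _ _ _ h h'
  · left
    obtain ⟨h1, h2, h3⟩ := h
    obtain ⟨h4, h5, h6⟩ := h'
    simp only at *
    have hs : min (v + w) (v' + w') + 1 ≤ max v v' + max w w' := by
      simp only [ne_eq, Prod.mk.injEq, and_true] at hne
      omega
    have hs' : ((min (v + w) (v' + w') : ℤ) : ℝ) + 1 ≤ (max v v' : ℤ) + (max w w' : ℤ) := by
      exact_mod_cast hs
    have e1 : ((max v v' : ℤ) : ℝ) ≤ x := by
      rcases max_choice v v' with h | h <;> rw [h] <;> assumption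
    have e2 : ((max w w' : ℤ) : ℝ) ≤ y := by
      rcases max_choice w w' with h | h <;> rw [h] <;> assumption
    have e3 : x + y ≤ ((min (v + w) (v' + w') : ℤ) : ℝ) + 1 := by
      rcases min_choice (v + w) (v' + w') with h | h <;> rw [h] <;> push_cast <;> assumption
    exact ⟨(max v v', max w w'), by push_cast at *; linarith, by push_cast at *; linarith⟩

/-- The only edge of a half of a lozenge that is not a side is the short diagonal, and the lozenge
covers both triangles at that edge. -/
theorem Covers.hasSide {A : Loz} {t : Tri} {i : Dir} {w : Vtx} (h : Covers A t)
    (ht : TriEdge t i w) : HasSide A i w ∨ ∀ t', TriEdge t' i w → Covers A t' := by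
  obtain ⟨⟨x, y⟩, m⟩ := A
  obtain ⟨x', y'⟩ := w
  by_cases hi : i = m
  · right
    subst hi
    rintro ⟨⟨v, v'⟩, b⟩ ht'
    rcases h with rfl | rfl <;> cases i <;> cases b <;>
      simp only [TriEdge, Covers, dn, Prod.mk.injEq, reduceCtorEq, and_false, and_true,
        or_false, false_or] at * <;> omega
  · left
    refine ⟨hi, ?_⟩
    rcases h with rfl | rfl <;> cases i <;>
      simp only [TriEdge] at ht <;> simp [lo, up, ht]

theorem stepUp_of_hasSide {A B : Loz} {i : Dir} {w : Vtx} (hA : HasSide A i w)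
    (hB : HasSide B i w) (h : ¬ (A.1 = B.1 ∨ dn A = dn B)) :
    (StepUp i A B ∧ w = up i A) ∨ (StepUp i B A ∧ w = up i B) := by
  obtain ⟨h1, h2⟩ := hA
  obtain ⟨h3, h4⟩ := hB
  rcases h2 with rfl | rfl <;> rcases h4 with h4 | h4
  · exact absurd (eq_or_eq_of_lo_eq h4) h
  · exact Or.inr ⟨⟨h3, h1, h4.symm⟩, h4⟩
  · exact Or.inl ⟨⟨h1, h3, h4⟩, rfl⟩
  · exact absurd (eq_or_eq_of_up_eq h4) h

/-- The level of a point with respect to the lattice lines of direction `i`. -/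
def level : Dir → ℝ → ℝ → ℝ
  | .a, _, y => y
  | .b, x, _ => x
  | .c, x, y => x + y

theorem level_le_up {i : Dir} {l : Loz} {t : Tri} {x y : ℝ} (hi : i ≠ l.2) (ht : Covers l t)
    (h : InTri t x y) : level i x y ≤ level i (up i l).1 (up i l).2 ∧
      (level i (up i l).1 (up i l).2 ≤ level i x y → InSeg i (up i l) x y) := by
  obtain ⟨⟨v, w⟩, m⟩ := l
  rcases ht with rfl | rfl <;> cases i <;> cases m <;>
    first
    | exact absurd rfl hi
    | (simp only [InTri, dn, up, level, InSeg] at *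
       push_cast at *
       refine ⟨by linarith, fun h => ⟨by linarith, by linarith, by linarith⟩⟩)

theorem lo_le_level {i : Dir} {l : Loz} {t : Tri} {x y : ℝ} (hi : i ≠ l.2) (ht : Covers l t)
    (h : InTri t x y) : level i (lo i l).1 (lo i l).2 ≤ level i x y := by
  obtain ⟨⟨v, w⟩, m⟩ := l
  rcases ht with rfl | rfl <;> cases i <;> cases m <;>
    first
    | exact absurd rfl hi
    | (simp only [InTri, dn, lo, level] at *
       push_cast at *
       linarith)

theorem InSeg.inTri {i : Dir} {w : Vtx} {x y : ℝ} (h : InSeg i w x y) {t : Tri}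
    (ht : TriEdge t i w) : InTri t x y := by
  obtain ⟨⟨v, v'⟩, b⟩ := t
  cases b <;> cases i <;> simp only [TriEdge] at ht <;> subst ht <;>
    simp only [InSeg, InTri] at * <;> push_cast at * <;>
    exact ⟨by linarith, by linarith, by linarith⟩

theorem exists_triEdge {l : Loz} {i : Dir} {w : Vtx} (h : HasSide l i w) :
    ∃ t, Covers l t ∧ TriEdge t i w := by
  obtain ⟨⟨x, y⟩, m⟩ := l
  obtain ⟨-, rfl | rfl⟩ := h <;> cases i
  exacts [⟨_, Or.inl rfl, rfl⟩, ⟨_, Or.inl rfl, rfl⟩, ⟨_, Or.inr rfl, rfl⟩, ⟨_, Or.inr rfl, rfl⟩,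
    ⟨_, Or.inr rfl, rfl⟩, ⟨_, Or.inl rfl, rfl⟩]

theorem seg_subset_tile {p u : ℂ} (hu : u ≠ 0) {l : Loz} {i : Dir} {w : Vtx}
    (h : HasSide l i w) : seg p u i w ⊆ tile p u l := by
  intro z hz
  rw [← pos_coord hu z (p := p), pos_mem_seg hu] at hz
  obtain ⟨t, h1, h2⟩ := exists_triEdge h
  exact (mem_tile_iff hu).2 ⟨t, h1, hz.inTri h2⟩

/-- The line through the common side separates the two lozenges, and `A` attains its top `level`
only along its upper side. -/
theorem tile_inter_of_stepUp {p u : ℂ} (hu : u ≠ 0) {A B : Loz} {i : Dir} (h : StepUp i A B) :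
    tile p u A ∩ tile p u B = seg p u i (up i A) := by
  refine Set.Subset.antisymm ?_ (Set.subset_inter (seg_subset_tile hu ⟨h.1, Or.inr rfl⟩)
    (seg_subset_tile hu ⟨h.2.1, Or.inl h.2.2⟩))
  rintro z ⟨h1, h2⟩
  obtain ⟨t, ht, h1⟩ := (mem_tile_iff hu).1 h1
  obtain ⟨t', ht', h2⟩ := (mem_tile_iff hu).1 h2
  have h3 := level_le_up h.1 ht h1
  have h4 := lo_le_level h.2.1 ht' h2
  rw [← h.2.2] at h4
  rw [← pos_coord hu z (p := p), pos_mem_seg hu]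
  exact h3.2 h4

theorem midpoint_mem_rhombus {p u z w : ℂ} (hz : z ∈ rhombus p u) (hw : w ∈ rhombus p u) :
    (z + w) / 2 ∈ rhombus p u := by
  obtain ⟨s, t, h1, h2, h3, h4, rfl⟩ := hz
  obtain ⟨s', t', h1', h2', h3', h4', rfl⟩ := hw
  refine ⟨(s + s') / 2, (t + t') / 2, by linarith, by linarith, by linarith, by linarith, ?_⟩
  push_cast
  ring

theorem midpoint_mem_tile {p u z w : ℂ} {l : Loz} (hz : z ∈ tile p u l) (hw : w ∈ tile p u l) :
    (z + w) / 2 ∈ tile p u l := by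
  obtain ⟨v, m⟩ := l
  cases m <;> exact midpoint_mem_rhombus hz hw

/-- The four vertices of a lozenge represent the four classes modulo 2, so the midpoint of two
different ones is not a lattice vertex. -/
theorem verts_parity {l : Loz} {v w s : Vtx} (hv : v ∈ verts l) (hw : w ∈ verts l)
    (h1 : v.1 + w.1 = 2 * s.1) (h2 : v.2 + w.2 = 2 * s.2) : v = w := by
  obtain ⟨⟨x, y⟩, m⟩ := l
  simp only [verts, List.mem_cons, List.not_mem_nil, or_false] at hv hw
  cases m <;> rcases hv with rfl | rfl | rfl | rfl <;> rcases hw with rfl | rfl | rfl | rfl <;>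
    simp only [apex] at h1 h2 ⊢ <;> first | rfl | (exfalso; omega)

/-- Without a common side the intersection contains only lattice vertices. It is also closed under
midpoints, so by `verts_parity` it has only one point. -/
theorem touch_of_packed {p u : ℂ} (hu : ‖u‖ = 1) {A B : Loz}
    (hp : ¬ (A.1 = B.1 ∨ dn A = dn B)) (h : (tile p u A ∩ tile p u B).Nonempty) :
    (∃ v, IsVertex (tile p u A) v ∧ IsVertex (tile p u B) v ∧ tile p u A ∩ tile p u B = {v}) ∨
      (∃ e, IsSide (tile p u A) e ∧ IsSide (tile p u B) e ∧ tile p u A ∩ tile p u B = e) := by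
  have hu0 := ne_zero_of_norm hu
  by_cases hs : ∃ i w, HasSide A i w ∧ HasSide B i w
  · right
    obtain ⟨i, w, hA, hB⟩ := hs
    refine ⟨seg p u i w, (isSide_tile hu).2 ⟨i, w, hA, rfl⟩,
      (isSide_tile hu).2 ⟨i, w, hB, rfl⟩, ?_⟩
    rcases stepUp_of_hasSide hA hB hp with ⟨h, rfl⟩ | ⟨h, rfl⟩
    · exact tile_inter_of_stepUp hu0 h
    · rw [Set.inter_comm]
      exact tile_inter_of_stepUp hu0 h
  · left
    have hlat : ∀ z ∈ tile p u A ∩ tile p u B, ∃ v, z = pt p u v := by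
      rintro z ⟨h1, h2⟩
      obtain ⟨t, ht, h1⟩ := (mem_tile_iff hu0).1 h1
      obtain ⟨t', ht', h2⟩ := (mem_tile_iff hu0).1 h2
      have hov : ¬ Covers B t := by
        intro h
        apply hp
        exact ht.overlap h
      have hov' : ¬ Covers A t' := by
        intro h
        apply hp
        exact h.overlap ht'
      have hne : t ≠ t' := by
        rintro rfl
        exact hov ht'
      rcases inTri_inter hne h1 h2 with ⟨v, hx, hy⟩ | ⟨i, w, e1, e2, e3⟩
      · refine ⟨v, ?_⟩
        rw [← pos_coord hu0 z (p := p), hx, hy, pt]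
      · have hA := (ht.hasSide e1).resolve_right fun h => hov' (h _ e2)
        have hB := (ht'.hasSide e2).resolve_right fun h => hov (h _ e1)
        exact absurd ⟨i, w, hA, hB⟩ hs
    obtain ⟨z, hz⟩ := h
    obtain ⟨v, rfl⟩ := hlat z hz
    have hvA := (pt_mem_tile hu0).1 hz.1
    refine ⟨pt p u v, (isVertex_tile hu).2 ⟨v, hvA, rfl⟩,
      (isVertex_tile hu).2 ⟨v, (pt_mem_tile hu0).1 hz.2, rfl⟩, ?_⟩
    refine Set.Subset.antisymm (fun z' hz' => ?_) (Set.singleton_subset_iff.2 hz)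
    obtain ⟨w, rfl⟩ := hlat z' hz'
    obtain ⟨s, hs⟩ := hlat _ ⟨midpoint_mem_tile hz.1 hz'.1, midpoint_mem_tile hz.2 hz'.2⟩
    have e : (pt p u v + pt p u w) / 2 = pos p u ((v.1 + w.1) / 2) ((v.2 + w.2) / 2) := by
      simp only [pt, pos]
      push_cast
      ring
    rw [e] at hs
    obtain ⟨h1, h2⟩ := pos_injective hu0 hs
    have h3 : v = w := verts_parity (s := s) hvA ((pt_mem_tile hu0).1 hz'.1)
      (by exact_mod_cast (by linarith : (v.1 : ℝ) + w.1 = 2 * s.1))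
      (by exact_mod_cast (by linarith : (v.2 : ℝ) + w.2 = 2 * s.2))
    rw [h3]
    rfl

/-! ### Translation between tiles and lozenges -/

theorem rhombus_neg (q v : ℂ) : rhombus q (-v) = rhombus (q - v - omega * v) v := by
  ext z
  constructor
  · rintro ⟨s, t, h1, h2, h3, h4, rfl⟩
    refine ⟨1 - s, 1 - t, by linarith, by linarith, by linarith, by linarith, ?_⟩
    push_cast
    ring
  · rintro ⟨s, t, h1, h2, h3, h4, rfl⟩
    refine ⟨1 - s, 1 - t, by linarith, by linarith, by linarith, by linarith, ?_⟩
    push_cast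
    ring

/-- The unit rhombi with corner and side in the lattice are tiles of lozenges. -/
theorem exists_tile_eq_rhombus (p u : ℂ) (v : Vtx) {s : ℂ} {i : Dir}
    (hs : s = u * vec i ∨ s = -(u * vec i)) : ∃ l, rhombus (pt p u v) s = tile p u l := by
  have ho := omega_sq
  have ho2 : omega - 1 = omega ^ 2 := ho.symm
  rcases hs with rfl | rfl <;> cases i <;> simp only [vec, mul_one, ho2, rhombus_neg]
  · exact ⟨(v, .c), rfl⟩
  · exact ⟨((v.1 - 1, v.2 + 1), .a), by simp [tile]⟩
  · exact ⟨((v.1 - 1, v.2), .b), by simp [tile]⟩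
  · refine ⟨((v.1 - 1, v.2 - 1), .c), ?_⟩
    rw [tile]
    congr 1
    simp only [pt, pos]
    push_cast
    ring
  · refine ⟨((v.1, v.2 - 1), .a), ?_⟩
    rw [tile]
    congr 1
    simp only [pt, pos]
    push_cast
    linear_combination (-u) * ho
  · refine ⟨((v.1 + 1, v.2 - 1), .b), ?_⟩
    rw [tile]
    congr 1
    simp only [pt, pos]
    push_cast
    linear_combination (-u * omega - 2 * u) * ho

theorem exists_pt_add (p u : ℂ) (v : Vtx) {s : ℂ} {i : Dir}
    (hs : s = u * vec i ∨ s = -(u * vec i)) : ∃ w, pt p u w = pt p u v + s := by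
  rcases hs with rfl | rfl
  · exact ⟨tip i v, pt_tip p u i v⟩
  · cases i
    · exact ⟨(v.1 - 1, v.2), by simp only [pt, pos, vec]; push_cast; ring⟩
    · exact ⟨(v.1, v.2 - 1), by simp only [pt, pos, vec]; push_cast; ring⟩
    · exact ⟨(v.1 + 1, v.2 - 1), by simp only [pt, pos, vec]; push_cast; ring⟩

theorem exists_unit_of_omega_mul {u s : ℂ} {i : Dir}
    (hs : omega * s = u * vec i ∨ omega * s = -(u * vec i)) :
    ∃ j, s = u * vec j ∨ s = -(u * vec j) := by
  have ho := omega_sq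
  have h1 : omega * (1 - omega) = 1 := by linear_combination -ho
  have h2 : s = omega * s * (1 - omega) := by linear_combination -s * h1
  rcases hs with hs | hs <;> rw [hs] at h2 <;> cases i <;> simp only [vec] at h2
  · exact ⟨.c, Or.inr (by simp only [h2, vec]; ring)⟩
  · exact ⟨.a, Or.inl (by simp only [h2, vec]; linear_combination u * h1)⟩
  · exact ⟨.b, Or.inl (by simp only [h2, vec]; linear_combination (-u) * ho)⟩
  · exact ⟨.c, Or.inl (by simp only [h2, vec]; ring)⟩
  · exact ⟨.a, Or.inr (by simp only [h2, vec]; linear_combination (-u) * h1)⟩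
  · exact ⟨.b, Or.inr (by simp only [h2, vec]; linear_combination u * ho)⟩

theorem exists_omega_mul {u s : ℂ} {i : Dir} (hs : s = u * vec i ∨ s = -(u * vec i)) :
    ∃ j, omega * s = u * vec j ∨ omega * s = -(u * vec j) := by
  have ho := omega_sq
  rcases hs with rfl | rfl <;> cases i <;> simp only [vec]
  · exact ⟨.b, Or.inl (by ring)⟩
  · exact ⟨.c, Or.inl (by linear_combination u * ho)⟩
  · exact ⟨.a, Or.inr (by linear_combination u * ho)⟩
  · exact ⟨.b, Or.inr (by ring)⟩
  · exact ⟨.c, Or.inr (by linear_combination (-u) * ho)⟩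
  · exact ⟨.a, Or.inl (by linear_combination (-u) * ho)⟩

/-- The ends of a segment that is a lattice edge. -/
theorem ends_of_segment_eq_seg {p u : ℂ} (hu : ‖u‖ = 1) {i : Dir} {w : Vtx} {a s : ℂ}
    (hs : ‖s‖ = 1) (h : segment ℝ a (a + s) = seg p u i w) :
    (∃ v, a = pt p u v) ∧ (s = u * vec i ∨ s = -(u * vec i)) := by
  rcases segment_ends h.symm (norm_edge hu i w) (by rwa [add_sub_cancel_left]) with
    ⟨h1, h2⟩ | ⟨h1, h2⟩
  · refine ⟨⟨_, h1⟩, Or.inl ?_⟩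
    rw [h1, pt_tip] at h2
    exact add_left_cancel h2
  · refine ⟨⟨_, h1⟩, Or.inr ?_⟩
    rw [h1, pt_tip] at h2
    linear_combination h2

/-- A tile that has a lattice edge as a side belongs to a lozenge. -/
theorem exists_tile_of_isSide {p u : ℂ} (hu : ‖u‖ = 1) {B : Set ℂ} {i : Dir} {w : Vtx}
    (h : IsSide B (seg p u i w)) : ∃ l, B = tile p u l := by
  obtain ⟨q, s, hs, rfl, he⟩ := h
  have hos : ‖omega * s‖ = 1 := by rw [norm_mul, norm_omega, hs, one_mul]
  have fin : ∀ {j : Dir}, (∃ v, q = pt p u v) → (s = u * vec j ∨ s = -(u * vec j)) →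
      ∃ l, rhombus q s = tile p u l := by
    rintro j ⟨v, rfl⟩ h
    exact exists_tile_eq_rhombus p u v h
  -- For a side that does not start at `q`, the corner `q` is reached by stepping back along a
  -- lattice unit.
  have sub : ∀ {j : Dir} {t : ℂ}, (∃ v, q + t = pt p u v) → (t = u * vec j ∨ t = -(u * vec j)) →
      ∃ v, q = pt p u v := by
    rintro j t ⟨v, hv⟩ h
    obtain ⟨w, hw⟩ := exists_pt_add p u v (s := -t) (i := j) (by
      rcases h with rfl | rfl
      · exact Or.inr rfl
      · exact Or.inl (neg_neg _))
    exact ⟨w, by rw [hw, ← hv]; ring⟩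
  rcases he with he | he | he | he
  · obtain ⟨h1, h2⟩ := ends_of_segment_eq_seg hu hs he.symm
    exact fin h1 h2
  · obtain ⟨h1, h2⟩ := ends_of_segment_eq_seg hu hos he.symm
    obtain ⟨j, hj⟩ := exists_unit_of_omega_mul h2
    exact fin h1 hj
  · obtain ⟨h1, h2⟩ := ends_of_segment_eq_seg hu hos he.symm
    obtain ⟨j, hj⟩ := exists_unit_of_omega_mul h2
    exact fin (sub h1 hj) hj
  · rw [show q + s + omega * s = q + omega * s + s by ring] at he
    obtain ⟨h1, h2⟩ := ends_of_segment_eq_seg hu hs he.symm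
    obtain ⟨j, hj⟩ := exists_omega_mul h2
    exact fin (sub h1 hj) h2

/-- Tiles that touch in a vertex or a side only do not overlap. -/
theorem not_overlap_of_touch {p u : ℂ} (hu : ‖u‖ = 1) {A B : Loz}
    (h : (∃ v, IsVertex (tile p u A) v ∧ IsVertex (tile p u B) v ∧
        tile p u A ∩ tile p u B = {v}) ∨
      (∃ e, IsSide (tile p u A) e ∧ IsSide (tile p u B) e ∧ tile p u A ∩ tile p u B = e)) :
    ¬ (A.1 = B.1 ∨ dn A = dn B) := by
  have hu0 := ne_zero_of_norm hu
  intro ho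
  obtain ⟨t, hA, hB⟩ : ∃ t, Covers A t ∧ Covers B t := by
    rcases ho with ho | ho
    · exact ⟨_, Or.inl rfl, Or.inl (by rw [ho])⟩
    · exact ⟨_, Or.inr rfl, Or.inr (by rw [ho])⟩
  have hv : ∀ v ∈ triVerts t, pt p u v ∈ tile p u A ∩ tile p u B := fun v hv =>
    ⟨(pt_mem_tile hu0).2 (hA.verts hv), (pt_mem_tile hu0).2 (hB.verts hv)⟩
  obtain ⟨x, y, z, hx, hy, hz, hxy, hxz, hyz⟩ : ∃ x y z, x ∈ triVerts t ∧ y ∈ triVerts t ∧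
      z ∈ triVerts t ∧ x ≠ y ∧ x ≠ z ∧ y ≠ z := by
    obtain ⟨⟨a, b⟩, c⟩ := t
    cases c
    · exact ⟨(a + 1, b), (a, b + 1), (a + 1, b + 1), by simp [triVerts], by simp [triVerts],
        by simp [triVerts], by simp, by simp, by simp⟩
    · exact ⟨(a, b), (a + 1, b), (a, b + 1), by simp [triVerts], by simp [triVerts],
        by simp [triVerts], by simp, by simp, by simp⟩
  rcases h with ⟨v, -, -, h⟩ | ⟨e, he, -, h⟩
  · rw [h] at hv
    exact hxy (pt_injective hu0 ((hv x hx).trans (hv y hy).symm))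
  · obtain ⟨i, w, -, rfl⟩ := (isSide_tile hu).1 he
    rw [h] at hv
    have h1 := (pt_mem_seg hu0).1 (hv x hx)
    have h2 := (pt_mem_seg hu0).1 (hv y hy)
    have h3 := (pt_mem_seg hu0).1 (hv z hz)
    rcases h1 with rfl | rfl <;> rcases h2 with rfl | rfl <;> rcases h3 with rfl | rfl <;>
      simp_all

/-- The edge at `w` matters only through its direction: it stands for the segment `d` in the
definition of a run. -/
theorem share_iff {p u : ℂ} (hu : ‖u‖ = 1) {A B : Loz} (h : ¬ (A.1 = B.1 ∨ dn A = dn B))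
    {i : Dir} {w : Vtx} :
    (∃ e, IsSide (tile p u A) e ∧ IsSide (tile p u B) e ∧ ParallelSides e (seg p u i w)) ↔
      AdjIn i A B := by
  constructor
  · rintro ⟨e, hA, hB, he⟩
    obtain ⟨j, v, hA', rfl⟩ := (isSide_tile hu).1 hA
    obtain ⟨j', v', hB', h'⟩ := (isSide_tile hu).1 hB
    obtain ⟨rfl, rfl⟩ := seg_injective hu h'
    obtain rfl := (parallelSides_seg hu).1 he
    exact (stepUp_of_hasSide hA' hB' h).imp (fun h => h.1) fun h => h.1
  · rintro (h | h)
    · exact ⟨seg p u i (up i A), (isSide_tile hu).2 ⟨i, _, ⟨h.1, Or.inr rfl⟩, rfl⟩,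
        (isSide_tile hu).2 ⟨i, _, ⟨h.2.1, Or.inl h.2.2⟩, rfl⟩, (parallelSides_seg hu).2 rfl⟩
    · exact ⟨seg p u i (up i B), (isSide_tile hu).2 ⟨i, _, ⟨h.2.1, Or.inl h.2.2⟩, rfl⟩,
        (isSide_tile hu).2 ⟨i, _, ⟨h.1, Or.inr rfl⟩, rfl⟩, (parallelSides_seg hu).2 rfl⟩

theorem AdjIn.not_overlap {i : Dir} {A B : Loz} (h : AdjIn i A B) :
    ¬ (A.1 = B.1 ∨ dn A = dn B) := by
  obtain ⟨⟨x, y⟩, m⟩ := A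
  obtain ⟨⟨x', y'⟩, m'⟩ := B
  revert h
  cases i <;> cases m <;> cases m' <;>
    simp only [AdjIn, StepUp, up, lo, dn, ne_eq, reduceCtorEq, not_true_eq_false,
      not_false_eq_true, true_and, false_and, Prod.mk.injEq, or_self, false_imp_iff] <;> omega

theorem adj_tile_iff {p u : ℂ} (hu : ‖u‖ = 1) {L : Set Loz} (hL : Packed L) {A B : Loz}
    (hA : A ∈ L) (hB : B ∈ L) :
    adjacencyGraph.Adj (tile p u A) (tile p u B) ↔ LAdj A B := by
  constructor
  · rintro ⟨hne, e, h1, h2⟩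
    have ho : ¬ (A.1 = B.1 ∨ dn A = dn B) := fun h => hne (by rw [hL A hA B hB h])
    obtain ⟨i, w, -, rfl⟩ := (isSide_tile hu).1 h1
    exact ⟨i, (share_iff hu ho (w := w)).1 ⟨_, h1, h2, (parallelSides_seg hu).2 rfl⟩⟩
  · rintro ⟨i, h⟩
    obtain ⟨e, h1, h2, -⟩ := (share_iff (p := p) hu h.not_overlap (w := 0)).2 h
    exact ⟨fun h' => h.ne (tile_injective (ne_zero_of_norm hu) h'), e, h1, h2⟩

theorem isRun_map_iff {p u : ℂ} (hu : ‖u‖ = 1) {L : Set Loz} (hL : Packed L) {K : List Loz} :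
    IsRun (tile p u '' L) (K.map (tile p u)) ↔
      2 ≤ K.length ∧ K.Nodup ∧ (∀ A ∈ K, A ∈ L) ∧ ∃ i, K.IsChain (AdjIn i) := by
  have hinj := tile_injective (p := p) (ne_zero_of_norm hu)
  rw [IsRun, List.length_map, List.nodup_map_iff hinj]
  refine and_congr_right fun hlen => and_congr_right fun hnd => ?_
  rw [show (∀ A ∈ K.map (tile p u), A ∈ tile p u '' L) ↔ ∀ A ∈ K, A ∈ L by
    refine List.forall_mem_map.trans (forall₂_congr fun A _ => ?_)
    exact hinj.mem_set_image]
  refine and_congr_right fun hKL => ?_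
  have hno : ∀ A ∈ K, ∀ B ∈ K, A ≠ B → ¬ (A.1 = B.1 ∨ dn A = dn B) := fun A hA B hB hne h =>
    hne (hL A (hKL A hA) B (hKL B hB) h)
  constructor
  · rintro ⟨d, hd⟩
    rw [List.isChain_map] at hd
    obtain ⟨A, B, K, rfl⟩ : ∃ A B K', K = A :: B :: K' := by
      match K, hlen with
      | A :: B :: K', _ => exact ⟨A, B, K', rfl⟩
    obtain ⟨e, hA, hB, hed⟩ := (List.isChain_cons_cons.1 hd).1
    obtain ⟨i, w, -, rfl⟩ := (isSide_tile hu).1 hA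
    refine ⟨i, ?_⟩
    rw [List.isChain_iff_getElem] at hd ⊢
    intro n hn
    obtain ⟨e, h1, h2, he⟩ := hd n hn
    refine (share_iff hu (w := w) (hno _ (List.getElem_mem _) _ (List.getElem_mem _) ?_)).1
      ⟨e, h1, h2, he.trans hed⟩
    intro h
    have := (hnd.getElem_inj_iff).1 h
    omega
  · rintro ⟨i, hi⟩
    refine ⟨seg p u i 0, ?_⟩
    rw [List.isChain_map]
    exact hi.imp fun A B h => (share_iff hu h.not_overlap).2 h

theorem chain_three {L : Set Loz} (hL : Packed L) {i : Dir} {A B C : Loz} (hA : A ∈ L)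
    (hC : C ∈ L) (hAC : A ≠ C) (h1 : AdjIn i A B) (h2 : AdjIn i B C) :
    (StepUp i A B ∧ StepUp i B C) ∨ (StepUp i C B ∧ StepUp i B A) := by
  rcases h1 with h1 | h1 <;> rcases h2 with h2 | h2
  · exact Or.inl ⟨h1, h2⟩
  · exact absurd (hL.down_unique hA hC h1 h2) hAC
  · exact absurd (hL.up_unique hA hC h1 h2) hAC
  · exact Or.inr ⟨h2, h1⟩

theorem StepUp.not_adj {i j : Dir} {A B C : Loz} (h1 : StepUp i A B) (h2 : StepUp i B C) :
    ¬ AdjIn j A C := by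
  obtain ⟨⟨x, y⟩, m⟩ := A
  obtain ⟨⟨x', y'⟩, m'⟩ := B
  obtain ⟨⟨x'', y''⟩, m''⟩ := C
  revert h1 h2
  cases i <;> cases m <;> cases m' <;> cases m'' <;> cases j <;>
    simp only [AdjIn, StepUp, up, lo, dn, ne_eq, reduceCtorEq, not_true_eq_false,
      not_false_eq_true, true_and, false_and, Prod.mk.injEq, or_self, false_imp_iff,
      implies_true] <;> omega

theorem AdjIn.dir_unique {i j : Dir} {A B : Loz} (h1 : AdjIn i A B) (h2 : AdjIn j A B) : i = j := by
  obtain ⟨⟨x, y⟩, m⟩ := A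
  obtain ⟨⟨x', y'⟩, m'⟩ := B
  revert h1 h2
  cases i <;> cases m <;> cases m' <;> cases j <;>
    simp only [AdjIn, StepUp, up, lo, dn, ne_eq, reduceCtorEq, not_true_eq_false,
      not_false_eq_true, true_and, false_and, Prod.mk.injEq, or_self, false_imp_iff,
      implies_true] <;> omega

/-- The middles of the runs of `L`, with the directions of the runs. -/
def mids (L : Set Loz) : Set (Dir × Loz) := {q | q.2 ∈ L ∧ IsMid L q.1 q.2}

theorem StepUp.trans_ne {i : Dir} {A B C : Loz} (h1 : StepUp i A B) (h2 : StepUp i B C) :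
    A ≠ C := by
  rintro rfl
  exact h1.asymm h2

theorem run_eq {L : Set Loz} (hL : Packed L) {i : Dir} {A B C : Loz} (hA : A ∈ L) (hB : B ∈ L)
    (hC : C ∈ L) (h1 : StepUp i A B) (h2 : StepUp i B C) :
    {X | X ∈ L ∧ (X = B ∨ AdjIn i B X)} = {A, B, C} := by
  ext X
  simp only [Set.mem_ofPred_eq, Set.mem_insert_iff, Set.mem_singleton_iff]
  constructor
  · rintro ⟨hX, rfl | h | h⟩
    · simp
    · simp [hL.up_unique hX hC h h2]
    · simp [hL.down_unique hX hA h h1]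
  · rintro (rfl | rfl | rfl)
    · exact ⟨hA, Or.inr (Or.inr h1)⟩
    · exact ⟨hB, Or.inl rfl⟩
    · exact ⟨hC, Or.inr (Or.inl h2)⟩

theorem runs_eq_image {p u : ℂ} (hu : ‖u‖ = 1) {L : Set Loz} (hL : Packed L) :
    runs (tile p u '' L) = (fun q : Dir × Loz =>
      tile p u '' {X | X ∈ L ∧ (X = q.2 ∨ AdjIn q.1 q.2 X)}) '' mids L := by
  ext R
  constructor
  · rintro ⟨A, B, C, h, rfl⟩
    obtain ⟨A, hA, rfl⟩ := h.2.2.1 A (by simp)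
    obtain ⟨B, hB, rfl⟩ := h.2.2.1 B (by simp)
    obtain ⟨C, hC, rfl⟩ := h.2.2.1 C (by simp)
    obtain ⟨-, hnd, -, i, hi⟩ := (isRun_map_iff hu hL (K := [A, B, C])).1 h
    simp only [List.isChain_cons_cons, List.isChain_singleton, and_true] at hi
    have hAC : A ≠ C := by
      rintro rfl
      simp at hnd
    rcases chain_three hL hA hC hAC hi.1 hi.2 with ⟨h1, h2⟩ | ⟨h1, h2⟩
    · refine ⟨(i, B), ⟨hB, ⟨A, hA, h1⟩, C, hC, h2⟩, ?_⟩
      simp only [run_eq hL hA hB hC h1 h2, Set.image_insert_eq, Set.image_singleton]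
    · refine ⟨(i, B), ⟨hB, ⟨C, hC, h1⟩, A, hA, h2⟩, ?_⟩
      simp only [run_eq hL hC hB hA h1 h2, Set.image_insert_eq, Set.image_singleton]
      ext X
      simp only [Set.mem_insert_iff, Set.mem_singleton_iff]
      tauto
  · rintro ⟨⟨i, B⟩, ⟨hB, ⟨A, hA, h1⟩, C, hC, h2⟩, rfl⟩
    refine ⟨tile p u A, tile p u B, tile p u C, ?_, ?_⟩
    · refine (isRun_map_iff hu hL (K := [A, B, C])).2 ⟨by simp, ?_, ?_, i, ?_⟩
      · simp [h1.ne, h2.ne, h1.trans_ne h2]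
      · simp only [List.mem_cons, List.not_mem_nil, or_false, forall_eq_or_imp, forall_eq]
        exact ⟨hA, hB, hC⟩
      · simp only [List.isChain_cons_cons, List.isChain_singleton, and_true]
        exact ⟨Or.inl h1, Or.inl h2⟩
    · simp only [run_eq hL hA hB hC h1 h2, Set.image_insert_eq, Set.image_singleton]

/-- The outer lozenges of a run share no side (`StepUp.not_adj`), so the set of the three determines
the middle, and then the direction by `AdjIn.dir_unique`. -/
theorem ncard_runs {p u : ℂ} (hu : ‖u‖ = 1) {L : Set Loz} (hL : Packed L) :
    (runs (tile p u '' L)).ncard = (mids L).ncard := by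
  rw [runs_eq_image hu hL]
  refine Set.InjOn.ncard_image ?_
  rintro ⟨i, B⟩ ⟨hB, ⟨A, hA, h1⟩, C, hC, h2⟩ ⟨i', B'⟩ ⟨hB', ⟨A', hA', h1'⟩, C', hC', h2'⟩ h
  simp only at hB hA h1 hC h2 hB' hA' h1' hC' h2' h
  have h := (tile_injective (ne_zero_of_norm hu)).image_injective h
  rw [run_eq hL hA hB hC h1 h2, run_eq hL hA' hB' hC' h1' h2'] at h
  have mA : A ∈ ({A', B', C'} : Set Loz) := h ▸ by simp
  have mC : C ∈ ({A', B', C'} : Set Loz) := h ▸ by simp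
  have mB' : B' ∈ ({A, B, C} : Set Loz) := h ▸ by simp
  have adj : ∀ X ∈ ({A', B', C'} : Set Loz), X ≠ B' → AdjIn i' B' X := by
    rintro X (rfl | rfl | rfl) hX
    exacts [Or.inr h1', absurd rfl hX, Or.inl h2']
  rcases mB' with rfl | rfl | rfl
  · exact absurd (adj C mC (h1.trans_ne h2).symm) (h1.not_adj h2)
  · have := (adj A mA h1.ne).dir_unique (Or.inr h1)
    rw [this]
  · exact absurd (adj A mA (h1.trans_ne h2)).symm (h1.not_adj h2)

/-- Run extension yields a lozenge beyond one end of the pair; lozenges beyond both ends would make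
a run of four. -/
theorem runsOfThree_of_runs {p u : ℂ} (hu : ‖u‖ = 1) {L : Set Loz} (hL : Packed L)
    (h1 : ∀ A ∈ tile p u '' L, ∀ B ∈ tile p u '' L, A ≠ B → ∀ s, IsSide A s → IsSide B s →
      ∃ C ∈ tile p u '' L, C ≠ A ∧ C ≠ B ∧
        ∃ q, IsSide C q ∧ (IsSide A q ∨ IsSide B q) ∧ ParallelSides q s)
    (h2 : ∀ l, IsRun (tile p u '' L) l → l.length ≤ 3) : RunsOfThree L := by
  intro i A hA B hB hAB
  have hex : (∃ C ∈ L, StepUp i B C) ∨ ∃ C ∈ L, StepUp i C A := by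
    obtain ⟨_, ⟨C, hC, rfl⟩, hCA, hCB, q, hq, hq', hqs⟩ := h1 _ ⟨A, hA, rfl⟩ _ ⟨B, hB, rfl⟩
      (fun h => hAB.ne (tile_injective (ne_zero_of_norm hu) h)) (seg p u i (up i A))
      ((isSide_tile hu).2 ⟨i, _, ⟨hAB.1, Or.inr rfl⟩, rfl⟩)
      ((isSide_tile hu).2 ⟨i, _, ⟨hAB.2.1, Or.inl hAB.2.2⟩, rfl⟩)
    have hno : ∀ X ∈ L, tile p u C ≠ tile p u X → ¬ (X.1 = C.1 ∨ dn X = dn C) :=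
      fun X hX hne h => hne (by rw [hL X hX C hC h])
    rcases hq' with hq' | hq'
    · rcases (share_iff hu (hno A hA hCA)).1 ⟨q, hq', hq, hqs⟩ with h | h
      · exact absurd (congrArg _ (hL.up_unique hC hB h hAB)) hCB
      · exact Or.inr ⟨C, hC, h⟩
    · rcases (share_iff hu (hno B hB hCB)).1 ⟨q, hq', hq, hqs⟩ with h | h
      · exact Or.inl ⟨C, hC, h⟩
      · exact absurd (congrArg _ (hL.down_unique hC hA h hAB)) hCA
  have hnot : ¬ ((∃ C ∈ L, StepUp i B C) ∧ ∃ C ∈ L, StepUp i C A) := by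
    rintro ⟨⟨C, hC, hBC⟩, D, hD, hDA⟩
    have hDC : D ≠ C := by
      rintro rfl
      exact hDA.not_adj hAB (Or.inr hBC)
    have := h2 _ ((isRun_map_iff hu hL (K := [D, A, B, C])).2 ⟨by simp, ?_, ?_, i, ?_⟩)
    · simp at this
    · simp [hDA.ne, hAB.ne, hBC.ne, hDC, hDA.trans_ne hAB, hAB.trans_ne hBC]
    · simp only [List.mem_cons, List.not_mem_nil, or_false, forall_eq_or_imp, forall_eq]
      exact ⟨hD, hA, hB, hC⟩
    · simp only [List.isChain_cons_cons, List.isChain_singleton, and_true]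
      exact ⟨Or.inl hDA, Or.inl hAB, Or.inl hBC⟩
  rcases hex with h | h
  · exact Or.inl ⟨h, fun h' => hnot ⟨h, h'⟩⟩
  · exact Or.inr ⟨h, fun h' => hnot ⟨h', h⟩⟩

theorem run_extends_of_runsOfThree {p u : ℂ} (hu : ‖u‖ = 1) {L : Set Loz} (hL : Packed L)
    (hr : RunsOfThree L) : ∀ A ∈ tile p u '' L, ∀ B ∈ tile p u '' L, A ≠ B → ∀ s, IsSide A s →
      IsSide B s → ∃ C ∈ tile p u '' L, C ≠ A ∧ C ≠ B ∧
        ∃ q, IsSide C q ∧ (IsSide A q ∨ IsSide B q) ∧ ParallelSides q s := by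
  have hinj := tile_injective (p := p) (ne_zero_of_norm hu)
  rintro _ ⟨A, hA, rfl⟩ _ ⟨B, hB, rfl⟩ hne s hs hs'
  obtain ⟨i, w, hAi, rfl⟩ := (isSide_tile hu).1 hs
  have hadj := (share_iff hu (fun h => hne (by rw [hL A hA B hB h])) (w := w)).1
    ⟨_, hs, hs', (parallelSides_seg hu).2 rfl⟩
  have key : ∀ X C, C ∈ L → AdjIn i X C → ∃ q, IsSide (tile p u C) q ∧ IsSide (tile p u X) q ∧
      ParallelSides q (seg p u i w) := by
    intro X C hC h
    obtain ⟨q, h1, h2, h3⟩ := (share_iff (p := p) hu h.not_overlap (w := w)).2 h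
    exact ⟨q, h2, h1, h3⟩
  have fin : ∀ A B, A ∈ L → B ∈ L → StepUp i A B → ∃ C ∈ L, C ≠ A ∧ C ≠ B ∧
      (AdjIn i A C ∨ AdjIn i B C) := by
    intro A B hA hB h
    rcases hr i A hA B hB h with ⟨⟨C, hC, h'⟩, -⟩ | ⟨⟨C, hC, h'⟩, -⟩
    · exact ⟨C, hC, (h.trans_ne h').symm, h'.ne.symm, Or.inr (Or.inl h')⟩
    · exact ⟨C, hC, h'.ne, h'.trans_ne h, Or.inl (Or.inr h')⟩
  obtain ⟨C, hC, h1, h2, h3⟩ : ∃ C ∈ L, C ≠ A ∧ C ≠ B ∧ (AdjIn i A C ∨ AdjIn i B C) := by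
    rcases hadj with h | h
    · exact fin A B hA hB h
    · obtain ⟨C, hC, h1, h2, h3⟩ := fin B A hB hA h
      exact ⟨C, hC, h2, h1, h3.symm⟩
  refine ⟨_, ⟨C, hC, rfl⟩, hinj.ne h1, hinj.ne h2, ?_⟩
  rcases h3 with h3 | h3
  · obtain ⟨q, hq⟩ := key A C hC h3
    exact ⟨q, hq.1, Or.inl hq.2.1, hq.2.2⟩
  · obtain ⟨q, hq⟩ := key B C hC h3
    exact ⟨q, hq.1, Or.inr hq.2.1, hq.2.2⟩

theorem run_le_of_runsOfThree {p u : ℂ} (hu : ‖u‖ = 1) {L : Set Loz} (hL : Packed L)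
    (hr : RunsOfThree L) (l : List (Set ℂ)) (hl : IsRun (tile p u '' L) l) : l.length ≤ 3 := by
  by_contra hlen
  obtain ⟨K, rfl⟩ : ∃ K : List Loz, K.map (tile p u) = l := by
    have : l ∈ Set.range (List.map (tile p u)) := by
      rw [Set.range_list_map]
      exact fun A hA => (hl.2.2.1 A hA).imp fun _ h => h.2
    exact this
  obtain ⟨-, hnd, hK, i, hi⟩ := (isRun_map_iff hu hL).1 hl
  rw [List.length_map] at hlen
  obtain ⟨A, B, C, D, K, rfl⟩ : ∃ A B C D K', K = A :: B :: C :: D :: K' := by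
    rcases K with _ | ⟨A, _ | ⟨B, _ | ⟨C, _ | ⟨D, K⟩⟩⟩⟩
    · simp at hlen
    · simp at hlen
    · simp at hlen
    · simp at hlen
    · exact ⟨A, B, C, D, K, rfl⟩
  simp only [List.isChain_cons_cons] at hi
  simp only [List.nodup_cons, List.mem_cons, not_or] at hnd
  have hA := hK A (by simp)
  have hB := hK B (by simp)
  have hC := hK C (by simp)
  have hD := hK D (by simp)
  rcases chain_three hL hA hC hnd.1.2.1 hi.1 hi.2.1 with ⟨h1, h2⟩ | ⟨h1, h2⟩
  · rcases chain_three hL hB hD hnd.2.1.2.1 hi.2.1 hi.2.2.1 with ⟨h3, h4⟩ | ⟨h3, h4⟩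
    · rcases hr i B hB C hC h2 with ⟨-, h⟩ | ⟨-, h⟩
      · exact h ⟨A, hA, h1⟩
      · exact h ⟨D, hD, h4⟩
    · exact h2.asymm h4
  · rcases chain_three hL hB hD hnd.2.1.2.1 hi.2.1 hi.2.2.1 with ⟨h3, h4⟩ | ⟨h3, h4⟩
    · exact h1.asymm h3
    · rcases hr i C hC B hB h1 with ⟨-, h⟩ | ⟨-, h⟩
      · exact h ⟨D, hD, h3⟩
      · exact h ⟨A, hA, h2⟩

theorem connected_induce_image {α : Type*} {G : SimpleGraph (Set ℂ)} {f : α → Set ℂ}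
    (hf : Function.Injective f) {S : Set α} : (G.induce (f '' S)).Connected ↔
      S.Nonempty ∧ ∀ A ∈ S, ∀ B ∈ S,
        Relation.ReflTransGen (fun X Y => X ∈ S ∧ Y ∈ S ∧ G.Adj (f X) (f Y)) A B := by
  rw [SimpleGraph.connected_iff]
  constructor
  · rintro ⟨h, ⟨⟨_, A, hA, rfl⟩⟩⟩
    refine ⟨⟨A, hA⟩, fun A hA B hB => ?_⟩
    have key : ∀ y, Relation.ReflTransGen (G.induce (f '' S)).Adj ⟨f A, A, hA, rfl⟩ y →
        ∀ B, f B = y.1 → Relation.ReflTransGen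
          (fun X Y => X ∈ S ∧ Y ∈ S ∧ G.Adj (f X) (f Y)) A B := by
      intro y hy
      induction hy with
      | refl =>
        intro B hB
        rw [hf hB]
      | @tail y z _ hyz ih =>
        intro B hB
        obtain ⟨_, C, hC, rfl⟩ := y
        obtain ⟨_, D, hD, rfl⟩ := z
        obtain rfl := hf hB
        exact (ih C rfl).tail ⟨hC, hD, hyz⟩
    exact key ⟨f B, B, hB, rfl⟩ ((SimpleGraph.reachable_iff_reflTransGen _ _).1 (h _ _)) B rfl
  · rintro ⟨⟨A, hA⟩, h⟩
    refine ⟨?_, ⟨⟨f A, A, hA, rfl⟩⟩⟩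
    rintro ⟨_, A, hA, rfl⟩ ⟨_, B, hB, rfl⟩
    have key : ∀ B, Relation.ReflTransGen (fun X Y => X ∈ S ∧ Y ∈ S ∧ G.Adj (f X) (f Y)) A B →
        ∀ hB : B ∈ S, (G.induce (f '' S)).Reachable ⟨f A, A, hA, rfl⟩ ⟨f B, B, hB, rfl⟩ := by
      intro B hAB
      induction hAB with
      | refl => exact fun _ => SimpleGraph.Reachable.refl _
      | tail _ h ih =>
        intro hB
        refine (ih h.1).trans (SimpleGraph.Adj.reachable ?_)
        exact h.2.2
    exact key B (h A hA B hB) hB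

theorem connected_adjacency_iff {p u : ℂ} (hu : ‖u‖ = 1) {L : Set Loz} (hL : Packed L) :
    (adjacencyGraph.induce (tile p u '' L)).Connected ↔ L.Nonempty ∧ Conn L := by
  rw [connected_induce_image (tile_injective (ne_zero_of_norm hu))]
  refine and_congr_right fun _ => forall₂_congr fun A _ => forall₂_congr fun B _ => ?_
  rw [Linked, show (fun X Y => X ∈ L ∧ Y ∈ L ∧ adjacencyGraph.Adj (tile p u X) (tile p u Y)) =
    fun X Y => X ∈ L ∧ Y ∈ L ∧ LAdj X Y from ?_]
  ext X Y
  exact and_congr_right fun hX => and_congr_right fun hY => adj_tile_iff hu hL hX hY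

/-- `A` and `B` have a vertex in common. -/
def Touches (A B : Loz) : Prop := ∃ v ∈ verts A, v ∈ verts B

theorem neighbour_tile_iff {p u : ℂ} (hu : u ≠ 0) {A B : Loz} :
    neighbourGraph.Adj (tile p u A) (tile p u B) ↔ A ≠ B ∧ Touches A B := by
  rw [← (tile_injective (p := p) hu).ne_iff]
  exact and_congr_right fun _ => inter_nonempty_iff hu

theorem connected_remove_iff {p u : ℂ} (hu : u ≠ 0) {L : Set Loz} {X : Loz} :
    (neighbourGraph.induce (tile p u '' L \ {tile p u X})).Connected ↔
      (L \ {X}).Nonempty ∧ ∀ A ∈ L \ {X}, ∀ B ∈ L \ {X}, Relation.ReflTransGen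
        (fun Y Z => Y ∈ L \ {X} ∧ Z ∈ L \ {X} ∧ Y ≠ Z ∧ Touches Y Z) A B := by
  rw [← Set.image_singleton, ← Set.image_sdiff (tile_injective hu),
    connected_induce_image (tile_injective hu)]
  simp only [neighbour_tile_iff hu]

/-- If one tile of a tredoku tiling belongs to a lozenge, then all do. -/
theorem IsTredoku.eq_image {T : Set (Set ℂ)} (hT : IsTredoku T) {p u : ℂ} (hu : ‖u‖ = 1)
    {l₀ : Loz} (h₀ : tile p u l₀ ∈ T) : T = tile p u '' {l | tile p u l ∈ T} := by
  refine Set.Subset.antisymm (fun B hB => ?_) (by rintro _ ⟨l, hl, rfl⟩; exact hl)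
  have h := (SimpleGraph.reachable_iff_reflTransGen _ _).1
    (hT.connected.preconnected ⟨_, h₀⟩ ⟨B, hB⟩)
  have key : ∀ y : T, Relation.ReflTransGen (adjacencyGraph.induce T).Adj ⟨_, h₀⟩ y →
      ∃ l, tile p u l = y.1 := by
    intro y hy
    induction hy with
    | refl => exact ⟨l₀, rfl⟩
    | @tail y z _ hyz ih =>
      obtain ⟨l, hl⟩ := ih
      obtain ⟨-, e, h1, h2⟩ := hyz
      simp only [Function.Embedding.subtype_apply, ← hl] at h1 h2
      obtain ⟨i, w, -, rfl⟩ := (isSide_tile hu).1 h1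
      obtain ⟨l', hl'⟩ := exists_tile_of_isSide hu h2
      exact ⟨l', hl'.symm⟩
  obtain ⟨l, hl⟩ := key _ h
  simp only at hl
  subst hl
  exact ⟨l, hB, rfl⟩

theorem packed_of_touch {p u : ℂ} (hu : ‖u‖ = 1) {L : Set Loz}
    (h : ∀ A ∈ tile p u '' L, ∀ B ∈ tile p u '' L, A ≠ B → (A ∩ B).Nonempty →
      (∃ v, IsVertex A v ∧ IsVertex B v ∧ A ∩ B = {v}) ∨
        (∃ e, IsSide A e ∧ IsSide B e ∧ A ∩ B = e)) : Packed L := by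
  intro A hA B hB hAB
  by_contra hne
  have hu0 := ne_zero_of_norm hu
  refine not_overlap_of_touch hu (h _ ⟨A, hA, rfl⟩ _ ⟨B, hB, rfl⟩
    ((tile_injective (p := p) hu0).ne hne) ?_) hAB
  obtain ⟨t, h1, h2⟩ : ∃ t, Covers A t ∧ Covers B t := by
    rcases hAB with h | h
    · exact ⟨_, Or.inl rfl, Or.inl (by rw [h])⟩
    · exact ⟨_, Or.inr rfl, Or.inr (by rw [h])⟩
  have hv : (t.1.1 + 1, t.1.2) ∈ triVerts t := by
    obtain ⟨v, _ | _⟩ := t <;> simp [triVerts]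
  exact (inter_nonempty_iff hu0).2 ⟨_, h1.verts hv, h2.verts hv⟩

/-! ### Triangles round a vertex and connectedness of the free triangles -/

/-- The six triangles at a vertex, in counterclockwise order, numbered modulo 6. -/
def fan (x : Vtx) (n : ℕ) : Tri :=
  match n % 6 with
  | 0 => (x, true)
  | 1 => ((x.1 - 1, x.2), false)
  | 2 => ((x.1 - 1, x.2), true)
  | 3 => ((x.1 - 1, x.2 - 1), false)
  | 4 => ((x.1, x.2 - 1), true)
  | _ => ((x.1, x.2 - 1), false)

/-- The lozenge that consists of two consecutive triangles at a vertex. -/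
def spoke (x : Vtx) (n : ℕ) : Loz :=
  match n % 6 with
  | 0 => (x, .b)
  | 1 => ((x.1 - 1, x.2), .c)
  | 2 => ((x.1 - 1, x.2), .a)
  | 3 => ((x.1, x.2 - 1), .b)
  | 4 => ((x.1, x.2 - 1), .c)
  | _ => (x, .a)

theorem fan_mod (x : Vtx) (n : ℕ) : fan x (n % 6) = fan x n := by simp [fan]

theorem fan_add_six (x : Vtx) (n : ℕ) : fan x (n + 6) = fan x n := by simp [fan]

theorem exists_mod_cases (n : ℕ) : ∃ m, n = 6 * m ∨ n = 6 * m + 1 ∨ n = 6 * m + 2 ∨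
    n = 6 * m + 3 ∨ n = 6 * m + 4 ∨ n = 6 * m + 5 := ⟨n / 6, by omega⟩

theorem spoke_covers (x : Vtx) (n : ℕ) : Covers (spoke x n) (fan x n) := by
  obtain ⟨m, rfl | rfl | rfl | rfl | rfl | rfl⟩ := exists_mod_cases n <;>
    simp [spoke, fan, Covers, dn, Nat.add_mod]

theorem spoke_covers_succ (x : Vtx) (n : ℕ) : Covers (spoke x n) (fan x (n + 1)) := by
  obtain ⟨m, rfl | rfl | rfl | rfl | rfl | rfl⟩ := exists_mod_cases n <;>
    simp [spoke, fan, Covers, dn, Nat.add_mod]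

theorem spoke_injective {x : Vtx} {m n : ℕ} (h : spoke x m = spoke x n) : m % 6 = n % 6 := by
  obtain ⟨m, rfl | rfl | rfl | rfl | rfl | rfl⟩ := exists_mod_cases m <;>
  obtain ⟨n, rfl | rfl | rfl | rfl | rfl | rfl⟩ := exists_mod_cases n <;>
    simp [spoke, Nat.add_mod, Prod.ext_iff] at h ⊢ <;> omega

theorem mem_triVerts_fan (x : Vtx) (n : ℕ) : x ∈ triVerts (fan x n) := by
  obtain ⟨m, rfl | rfl | rfl | rfl | rfl | rfl⟩ := exists_mod_cases n <;>
    simp [fan, triVerts, Nat.add_mod]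

theorem exists_fan {x : Vtx} {t : Tri} (h : x ∈ triVerts t) : ∃ n, n < 6 ∧ t = fan x n := by
  obtain ⟨v, _ | _⟩ := t <;> simp only [triVerts, List.mem_cons, List.not_mem_nil, or_false] at h <;>
    rcases h with rfl | rfl | rfl
  · exact ⟨1, by omega, by simp [fan]⟩
  · exact ⟨5, by omega, by simp [fan]⟩
  · exact ⟨3, by omega, by simp [fan]⟩
  · exact ⟨0, by omega, by simp [fan]⟩
  · exact ⟨2, by omega, by simp [fan]⟩
  · exact ⟨4, by omega, by simp [fan]⟩

/-- A lozenge covers one triangle or two consecutive triangles at each of its vertices. -/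
theorem exists_arc {l : Loz} {x : Vtx} (h : x ∈ verts l) :
    ∃ k len, 0 < len ∧ ∀ n < 6, Covers l (fan x (k + n)) ↔ n < len := by
  obtain ⟨⟨v, w⟩, m⟩ := l
  simp only [verts, List.mem_cons, List.not_mem_nil, or_false] at h
  have key : ∀ k len, 0 < len → (∀ n < 6, Covers ((v, w), m) (fan x (k + n)) ↔ n < len) →
      ∃ k len, 0 < len ∧ ∀ n < 6, Covers ((v, w), m) (fan x (k + n)) ↔ n < len :=
    fun k len h h' => ⟨k, len, h, h'⟩
  cases m <;> rcases h with rfl | rfl | rfl | rfl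
  · refine key 5 2 (by omega) fun n hn => ?_
    interval_cases n <;> simp [fan, Covers, dn]
  · refine key 2 2 (by omega) fun n hn => ?_
    interval_cases n <;> simp [fan, Covers, dn]
    omega
  · refine key 4 1 (by omega) fun n hn => ?_
    interval_cases n <;> simp [fan, Covers, dn]
    omega
  · refine key 1 1 (by omega) fun n hn => ?_
    interval_cases n <;> simp [fan, Covers, dn, apex]
  · refine key 0 2 (by omega) fun n hn => ?_
    interval_cases n <;> simp [fan, Covers, dn]
  · refine key 2 1 (by omega) fun n hn => ?_
    interval_cases n <;> simp [fan, Covers, dn]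
    omega
  · refine key 3 2 (by omega) fun n hn => ?_
    interval_cases n <;> simp [fan, Covers, dn]
    omega
  · refine key 5 1 (by omega) fun n hn => ?_
    interval_cases n <;> simp [fan, Covers, dn, apex]
  · refine key 0 1 (by omega) fun n hn => ?_
    interval_cases n <;> simp [fan, Covers, dn]
  · refine key 1 2 (by omega) fun n hn => ?_
    interval_cases n <;> simp [fan, Covers, dn]
  · refine key 4 2 (by omega) fun n hn => ?_
    interval_cases n <;> simp [fan, Covers, dn]
  · refine key 3 1 (by omega) fun n hn => ?_
    interval_cases n <;> simp [fan, Covers, dn, apex]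

/-- Two triangles with a common edge (or equal). -/
def TAdj (t t' : Tri) : Prop := ∃ l, Covers l t ∧ Covers l t'

theorem TAdj.symm {t t' : Tri} (h : TAdj t t') : TAdj t' t := h.imp fun _ h => ⟨h.2, h.1⟩

theorem tAdj_fan (x : Vtx) (n : ℕ) : TAdj (fan x n) (fan x (n + 1)) :=
  ⟨_, spoke_covers x n, spoke_covers_succ x n⟩

/-- `t` and `t'` are linked by triangles of `S`, consecutive ones having an edge in common. -/
def TLinked (S : Set Tri) : Tri → Tri → Prop :=
  Relation.ReflTransGen fun t t' => t ∈ S ∧ t' ∈ S ∧ TAdj t t'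

theorem TLinked.symm {S : Set Tri} {t t' : Tri} (h : TLinked S t t') : TLinked S t' t := by
  induction h with
  | refl => exact Relation.ReflTransGen.refl
  | tail _ h ih => exact Relation.ReflTransGen.head ⟨h.2.1, h.1, h.2.2.symm⟩ ih

theorem TLinked.trans {S : Set Tri} {t t' t'' : Tri} (h : TLinked S t t') (h' : TLinked S t' t'') :
    TLinked S t t'' := Relation.ReflTransGen.trans h h'

theorem TLinked.mono {S S' : Set Tri} (hS : S ⊆ S') {t t' : Tri} (h : TLinked S t t') :
    TLinked S' t t' :=
  Relation.ReflTransGen.mono (fun _ _ h => ⟨hS h.1, hS h.2.1, h.2.2⟩) _ _ h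

theorem TLinked.single {S : Set Tri} {t t' : Tri} (h : t ∈ S) (h' : t' ∈ S) (ha : TAdj t t') :
    TLinked S t t' := Relation.ReflTransGen.single ⟨h, h', ha⟩

theorem TLinked.fan {S : Set Tri} {x : Vtx} {m n : ℕ} (hmn : m ≤ n)
    (h : ∀ k, m ≤ k → k ≤ n → fan x k ∈ S) : TLinked S (fan x m) (fan x n) := by
  induction n, hmn using Nat.le_induction with
  | base => exact Relation.ReflTransGen.refl
  | succ n hmn ih =>
    exact (ih fun k h1 h2 => h k h1 (by omega)).trans
      (TLinked.single (h n hmn (by omega)) (h (n + 1) (by omega) le_rfl) (tAdj_fan x n))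

/-- The triangles that are not covered by lozenges of `L`. -/
def free (L : Set Loz) : Set Tri := {t | ∀ l ∈ L, ¬ Covers l t}

/-- The free triangles are connected. -/
def FreeConn (L : Set Loz) : Prop := ∀ t ∈ free L, ∀ t' ∈ free L, TLinked (free L) t t'

/-- The triangles at a vertex of `l` that are not covered by `l` are linked. -/
theorem linked_around {l : Loz} {x : Vtx} (hx : x ∈ verts l) {S : Set Tri}
    (hS : ∀ t, x ∈ triVerts t → ¬ Covers l t → t ∈ S) {t t' : Tri} (h : x ∈ triVerts t)
    (h' : x ∈ triVerts t') (hl : ¬ Covers l t) (hl' : ¬ Covers l t') : TLinked S t t' := by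
  obtain ⟨k, len, hlen, hk⟩ := exists_arc hx
  -- Numbered from the start of the arc of `l`, the uncovered triangles are those with `len ≤ n <
  -- 6`, again an arc.
  have idx : ∀ t, x ∈ triVerts t → ¬ Covers l t → ∃ n, len ≤ n ∧ n < 6 ∧ t = fan x (k + n) := by
    intro t ht hl
    obtain ⟨n, hn, rfl⟩ := exists_fan ht
    obtain ⟨m, hm, hmn⟩ : ∃ m < 6, (k + m) % 6 = n := ⟨(n + 6 * k - k) % 6, by omega, by omega⟩
    have e : fan x n = fan x (k + m) := by rw [← fan_mod x (k + m), hmn]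
    rw [e] at hl ⊢
    rw [hk m hm] at hl
    exact ⟨m, by omega, hm, rfl⟩
  have key : ∀ m n, len ≤ m → m ≤ n → n < 6 → TLinked S (fan x (k + m)) (fan x (k + n)) := by
    intro m n h1 h2 h3
    refine TLinked.fan (by omega) fun j hj hj' => hS _ (mem_triVerts_fan x j) ?_
    obtain ⟨i, rfl⟩ : ∃ i, j = k + i := ⟨j - k, by omega⟩
    rw [hk i (by omega)]
    omega
  obtain ⟨m, hm, hm', rfl⟩ := idx t h hl
  obtain ⟨n, hn, hn', rfl⟩ := idx t' h' hl'
  rcases le_total m n with hmn | hmn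
  · exact key m n hm hmn hn'
  · exact (key n m hn hmn hm').symm

/-- Filling in a lozenge does not disconnect the free triangles if all free triangles next to it
are linked by other free triangles. -/
theorem FreeConn.fill {K : Set Loz} (hK : FreeConn K) {D : Loz} (R : Set Tri)
    (h1 : ∀ t t', t ∈ free K → ¬ Covers D t → Covers D t' → TAdj t t' → t ∈ R)
    (h2 : ∀ t ∈ R, ∀ t' ∈ R, TLinked (free (insert D K)) t t') : FreeConn (insert D K) := by
  have mem : ∀ t, t ∈ free K → ¬ Covers D t → t ∈ free (insert D K) := by
    rintro t ht hD l (rfl | hl)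
    exacts [hD, ht l hl]
  intro t ht t' ht'
  have sub : ∀ t, t ∈ free (insert D K) → t ∈ free K := fun t ht l hl =>
    ht l (Set.mem_insert_of_mem _ hl)
  -- Follows a path that was free before the filling. While it is inside `D`, the invariant is that
  -- all of `R` can be reached instead.
  have key : ∀ t', TLinked (free K) t t' → (¬ Covers D t' → TLinked (free (insert D K)) t t') ∧
      (Covers D t' → ∀ r ∈ R, TLinked (free (insert D K)) t r) := by
    intro t' h
    induction h with
    | refl =>
      exact ⟨fun _ => Relation.ReflTransGen.refl, fun h => absurd h (ht D (Set.mem_insert _ _))⟩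
    | @tail s s' _ hs ih =>
      obtain ⟨hs, hs', hadj⟩ := hs
      by_cases hD : Covers D s <;> by_cases hD' : Covers D s'
      · exact ⟨fun h => absurd hD' h, fun _ => ih.2 hD⟩
      · exact ⟨fun _ => ih.2 hD _ (h1 s' s hs' hD' hD hadj.symm), fun h => absurd h hD'⟩
      · exact ⟨fun h => absurd hD' h, fun _ r hr =>
          (ih.1 hD).trans (h2 _ (h1 s s' hs hD hD' hadj) r hr)⟩
      · exact ⟨fun _ => (ih.1 hD).trans (TLinked.single (mem s hs hD) (mem s' hs' hD') hadj),
          fun h => absurd h hD'⟩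
  exact (key t' (hK t (sub t ht) t' (sub t' ht'))).1 (ht' D (Set.mem_insert _ _))

theorem Covers.triEdge {l : Loz} {t : Tri} (h : Covers l t) : TriEdge t l.2 (lo l.2 l) := by
  obtain ⟨⟨x, y⟩, m⟩ := l
  rcases h with rfl | rfl <;> cases m <;> simp [TriEdge, lo, dn]

theorem TriEdge.mem {t : Tri} {i : Dir} {w : Vtx} (h : TriEdge t i w) :
    w ∈ triVerts t ∧ tip i w ∈ triVerts t := by
  obtain ⟨⟨x, y⟩, _ | _⟩ := t <;> cases i <;> simp only [TriEdge] at h <;> subst h <;>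
    simp [triVerts, tip]

/-- The lozenge with a given short diagonal. -/
def diamond : Dir → Vtx → Loz
  | .a, w => (w, .a)
  | .b, w => (w, .b)
  | .c, w => ((w.1 - 1, w.2), .c)

theorem TriEdge.covers {t : Tri} {i : Dir} {w : Vtx} (h : TriEdge t i w) :
    Covers (diamond i w) t := by
  obtain ⟨⟨x, y⟩, _ | _⟩ := t <;> cases i <;> simp only [TriEdge] at h <;> subst h <;>
    simp [diamond, Covers, dn]

/-- The triangle across a side contains both ends of the side, so it joins the triangles round one
end to those round the other. -/
theorem exists_outer {l : Loz} {i : Dir} {w : Vtx} (h : HasSide l i w) :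
    ∃ t, ¬ Covers l t ∧ w ∈ triVerts t ∧ tip i w ∈ triVerts t := by
  have key : ∀ t, ¬ Covers l t → TriEdge t i w → ∃ t, ¬ Covers l t ∧ w ∈ triVerts t ∧
      tip i w ∈ triVerts t := fun t h h' => ⟨t, h, h'.mem⟩
  obtain ⟨⟨x, y⟩, m⟩ := l
  obtain ⟨hi, rfl | rfl⟩ := h
  · cases i
    · refine key ((x, y - 1), false) ?_ (by simp [TriEdge, lo])
      cases m <;> simp [Covers, dn] at hi ⊢
    · refine key ((x - 1, y), false) ?_ (by simp [TriEdge, lo])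
      cases m <;> simp [Covers, dn] at hi ⊢
    · refine key (dn ((x, y), m), true) ?_ (by simp [TriEdge, lo])
      cases m <;> simp [Covers, dn] at hi ⊢
  · cases i
    · refine key (((dn ((x, y), m)).1, (dn ((x, y), m)).2 + 1), true) ?_ (by simp [TriEdge, up])
      cases m <;> simp [Covers, dn] at hi ⊢
    · refine key (((dn ((x, y), m)).1 + 1, (dn ((x, y), m)).2), true) ?_ (by simp [TriEdge, up])
      cases m <;> simp [Covers, dn] at hi ⊢
    · refine key ((x, y), false) ?_ (by simp [TriEdge, up])
      cases m <;> simp [Covers, dn] at hi ⊢ <;> omega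

/-- The uncovered triangles at the ends of a side are linked. -/
theorem linked_along {l : Loz} {i : Dir} {w : Vtx} (h : HasSide l i w) {S : Set Tri}
    (hS : ∀ t, w ∈ triVerts t ∨ tip i w ∈ triVerts t → ¬ Covers l t → t ∈ S) {t t' : Tri}
    (ht : w ∈ triVerts t ∨ tip i w ∈ triVerts t) (ht' : w ∈ triVerts t' ∨ tip i w ∈ triVerts t')
    (hl : ¬ Covers l t) (hl' : ¬ Covers l t') : TLinked S t t' := by
  obtain ⟨o, ho, ho1, ho2⟩ := exists_outer h
  have hw : w ∈ verts l ∧ tip i w ∈ verts l := by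
    obtain ⟨hi, rfl | rfl⟩ := h
    exacts [⟨lo_mem_verts hi, tip_lo_mem_verts hi⟩, ⟨up_mem_verts hi, tip_up_mem_verts hi⟩]
  have key : ∀ t, (w ∈ triVerts t ∨ tip i w ∈ triVerts t) → ¬ Covers l t → TLinked S t o := by
    rintro t (ht | ht) hl
    · exact linked_around hw.1 (fun t h => hS t (Or.inl h)) ht ho1 hl ho
    · exact linked_around hw.2 (fun t h => hS t (Or.inr h)) ht ho2 hl ho
  exact (key t ht hl).trans (key t' ht' hl').symm

theorem exists_side_of_tAdj {D : Loz} {t t' : Tri} (h : TAdj t t') (ht : ¬ Covers D t)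
    (ht' : Covers D t') : ∃ i w, HasSide D i w ∧ TriEdge t i w := by
  obtain ⟨l, h1, h2⟩ := h
  exact ⟨_, _, (ht'.hasSide h2.triEdge).resolve_right fun h => ht (h _ h1.triEdge), h1.triEdge⟩

theorem StepUp.covers {i : Dir} {A B : Loz} (h : StepUp i A B) {t : Tri}
    (ht : TriEdge t i (up i A)) : Covers A t ∨ Covers B t := by
  obtain ⟨⟨x, y⟩, m⟩ := A
  obtain ⟨⟨x', y'⟩, m'⟩ := B
  obtain ⟨⟨v, w⟩, b⟩ := t
  revert h ht
  cases i <;> cases b <;> simp only [StepUp, up, lo, TriEdge, Covers, Prod.ext_iff, and_true,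
    reduceCtorEq, and_false, or_false, false_or] <;> omega

theorem opposite_side {l : Loz} {i : Dir} {x : Vtx} (hi : i ≠ l.2) (hx : x ∈ verts l) :
    (x ≠ lo i l → x ≠ tip i (lo i l) → x = up i l ∨ x = tip i (up i l)) ∧
      (x ≠ up i l → x ≠ tip i (up i l) → x = lo i l ∨ x = tip i (lo i l)) := by
  obtain ⟨⟨v, w⟩, m⟩ := l
  simp only [verts, List.mem_cons, List.not_mem_nil, or_false] at hx
  cases i <;> cases m <;> first
    | exact absurd rfl hi
    | (rcases hx with rfl | rfl | rfl | rfl <;> simp [lo, up, tip, dn, apex])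

/-- Attaching a lozenge with two fresh vertices does not disconnect the free triangles. -/
theorem FreeConn.attach {K : Set Loz} (hK : FreeConn K) {A D : Loz} (hA : A ∈ K) {i : Dir}
    {w : Vtx} (h : (StepUp i A D ∧ w = up i A) ∨ (StepUp i D A ∧ w = lo i A))
    (hf : FreshAt K i w D) : FreeConn (insert D K) := by
  have hside : HasSide D i w := by
    rcases h with ⟨h, rfl⟩ | ⟨h, rfl⟩
    exacts [⟨h.2.1, Or.inl h.2.2⟩, ⟨h.1, Or.inr h.2.2.symm⟩]
  have hmem : ∀ y ∈ verts D, y ≠ w → y ≠ tip i w → ∀ t, y ∈ triVerts t → ¬ Covers D t →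
      t ∈ free (insert D K) := by
    rintro y hy h1 h2 t ht hD B (rfl | hB) hBt
    · exact hD hBt
    · exact hf y hy h1 h2 B hB (hBt.verts ht)
  -- `R` consists of the outer triangles at the two fresh vertices, all of them free. A free
  -- triangle across a side of `D` is among them, because `A` lies behind the only side without
  -- fresh vertices.
  refine hK.fill {t | ¬ Covers D t ∧ ∃ y ∈ verts D, y ≠ w ∧ y ≠ tip i w ∧ y ∈ triVerts t} ?_ ?_
  · intro t t' ht hD hD' hadj
    obtain ⟨j, v, hj, hjt⟩ := exists_side_of_tAdj hadj hD hD'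
    refine ⟨hD, ?_⟩
    have hv : v ∈ verts D ∧ tip j v ∈ verts D := by
      obtain ⟨hi, rfl | rfl⟩ := hj
      exacts [⟨lo_mem_verts hi, tip_lo_mem_verts hi⟩, ⟨up_mem_verts hi, tip_up_mem_verts hi⟩]
    by_contra hno
    push Not at hno
    have h1 : v = w ∨ v = tip i w := by
      by_contra h
      push Not at h
      exact hno v hv.1 h.1 h.2 hjt.mem.1
    have h2 : tip j v = w ∨ tip j v = tip i w := by
      by_contra h
      push Not at h
      exact hno _ hv.2 h.1 h.2 hjt.mem.2
    obtain ⟨rfl, rfl⟩ := edge_unique h1 h2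
    rcases h with ⟨h, rfl⟩ | ⟨h, rfl⟩
    · exact (h.covers hjt).elim (ht A hA) hD
    · rw [← h.2.2] at hjt
      exact (h.covers hjt).elim hD (ht A hA)
  -- The two fresh vertices are the ends of the side opposite to the attaching one.
  · obtain ⟨v, hv, hvw, hv', hopp⟩ : ∃ v, HasSide D i v ∧ (v ≠ w ∧ v ≠ tip i w) ∧
        (tip i v ≠ w ∧ tip i v ≠ tip i w) ∧
        ∀ y ∈ verts D, y ≠ w → y ≠ tip i w → y = v ∨ y = tip i v := by
      obtain ⟨hi, hw⟩ := hside
      have hne := lo_ne_up hi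
      have hinj : ∀ v w, tip i v = tip i w → v = w := by
        rintro ⟨a, b⟩ ⟨c, d⟩ h
        cases i <;> simpa [tip] using h
      have hpar : lo i D ≠ tip i (up i D) ∧ up i D ≠ tip i (lo i D) := by
        obtain ⟨⟨x, y⟩, m⟩ := D
        cases i <;> cases m <;> simp [lo, up, tip, dn] at hi ⊢
      rcases hw with rfl | rfl
      · exact ⟨up i D, ⟨hi, Or.inr rfl⟩, ⟨hne.symm, hpar.2⟩,
          ⟨hpar.1.symm, fun h => hne (hinj _ _ h).symm⟩, fun y hy => (opposite_side hi hy).1⟩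
      · exact ⟨lo i D, ⟨hi, Or.inl rfl⟩, ⟨hne, hpar.1⟩,
          ⟨hpar.2.symm, fun h => hne (hinj _ _ h)⟩, fun y hy => (opposite_side hi hy).2⟩
    have hvm : v ∈ verts D ∧ tip i v ∈ verts D := by
      obtain ⟨hi, rfl | rfl⟩ := hv
      exacts [⟨lo_mem_verts hi, tip_lo_mem_verts hi⟩, ⟨up_mem_verts hi, tip_up_mem_verts hi⟩]
    have hor : ∀ t, (∃ y ∈ verts D, y ≠ w ∧ y ≠ tip i w ∧ y ∈ triVerts t) →
        v ∈ triVerts t ∨ tip i v ∈ triVerts t := by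
      rintro t ⟨y, hy, h1, h2, ht⟩
      rcases hopp y hy h1 h2 with rfl | rfl
      exacts [Or.inl ht, Or.inr ht]
    rintro t ⟨hD, ht⟩ t' ⟨hD', ht'⟩
    refine linked_along hv ?_ (hor t ht) (hor t' ht') hD hD'
    rintro t (ht | ht) hD
    exacts [hmem _ hvm.1 hvw.1 hvw.2 t ht hD, hmem _ hvm.2 hv'.1 hv'.2 t ht hD]

theorem free_empty : free ∅ = Set.univ := by
  ext t
  simp [free]

theorem freeConn_empty : FreeConn ∅ := by
  rw [FreeConn, free_empty]
  have step : ∀ {t t' : Tri} (l : Loz), Covers l t → Covers l t' → TLinked Set.univ t t' :=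
    fun l h h' => TLinked.single (Set.mem_univ _) (Set.mem_univ _) ⟨l, h, h'⟩
  have hx : ∀ x y : ℤ, TLinked Set.univ ((x, y), true) ((x + 1, y), true) := fun x y =>
    (step ((x, y), .c) (Or.inl rfl) (Or.inr rfl)).trans
      (step ((x + 1, y), .b) (t := ((x, y), false)) (Or.inr (by simp [dn])) (Or.inl rfl))
  have hy : ∀ x y : ℤ, TLinked Set.univ ((x, y), true) ((x, y + 1), true) := fun x y =>
    (step ((x, y), .c) (Or.inl rfl) (Or.inr rfl)).trans
      (step ((x, y + 1), .a) (t := ((x, y), false)) (Or.inr (by simp [dn])) (Or.inl rfl))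
  have hx0 : ∀ x y : ℤ, TLinked Set.univ ((0, y), true) ((x, y), true) := by
    intro x y
    induction x using Int.induction_on with
    | zero => exact Relation.ReflTransGen.refl
    | succ n ih => exact ih.trans (hx _ _)
    | pred n ih =>
      refine ih.trans (TLinked.symm ?_)
      simpa using hx (-n - 1) y
  have hy0 : ∀ y : ℤ, TLinked Set.univ ((0, 0), true) ((0, y), true) := by
    intro y
    induction y using Int.induction_on with
    | zero => exact Relation.ReflTransGen.refl
    | succ n ih => exact ih.trans (hy _ _)
    | pred n ih =>
      refine ih.trans (TLinked.symm ?_)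
      simpa using hy 0 (-n - 1)
  have key : ∀ t, TLinked Set.univ ((0, 0), true) t := by
    rintro ⟨⟨x, y⟩, b⟩
    refine ((hy0 y).trans (hx0 x y)).trans ?_
    cases b
    · exact step ((x, y), .c) (Or.inl rfl) (Or.inr rfl)
    · exact Relation.ReflTransGen.refl
  exact fun t _ t' _ => (key t).symm.trans (key t')

/-- Two opposite sides contain all four vertices. A third side has an end on each of them, so its
outer triangle joins the triangles along the two. -/
theorem freeConn_singleton (X : Loz) : FreeConn {X} := by
  have hmem : ∀ t, ¬ Covers X t → t ∈ free {X} := by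
    rintro t ht _ rfl
    exact ht
  rw [← insert_empty_eq X] at hmem ⊢
  refine freeConn_empty.fill {t | ¬ Covers X t ∧ ∃ y ∈ verts X, y ∈ triVerts t} ?_ ?_
  · intro t t' _ hD hD' hadj
    obtain ⟨j, v, hj, hjt⟩ := exists_side_of_tAdj hadj hD hD'
    refine ⟨hD, v, ?_, hjt.mem.1⟩
    obtain ⟨hi, rfl | rfl⟩ := hj
    exacts [lo_mem_verts hi, up_mem_verts hi]
  have side : ∀ {i w}, HasSide X i w → ∀ t t', ¬ Covers X t → ¬ Covers X t' →
      (w ∈ triVerts t ∨ tip i w ∈ triVerts t) → (w ∈ triVerts t' ∨ tip i w ∈ triVerts t') →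
      TLinked (free (insert X ∅)) t t' := fun h t t' h1 h2 h3 h4 =>
    linked_along h (fun t _ => hmem t) h3 h4 h1 h2
  have chain : ∀ {i j k v w s}, HasSide X i v → HasSide X j w → HasSide X k s →
      (w = v ∨ w = tip i v) → (tip j w = s ∨ tip j w = tip k s) →
      ∀ t t', ¬ Covers X t → ¬ Covers X t' →
      ((v ∈ triVerts t ∨ tip i v ∈ triVerts t) ∨ (s ∈ triVerts t ∨ tip k s ∈ triVerts t)) →
      ((v ∈ triVerts t' ∨ tip i v ∈ triVerts t') ∨ (s ∈ triVerts t' ∨ tip k s ∈ triVerts t')) →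
      TLinked (free (insert X ∅)) t t' := by
    intro i j k v w s h1 h2 h3 h4 h5
    obtain ⟨o, ho, ho1, ho2⟩ := exists_outer h2
    have q1 : v ∈ triVerts o ∨ tip i v ∈ triVerts o := by
      rcases h4 with rfl | rfl
      exacts [Or.inl ho1, Or.inr ho1]
    have q2 : s ∈ triVerts o ∨ tip k s ∈ triVerts o := by
      rcases h5 with h5 | h5 <;> rw [h5] at ho2
      exacts [Or.inl ho2, Or.inr ho2]
    have key : ∀ t, ¬ Covers X t →
        ((v ∈ triVerts t ∨ tip i v ∈ triVerts t) ∨ (s ∈ triVerts t ∨ tip k s ∈ triVerts t)) →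
        TLinked (free (insert X ∅)) t o := by
      rintro t ht (h | h)
      exacts [side h1 t o ht ho h q1, side h3 t o ht ho h q2]
    exact fun t t' ht ht' h h' => (key t ht h).trans (key t' ht' h').symm
  rintro t ⟨hX, y, hy, hyt⟩ t' ⟨hX', y', hy', hyt'⟩
  obtain ⟨⟨p, q⟩, m⟩ := X
  have lo' : ∀ i, i ≠ m → HasSide ((p, q), m) i (lo i ((p, q), m)) := fun i hi => ⟨hi, Or.inl rfl⟩
  have up' : ∀ i, i ≠ m → HasSide ((p, q), m) i (up i ((p, q), m)) := fun i hi => ⟨hi, Or.inr rfl⟩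
  have fin : ∀ i j, i ≠ m → j ≠ m →
      (lo j ((p, q), m) = lo i ((p, q), m) ∨ lo j ((p, q), m) = tip i (lo i ((p, q), m))) →
      (tip j (lo j ((p, q), m)) = up i ((p, q), m) ∨
        tip j (lo j ((p, q), m)) = tip i (up i ((p, q), m))) →
      TLinked (free (insert ((p, q), m) ∅)) t t' := by
    intro i j hi hj h1 h2
    have key : ∀ y ∈ verts ((p, q), m), ∀ t, y ∈ triVerts t →
        ((lo i ((p, q), m) ∈ triVerts t ∨ tip i (lo i ((p, q), m)) ∈ triVerts t) ∨
          (up i ((p, q), m) ∈ triVerts t ∨ tip i (up i ((p, q), m)) ∈ triVerts t)) := by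
      intro y hy t ht
      by_cases e1 : y = lo i ((p, q), m)
      · exact Or.inl (Or.inl (e1 ▸ ht))
      by_cases e2 : y = tip i (lo i ((p, q), m))
      · exact Or.inl (Or.inr (e2 ▸ ht))
      rcases (opposite_side hi hy).1 e1 e2 with rfl | rfl
      exacts [Or.inr (Or.inl ht), Or.inr (Or.inr ht)]
    exact chain (lo' i hi) (lo' j hj) (up' i hi) h1 h2 t t' hX hX' (key y hy t hyt)
      (key y' hy' t' hyt')
  cases m
  · exact fin .c .b (by simp) (by simp) (by simp [lo, tip, dn]) (by simp [lo, up, tip])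
  · exact fin .c .a (by simp) (by simp) (by simp [lo, tip, dn]) (by simp [lo, up, tip])
  · exact fin .a .b (by simp) (by simp) (by simp [lo]) (by simp [lo, up, tip, dn])

/-! ### A mod 2 separation argument at a vertex -/

/-- The cochain on vertices that belongs to crossing the diagonal of the lozenge `f`. -/
def potential (f : Loz) (x : Vtx) : Bool :=
  match f.2 with
  | .a => decide (f.1.2 = x.2 ∧ x.1 ≤ f.1.1)
  | _ => false

/-- Whether a horizontal ray from the edge of direction `i` at `w` passes through a triangle. -/
def shade : Dir → Vtx → Tri → Bool
  | .a, _, _ => false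
  | .b, w, t => decide (t.1.2 = w.2 ∧ w.1 ≤ t.1.1)
  | .c, w, (v, true) => decide (v.2 = w.2 ∧ w.1 ≤ v.1)
  | .c, w, (v, false) => decide (v.2 = w.2 ∧ w.1 - 1 ≤ v.1)

theorem potential_iff {f : Loz} {x : Vtx} :
    potential f x = true ↔ f.2 = .a ∧ f.1.2 = x.2 ∧ x.1 ≤ f.1.1 := by
  obtain ⟨u, m⟩ := f
  cases m <;> simp [potential]

theorem shade_iff {i : Dir} {w : Vtx} {t : Tri} : shade i w t = true ↔ i ≠ .a ∧ t.1.2 = w.2 ∧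
    (if i = .c ∧ t.2 = false then w.1 - 1 ≤ t.1.1 else w.1 ≤ t.1.1) := by
  obtain ⟨v, _ | _⟩ := t <;> cases i <;> simp [shade]

/-- Ray casting modulo 2. `potential f x` tells whether a step between the halves of `f` crosses the
horizontal ray to the right of `x`. From one end of an edge to the other this changes if the step
crosses the edge itself, or if an end of the step lies in the strip to the right of the edge, which
`shade` records. -/
theorem potential_coboundary (f : Loz) (i : Dir) (w : Vtx) :
    (potential f w ^^ potential f (tip i w)) =
      (decide (f = diamond i w) ^^ shade i w (f.1, true) ^^ shade i w (dn f, false)) := by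
  obtain ⟨⟨x, y⟩, m⟩ := f
  obtain ⟨v, w⟩ := w
  have hx : ∀ a b : Bool, (a ^^ b) = true ↔ ¬ (a = true ↔ b = true) := by decide
  rw [Bool.eq_iff_iff]
  simp only [hx, potential_iff, shade_iff, decide_eq_true_eq]
  cases m <;> cases i <;>
    simp [tip, diamond, dn] <;>
    omega

/-- A path of triangles has a cochain on vertices whose coboundary counts crossings. -/
theorem exists_potential {S : Set Loz} {t t' : Tri}
    (h : Relation.ReflTransGen (fun t t' => ∃ l ∈ S, Covers l t ∧ Covers l t') t t') :
    ∃ φ : Vtx → Bool, ∀ i w, diamond i w ∉ S →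
      (φ w ^^ φ (tip i w)) = (shade i w t ^^ shade i w t') := by
  induction h with
  | refl => exact ⟨fun _ => false, fun i w _ => by simp⟩
  | @tail s s' _ hs ih =>
    obtain ⟨φ, hφ⟩ := ih
    obtain ⟨l, hl, h1, h2⟩ := hs
    by_cases hss : s = s'
    · exact ⟨φ, hss ▸ hφ⟩
    · refine ⟨fun x => φ x ^^ potential l x, fun i w hw => ?_⟩
      have e1 := hφ i w hw
      have e2 := potential_coboundary l i w
      rw [decide_eq_false (fun h => hw (by rw [← h]; exact hl))] at e2
      have e3 : (shade i w (l.1, true) ^^ shade i w (dn l, false)) =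
          (shade i w s ^^ shade i w s') := by
        rcases h1 with rfl | rfl <;> rcases h2 with rfl | rfl
        · exact absurd rfl hss
        · rfl
        · exact Bool.xor_comm _ _
        · exact absurd rfl hss
      rw [Bool.false_xor, e3] at e2
      have aux : ∀ a b c d s t r : Bool, (a ^^ b) = (s ^^ t) → (c ^^ d) = (t ^^ r) →
          ((a ^^ c) ^^ (b ^^ d)) = (s ^^ r) := by decide
      exact aux _ _ _ _ _ _ _ e1 e2

/-- A closed path of triangles that crosses the diagonal of `f` once separates its ends. -/
theorem exists_separation {S : Set Loz} {f : Loz} {t t' : Tri} (ht : Covers f t)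
    (ht' : Covers f t') (hne : t ≠ t')
    (h : Relation.ReflTransGen (fun t t' => ∃ l ∈ S, Covers l t ∧ Covers l t') t t') :
    ∃ χ : Vtx → Bool, ∀ i w, diamond i w ∉ S →
      (χ w ^^ χ (tip i w)) = decide (f = diamond i w) := by
  obtain ⟨φ, hφ⟩ := exists_potential h
  -- The potential of `f` closes the path, so the shades of its two ends cancel.
  refine ⟨fun x => φ x ^^ potential f x, fun i w hw => ?_⟩
  have e1 := hφ i w hw
  have e2 := potential_coboundary f i w
  have e3 : (shade i w (f.1, true) ^^ shade i w (dn f, false)) =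
      (shade i w t ^^ shade i w t') := by
    rcases ht with rfl | rfl <;> rcases ht' with rfl | rfl
    · exact absurd rfl hne
    · rfl
    · exact Bool.xor_comm _ _
    · exact absurd rfl hne
  rw [Bool.xor_assoc, e3] at e2
  have aux : ∀ a b c d s t r : Bool, (a ^^ b) = (s ^^ t) → (c ^^ d) = (r ^^ (s ^^ t)) →
      ((a ^^ c) ^^ (b ^^ d)) = r := by decide
  exact aux _ _ _ _ _ _ _ e1 e2

/-- Two vertices of a triangle are the ends of an edge of it. -/
theorem exists_edge {t : Tri} {v w : Vtx} (hv : v ∈ triVerts t) (hw : w ∈ triVerts t)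
    (hne : v ≠ w) : ∃ i s, TriEdge t i s ∧ ((s = v ∧ tip i s = w) ∨ (s = w ∧ tip i s = v)) := by
  obtain ⟨⟨x, y⟩, _ | _⟩ := t <;>
    simp only [triVerts, List.mem_cons, List.not_mem_nil, or_false] at hv hw <;>
    rcases hv with rfl | rfl | rfl <;> rcases hw with rfl | rfl | rfl <;>
    first
    | exact absurd rfl hne
    | (refine ⟨.a, _, rfl, ?_⟩; simp [tip]; done)
    | (refine ⟨.b, _, rfl, ?_⟩; simp [tip]; done)
    | (refine ⟨.c, _, rfl, ?_⟩; simp [tip])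

/-- The other end of a spoke. -/
theorem spoke_eq_diamond (x : Vtx) (n : ℕ) : ∃ i s, spoke x n = diamond i s ∧
    TriEdge (fan x n) i s ∧ TriEdge (fan x (n + 1)) i s ∧
    ∃ y, y ≠ x ∧ ((s = x ∧ tip i s = y) ∨ (s = y ∧ tip i s = x)) := by
  have key : ∀ i s y, spoke x n = diamond i s → TriEdge (fan x n) i s →
      TriEdge (fan x (n + 1)) i s → y ≠ x →
      ((s = x ∧ tip i s = y) ∨ (s = y ∧ tip i s = x)) → ∃ i s, spoke x n = diamond i s ∧
    TriEdge (fan x n) i s ∧ TriEdge (fan x (n + 1)) i s ∧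
    ∃ y, y ≠ x ∧ ((s = x ∧ tip i s = y) ∨ (s = y ∧ tip i s = x)) :=
    fun i s y h1 h2 h3 h4 h5 => ⟨i, s, h1, h2, h3, y, h4, h5⟩
  obtain ⟨a, b⟩ := x
  obtain ⟨m, rfl | rfl | rfl | rfl | rfl | rfl⟩ := exists_mod_cases n
  · refine key .b (a, b) (a, b + 1) ?_ ?_ ?_ ?_ ?_ <;>
      simp [spoke, fan, diamond, TriEdge, tip, Nat.add_mod]
  · refine key .c (a, b) (a - 1, b + 1) ?_ ?_ ?_ ?_ ?_ <;>
      simp [spoke, fan, diamond, TriEdge, tip, Nat.add_mod]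
  · refine key .a (a - 1, b) (a - 1, b) ?_ ?_ ?_ ?_ ?_ <;>
      simp [spoke, fan, diamond, TriEdge, tip, Nat.add_mod]
  · refine key .b (a, b - 1) (a, b - 1) ?_ ?_ ?_ ?_ ?_ <;>
      simp [spoke, fan, diamond, TriEdge, tip, Nat.add_mod]
  · refine key .c (a + 1, b - 1) (a + 1, b - 1) ?_ ?_ ?_ ?_ ?_ <;>
      simp [spoke, fan, diamond, TriEdge, tip, Nat.add_mod]
  · refine key .a (a, b) (a + 1, b) ?_ ?_ ?_ ?_ ?_ <;>
      simp [spoke, fan, diamond, TriEdge, tip, Nat.add_mod]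

theorem Packed.eq_of_covers {L : Set Loz} (hL : Packed L) {A B : Loz} (hA : A ∈ L) (hB : B ∈ L)
    {t : Tri} (h : Covers A t) (h' : Covers B t) : A = B := hL A hA B hB (h.overlap h')

/-- Consecutive covered triangles at `x` belong to one lozenge or to two lozenges that share the
edge between them. -/
theorem linked_of_covered {L : Set Loz} (hL : Packed L) {x : Vtx} {m n : ℕ} (hmn : m ≤ n)
    (h : ∀ k, m ≤ k → k ≤ n → ∃ Z ∈ L, Covers Z (fan x k)) {A B : Loz} (hA : A ∈ L) (hB : B ∈ L)
    (hA' : Covers A (fan x m)) (hB' : Covers B (fan x n)) :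
    Linked {Z | Z ∈ L ∧ x ∈ verts Z} A B := by
  induction n, hmn using Nat.le_induction generalizing B with
  | base =>
    rw [hL.eq_of_covers hA hB hA' hB']
    exact Relation.ReflTransGen.refl
  | succ n hmn ih =>
    obtain ⟨Z, hZ, hZ'⟩ := h n hmn (by omega)
    have h1 := ih (fun k h1 h2 => h k h1 (by omega)) hZ hZ'
    by_cases hZB : Z = B
    · exact hZB ▸ h1
    refine h1.trans (Linked.single ⟨hZ, hZ'.verts (mem_triVerts_fan x n)⟩
      ⟨hB, hB'.verts (mem_triVerts_fan x (n + 1))⟩ ?_)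
    obtain ⟨i, s, -, e1, e2, -⟩ := spoke_eq_diamond x n
    have hno : ¬ (Z.1 = B.1 ∨ dn Z = dn B) := fun h => hZB (hL Z hZ B hB h)
    have s1 := (hZ'.hasSide e1).resolve_right fun h => hno ((h _ e2).overlap hB')
    have s2 := (hB'.hasSide e2).resolve_right fun h => hno (hZ'.overlap (h _ e1))
    exact ⟨i, (stepUp_of_hasSide s1 s2 hno).imp (fun h => h.1) fun h => h.1⟩

theorem tip_ne (i : Dir) (w : Vtx) : tip i w ≠ w := by
  obtain ⟨a, b⟩ := w
  cases i <;> simp [tip]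

theorem diamond_injective {i j : Dir} {v w : Vtx} (h : diamond i v = diamond j w) :
    i = j ∧ v = w := by
  obtain ⟨a, b⟩ := v
  obtain ⟨c, d⟩ := w
  cases i <;> cases j <;> simp_all [diamond]

/-- A colouring of the vertices that is constant along the edges of `L` off `x` is constant on the
vertices of `L` other than `x`. -/
theorem colour_constant {L : Set Loz} (hc : Conn L) {x : Vtx} {χ : Vtx → Bool}
    (h : ∀ Z ∈ L, ∀ t, Covers Z t → ∀ i s, TriEdge t i s → s ≠ x → tip i s ≠ x →
      χ s = χ (tip i s)) {A B : Loz} (hA : A ∈ L) (hB : B ∈ L) {v w : Vtx} (hv : v ∈ verts A)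
    (hw : w ∈ verts B) (hvx : v ≠ x) (hwx : w ≠ x) : χ v = χ w := by
  have tri : ∀ Z ∈ L, ∀ t, Covers Z t → ∀ v ∈ triVerts t, ∀ w ∈ triVerts t, v ≠ x → w ≠ x →
      χ v = χ w := by
    intro Z hZ t ht v hv w hw hvx hwx
    by_cases hvw : v = w
    · rw [hvw]
    obtain ⟨i, s, hs, ⟨rfl, rfl⟩ | ⟨rfl, rfl⟩⟩ := exists_edge hv hw hvw
    · exact h Z hZ t ht i s hs hvx hwx
    · exact (h Z hZ t ht i s hs hwx hvx).symm
  have loz : ∀ Z ∈ L, ∀ v ∈ verts Z, ∀ w ∈ verts Z, v ≠ x → w ≠ x → χ v = χ w := by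
    intro Z hZ v hv w hw hvx hwx
    obtain ⟨t, ht, hvt⟩ := exists_covers hv
    obtain ⟨t', ht', hwt⟩ := exists_covers hw
    have e := ht.triEdge.mem
    have e' := ht'.triEdge.mem
    -- The halves share the short diagonal, and one of its ends is not `x`. The same holds below for
    -- the common side of two adjacent lozenges, so leaving out `x` breaks no link.
    obtain ⟨d, hd, hd', hdx⟩ : ∃ d, d ∈ triVerts t ∧ d ∈ triVerts t' ∧ d ≠ x := by
      by_cases hx : lo Z.2 Z = x
      · exact ⟨_, e.2, e'.2, fun h => tip_ne _ _ (h.trans hx.symm)⟩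
      · exact ⟨_, e.1, e'.1, hx⟩
    exact (tri Z hZ t ht v hvt d hd hvx hdx).trans (tri Z hZ t' ht' d hd' w hwt hdx hwx)
  have adj : ∀ {A B i}, A ∈ L → B ∈ L → StepUp i A B → ∃ d, d ∈ verts A ∧ d ∈ verts B ∧ d ≠ x := by
    intro A B i hA hB h
    have m1 := up_mem_verts h.1
    have m2 := tip_up_mem_verts h.1
    have m3 := lo_mem_verts h.2.1
    have m4 := tip_lo_mem_verts h.2.1
    rw [← h.2.2] at m3 m4
    by_cases hx : up i A = x
    · exact ⟨_, m2, m4, fun h => tip_ne _ _ (h.trans hx.symm)⟩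
    · exact ⟨_, m1, m3, hx⟩
  have key : ∀ B, Linked L A B → ∀ w ∈ verts B, w ≠ x → χ v = χ w := by
    intro B hAB
    induction hAB with
    | refl => exact fun w hw hwx => loz A hA v hv w hw hvx hwx
    | tail _ hs ih =>
      obtain ⟨hY, hZ, i, hs⟩ := hs
      obtain ⟨d, hd, hd', hdx⟩ := hs.elim (adj hY hZ) fun h =>
        (adj hZ hY h).imp fun _ h => ⟨h.2.1, h.1, h.2.2⟩
      exact fun w hw hwx => (ih d hd hdx).trans (loz _ hZ d hd' w hw hdx hwx)
  exact key B (hc A hA B hB) w hw hwx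

theorem covers_cases {l : Loz} {s t t' : Tri} (ht : Covers l t) (ht' : Covers l t') (hne : t ≠ t')
    (hs : Covers l s) : s = t ∨ s = t' := by
  rcases ht with rfl | rfl <;> rcases ht' with rfl | rfl <;> rcases hs with rfl | rfl <;> simp_all

theorem fan_ne_succ (x : Vtx) (n : ℕ) : fan x n ≠ fan x (n + 1) := by
  obtain ⟨m, rfl | rfl | rfl | rfl | rfl | rfl⟩ := exists_mod_cases n <;>
    simp [fan, Nat.add_mod]

/-- If there are no holes, then the lozenges at a vertex are linked at that vertex. -/
theorem linked_at {L : Set Loz} (hL : Packed L) (hc : Conn L) (hf : FreeConn L) {x : Vtx}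
    {D B : Loz} (hD : D ∈ L) (hB : B ∈ L) (hxD : x ∈ verts D) (hxB : x ∈ verts B) :
    Linked {Z | Z ∈ L ∧ x ∈ verts Z} D B := by
  obtain ⟨t, hDt, hxt⟩ := exists_covers hxD
  obtain ⟨i, hi, rfl⟩ := exists_fan hxt
  obtain ⟨t', hBt, hxt'⟩ := exists_covers hxB
  obtain ⟨j, hj, rfl⟩ := exists_fan hxt'
  obtain ⟨n, hn, hnj⟩ : ∃ n < 6, (i + n) % 6 = j := ⟨(j + 6 - i) % 6, by omega, by omega⟩
  have hBn : Covers B (fan x (i + n)) := by rwa [← fan_mod, hnj]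
  have hD6 : Covers D (fan x (i + 6)) := by rwa [fan_add_six]
  -- If `D` and `B` are not linked at `x`, then both ways round `x` from `D` to `B` pass a free
  -- triangle, at the indices `a` and `b`.
  by_contra hno
  have h1 : ∃ a, a ≤ n ∧ fan x (i + a) ∈ free L := by
    by_contra h
    push Not at h
    refine hno (linked_of_covered hL (Nat.le_add_right i n) (fun k h1 h2 => ?_) hD hB hDt hBn)
    have := h (k - i) (by omega)
    rw [Nat.add_sub_cancel' h1] at this
    simpa [free] using this
  have h2 : ∃ b, n ≤ b ∧ b ≤ 6 ∧ fan x (i + b) ∈ free L := by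
    by_contra h
    push Not at h
    refine hno (linked_of_covered hL (by omega : i + n ≤ i + 6) (fun k h1 h2 => ?_) hB hD hBn
      hD6).symm
    have := h (k - i) (by omega) (by omega)
    rw [Nat.add_sub_cancel' (by omega : i ≤ k)] at this
    simpa [free] using this
  classical
  -- The last free triangle before `B` is taken, so that the next triangle is covered by some `Z`.
  obtain ⟨a, han, ha, hmax⟩ : ∃ a, a ≤ n ∧ fan x (i + a) ∈ free L ∧
      ∀ k, a < k → k ≤ n → fan x (i + k) ∉ free L := by
    obtain ⟨a, h, h'⟩ := h1
    exact ⟨Nat.findGreatest (fun a => fan x (i + a) ∈ free L) n, Nat.findGreatest_le n,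
      Nat.findGreatest_spec (P := fun a => fan x (i + a) ∈ free L) h h',
      fun k h1 h2 => Nat.findGreatest_is_greatest h1 h2⟩
  obtain ⟨b, hnb, hb6, hb⟩ := h2
  have ha0 : a ≠ 0 := by
    rintro rfl
    exact ha D hD hDt
  have han' : a ≠ n := by
    rintro rfl
    exact ha B hB hBn
  have hnb' : n ≠ b := by
    rintro rfl
    exact hb B hB hBn
  have hb6' : b ≠ 6 := by
    rintro rfl
    exact hb D hD hD6
  obtain ⟨Z, hZ, hZc⟩ : ∃ Z ∈ L, Covers Z (fan x (i + a + 1)) := by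
    simpa [free, add_assoc] using hmax (a + 1) (by omega) (by omega)
  set S : Set Loz := {l | ∀ t, Covers l t → t ∈ free L} ∪
    {l | ∃ k, a < k ∧ k < b ∧ l = spoke x (i + k)} with hS
  -- A path from the triangle `a` through free triangles to `b`, then back round `x` to `a + 1`.
  -- Crossing the edge between `a` and `a + 1` closes it. Away from `x` this closed path crosses no
  -- edge of a lozenge of `L`.
  have hpath : Relation.ReflTransGen (fun t t' => ∃ l ∈ S, Covers l t ∧ Covers l t')
      (fan x (i + a)) (fan x (i + a + 1)) := by
    have p1 : ∀ t, TLinked (free L) (fan x (i + a)) t →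
        Relation.ReflTransGen (fun t t' => ∃ l ∈ S, Covers l t ∧ Covers l t')
          (fan x (i + a)) t := by
      intro t ht
      induction ht with
      | refl => exact Relation.ReflTransGen.refl
      | @tail s s' _ hs ih =>
        obtain ⟨h1, h2, l, h3, h4⟩ := hs
        by_cases hss : s = s'
        · exact hss ▸ ih
        · refine ih.tail ⟨l, Or.inl fun r hr => ?_, h3, h4⟩
          rcases covers_cases h3 h4 hss hr with rfl | rfl
          exacts [h1, h2]
    have p2 : ∀ k, a + 1 ≤ k → k ≤ b →
        Relation.ReflTransGen (fun t t' => ∃ l ∈ S, Covers l t ∧ Covers l t')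
          (fan x (i + k)) (fan x (i + a + 1)) := by
      intro k hk
      induction k, hk using Nat.le_induction with
      | base => exact fun _ => Relation.ReflTransGen.refl
      | succ k hk ih =>
        intro hkb
        exact Relation.ReflTransGen.head ⟨spoke x (i + k), Or.inr ⟨k, by omega, by omega, rfl⟩,
          spoke_covers_succ x (i + k), spoke_covers x (i + k)⟩ (ih (by omega))
    exact (p1 _ (hf _ ha _ hb)).trans (p2 b (by omega) le_rfl)
  obtain ⟨χ, hχ⟩ := exists_separation (spoke_covers x (i + a)) (spoke_covers_succ x (i + a))
    (fan_ne_succ x (i + a)) hpath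
  have hspoke : ∀ k j s, diamond j s = spoke x k → s = x ∨ tip j s = x := by
    intro k j s h
    obtain ⟨j', s', h', -, -, y, -, hy⟩ := spoke_eq_diamond x k
    obtain ⟨rfl, rfl⟩ := diamond_injective (h.trans h')
    exact hy.imp (fun h => h.1) fun h => h.2
  have hconst : ∀ Y ∈ L, ∀ t, Covers Y t → ∀ j s, TriEdge t j s → s ≠ x → tip j s ≠ x →
      χ s = χ (tip j s) := by
    intro Y hY t ht j s hs h1 h2
    have := hχ j s (by
      rintro (h | ⟨k, -, -, h⟩)
      · exact h t hs.covers Y hY ht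
      · exact (hspoke _ _ _ h).elim h1 h2)
    rw [decide_eq_false fun h => (hspoke _ _ _ h.symm).elim h1 h2] at this
    simpa using this
  have hends : ∀ k Y, Y ∈ L → Covers Y (fan x k) ∨ Covers Y (fan x (k + 1)) →
      (∀ k', a < k' → k' < b → k % 6 ≠ (i + k') % 6) →
      ∃ y, y ≠ x ∧ y ∈ verts Y ∧ (χ x ^^ χ y) = decide (spoke x (i + a) = spoke x k) := by
    intro k Y hY hYk hk
    obtain ⟨j, s, h, e1, e2, y, hyx, hy⟩ := spoke_eq_diamond x k
    have := hχ j s (by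
      rintro (h' | ⟨k', h1, h2, h'⟩)
      · rcases hYk with hYk | hYk
        · exact h' _ e1.covers Y hY hYk
        · exact h' _ e2.covers Y hY hYk
      · exact hk k' h1 h2 (spoke_injective (h.trans h')))
    rw [← h] at this
    have hmem : s ∈ verts Y ∧ tip j s ∈ verts Y := by
      rcases hYk with hYk | hYk
      exacts [⟨hYk.verts e1.mem.1, hYk.verts e1.mem.2⟩, ⟨hYk.verts e2.mem.1, hYk.verts e2.mem.2⟩]
    rcases hy with ⟨rfl, rfl⟩ | ⟨rfl, rfl⟩
    · exact ⟨_, hyx, hmem.2, this⟩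
    · exact ⟨_, hyx, hmem.1, by rw [Bool.xor_comm, this]⟩
  -- The edge of `Z` at `x` is crossed and that of `D` is not, since `0 < a < 6`. Yet their other
  -- ends have the same colour, because `L` is connected.
  obtain ⟨y, hyx, hyZ, hy⟩ := hends (i + a) Z hZ (Or.inr hZc) (fun k' h1 h2 => by omega)
  obtain ⟨y', hyx', hyD, hy'⟩ := hends i D hD (Or.inl hDt) (fun k' h1 h2 => by omega)
  have e := colour_constant hc hconst hZ hD hyZ hyD hyx hyx'
  rw [decide_eq_true rfl, e] at hy
  rw [hy, eq_comm, decide_eq_true_iff] at hy'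
  have := spoke_injective hy'
  omega

/-! ### Topology of the uncovered region -/

open Topology in
-- A bound by an integer that fails at `z` fails nearby. One neighbourhood serves for all integers,
-- because the floor and the ceiling of `f z` give the critical bounds.
theorem eventually_int_le {f : ℂ → ℝ} (hf : Continuous f) (z : ℂ) :
    ∀ᶠ z' in 𝓝 z, ∀ m : ℤ, ((m : ℝ) ≤ f z' → (m : ℝ) ≤ f z) ∧ (f z' ≤ m → f z ≤ m) := by
  have h1 : ∀ᶠ z' in 𝓝 z, f z' < ⌊f z⌋ + 1 :=
    hf.continuousAt.eventually_lt continuousAt_const (Int.lt_floor_add_one _)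
  have h2 : ∀ᶠ z' in 𝓝 z, (⌈f z⌉ : ℝ) - 1 < f z' :=
    continuousAt_const.eventually_lt hf.continuousAt (by linarith [Int.ceil_lt_add_one (f z)])
  filter_upwards [h1, h2] with z' h1 h2 m
  constructor
  · intro h
    refine Int.le_floor.1 ?_
    have : (m : ℝ) < (⌊f z⌋ : ℤ) + 1 := by linarith
    exact Int.lt_add_one_iff.1 (by exact_mod_cast this)
  · intro h
    refine Int.ceil_le.1 ?_
    have : ((⌈f z⌉ : ℤ) : ℝ) < m + 1 := by linarith
    exact Int.lt_add_one_iff.1 (by exact_mod_cast this)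

open Topology in
/-- The triangles that contain a point near `z` contain `z`. -/
theorem eventually_inTri (p u z : ℂ) : ∀ᶠ z' in 𝓝 z, ∀ t, InTri t (cx p u z') (cy p u z') →
    InTri t (cx p u z) (cy p u z) := by
  have hx := continuous_cx p u
  have hy := continuous_cy p u
  filter_upwards [eventually_int_le hx z, eventually_int_le hy z,
    eventually_int_le (hx.add hy) z] with z' h1 h2 h3
  rintro ⟨v, _ | _⟩ ⟨e1, e2, e3⟩
  · refine ⟨?_, ?_, ?_⟩
    · exact_mod_cast (h1 (v.1 + 1)).2 (by exact_mod_cast e1)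
    · exact_mod_cast (h2 (v.2 + 1)).2 (by exact_mod_cast e2)
    · exact_mod_cast (h3 (v.1 + v.2 + 1)).1 (by exact_mod_cast e3)
  · refine ⟨(h1 v.1).1 e1, (h2 v.2).1 e2, ?_⟩
    exact_mod_cast (h3 (v.1 + v.2 + 1)).2 (by exact_mod_cast e3)

theorem exists_inTri (x y : ℝ) : ∃ t, InTri t x y := by
  have hx := Int.floor_le x
  have hx' := Int.lt_floor_add_one x
  have hy := Int.floor_le y
  have hy' := Int.lt_floor_add_one y
  rcases le_total (x + y) (⌊x⌋ + ⌊y⌋ + 1) with h | h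
  · exact ⟨((⌊x⌋, ⌊y⌋), true), hx, hy, h⟩
  · exact ⟨((⌊x⌋, ⌊y⌋), false), hx'.le, hy'.le, h⟩

/-- The triangles that contain a given point are linked. -/
theorem linked_at_point {x y : ℝ} {t t' : Tri} (h : InTri t x y) (h' : InTri t' x y) :
    TLinked {s | InTri s x y} t t' := by
  by_cases hne : t = t'
  · rw [hne]
    exact Relation.ReflTransGen.refl
  rcases inTri_inter hne h h' with ⟨v, rfl, rfl⟩ | ⟨i, w, h1, h2, -⟩
  · have hfan : ∀ n, InTri (fan v n) v.1 v.2 := fun n => inTri_int.2 (mem_triVerts_fan v n)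
    have key : ∀ t, InTri t v.1 v.2 → TLinked {s | InTri s v.1 v.2} (fan v 0) t := by
      intro t ht
      obtain ⟨n, -, rfl⟩ := exists_fan (inTri_int.1 ht)
      exact TLinked.fan (Nat.zero_le n) fun k _ _ => hfan k
    exact (key t h).symm.trans (key t' h')
  · exact TLinked.single h h' ⟨_, h1.covers, h2.covers⟩

/-- The region that is not covered by the tiles of `L`. -/
def outside (p u : ℂ) (L : Set Loz) : Set ℂ := (⋃₀ (tile p u '' L))ᶜ

theorem mem_outside {p u : ℂ} (hu : u ≠ 0) {L : Set Loz} {z : ℂ} :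
    z ∈ outside p u L ↔ ∀ t, InTri t (cx p u z) (cy p u z) → t ∈ free L := by
  simp only [outside, Set.sUnion_image, Set.mem_compl_iff, Set.mem_iUnion, not_exists,
    mem_tile_iff hu, free, Set.mem_ofPred_eq]
  constructor
  · exact fun h t ht l hl hc => h l hl t ⟨hc, ht⟩
  · rintro h l hl t ⟨hc, ht⟩
    exact h t ht l hl hc

/-- The uncovered points whose triangles are linked to `t₀` and those whose triangles are not form
two disjoint open sets. They exhaust the region because the triangles at one point are linked
(`linked_at_point`). The centres of triangles carry the conclusion back to triangles. -/
theorem freeConn_of_isConnected {p u : ℂ} (hu : u ≠ 0) {L : Set Loz}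
    (h : IsConnected (outside p u L)) : FreeConn L := by
  intro t₀ ht₀ t₁ ht₁
  set S : Set Tri := {t | TLinked (free L) t₀ t}
  have hopen : ∀ S' : Set Tri, IsOpen {z | z ∈ outside p u L ∧
      ∀ t, InTri t (cx p u z) (cy p u z) → t ∈ S'} := by
    intro S'
    rw [isOpen_iff_mem_nhds]
    rintro z ⟨hz, hz'⟩
    filter_upwards [eventually_inTri p u z] with z' h
    exact ⟨(mem_outside hu).2 fun t ht => (mem_outside hu).1 hz t (h t ht),
      fun t ht => hz' t (h t ht)⟩
  have hcentre : ∀ t, t ∈ free L → ∃ z ∈ outside p u L, InTri t (cx p u z) (cy p u z) ∧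
      ∀ t', InTri t' (cx p u z) (cy p u z) → t' = t := by
    intro t ht
    refine ⟨pos p u (t.1.1 + (if t.2 then 1 / 3 else 2 / 3))
      (t.1.2 + (if t.2 then 1 / 3 else 2 / 3)), (mem_outside hu).2 ?_, ?_, ?_⟩ <;>
      rw [cx_pos hu, cy_pos hu]
    · intro t' ht'
      rwa [eq_of_centre rfl rfl ht']
    · exact inTri_centre t
    · exact fun t' => eq_of_centre rfl rfl
  obtain ⟨z₀, hz₀, h₀, h₀'⟩ := hcentre t₀ ht₀
  obtain ⟨z₁, hz₁, h₁, -⟩ := hcentre t₁ ht₁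
  have hsub := h.isPreconnected.subset_left_of_subset_union (hopen S) (hopen Sᶜ) ?_ ?_
    ⟨z₀, hz₀, hz₀, fun t ht => by rw [h₀' t ht]; exact Relation.ReflTransGen.refl⟩
  · exact (hsub hz₁).2 _ h₁
  · refine Set.disjoint_left.2 fun z hz hz' => ?_
    obtain ⟨t, ht⟩ := exists_inTri (cx p u z) (cy p u z)
    exact hz'.2 t ht (hz.2 t ht)
  · intro z hz
    by_cases hS : ∃ t, InTri t (cx p u z) (cy p u z) ∧ t ∈ S
    · obtain ⟨t, ht, htS⟩ := hS
      exact Or.inl ⟨hz, fun t' ht' => TLinked.trans htS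
        ((linked_at_point ht ht').mono fun s hs => (mem_outside hu).1 hz s hs)⟩
    · exact Or.inr ⟨hz, fun t ht htS => hS ⟨t, ht, htS⟩⟩

/-- Coordinates of points in the interior of a triangle. -/
def InInterior : Tri → ℝ → ℝ → Prop
  | (v, true), x, y => (v.1 : ℝ) < x ∧ (v.2 : ℝ) < y ∧ x + y < v.1 + v.2 + 1
  | (v, false), x, y => x < (v.1 : ℝ) + 1 ∧ y < (v.2 : ℝ) + 1 ∧ (v.1 : ℝ) + v.2 + 1 < x + y

theorem InInterior.eq {t t' : Tri} {x y : ℝ} (h : InInterior t x y) (h' : InTri t' x y) :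
    t' = t := by
  obtain ⟨⟨v, w⟩, b⟩ := t
  obtain ⟨⟨v', w'⟩, b'⟩ := t'
  have aux : ∀ {m n : ℤ}, (m : ℝ) < n + 1 → m ≤ n := fun {m n} h => by
    have : m < n + 1 := by exact_mod_cast h
    omega
  cases b <;> cases b' <;> simp only [InTri, InInterior] at h h' <;>
    obtain ⟨h4, h5, h6⟩ := h <;> obtain ⟨h1, h2, h3⟩ := h'
  · have a1 : v ≤ v' := aux (by linarith)
    have a2 : w ≤ w' := aux (by linarith)
    have a3 : v' + w' ≤ v + w := aux (by push_cast; linarith)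
    rw [show v' = v by omega, show w' = w by omega]
  · have a1 : v' ≤ v := aux (by linarith)
    have a2 : w' ≤ w := aux (by linarith)
    have a3 : v + w + 1 ≤ v' + w' := aux (by push_cast; linarith)
    omega
  · have a1 : v ≤ v' := aux (by linarith)
    have a2 : w ≤ w' := aux (by linarith)
    have a3 : v' + w' + 1 ≤ v + w := aux (by push_cast; linarith)
    omega
  · have a1 : v' ≤ v := aux (by linarith)
    have a2 : w' ≤ w := aux (by linarith)
    have a3 : v + w ≤ v' + w' := aux (by push_cast; linarith)
    rw [show v' = v by omega, show w' = w by omega]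

theorem inInterior_towards {t : Tri} {x y s : ℝ} (h : InTri t x y) (h0 : 0 ≤ s) (h1 : s < 1) :
    InInterior t ((1 - s) * (t.1.1 + (if t.2 then 1 / 3 else 2 / 3)) + s * x)
      ((1 - s) * (t.1.2 + (if t.2 then 1 / 3 else 2 / 3)) + s * y) := by
  obtain ⟨⟨v, w⟩, b⟩ := t
  cases b <;> simp only [InTri, InInterior, if_true, if_false, Bool.false_eq_true] at h ⊢ <;>
    obtain ⟨e1, e2, e3⟩ := h <;> refine ⟨?_, ?_, ?_⟩ <;>
    nlinarith [mul_le_mul_of_nonneg_left e1 h0, mul_le_mul_of_nonneg_left e2 h0,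
      mul_le_mul_of_nonneg_left e3 h0]

/-- Coordinates of the midpoint of an edge. -/
noncomputable def mid : Dir → Vtx → ℝ × ℝ
  | .a, w => (w.1 + 1 / 2, w.2)
  | .b, w => (w.1, w.2 + 1 / 2)
  | .c, w => (w.1 - 1 / 2, w.2 + 1 / 2)

theorem inTri_mid {i : Dir} {w : Vtx} {t : Tri} :
    InTri t (mid i w).1 (mid i w).2 ↔ TriEdge t i w := by
  constructor
  · have aux : ∀ {m n : ℤ}, (m : ℝ) < n + 1 → m ≤ n := fun {m n} h => by
      have : m < n + 1 := by exact_mod_cast h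
      omega
    obtain ⟨⟨v, v'⟩, b⟩ := t
    obtain ⟨w, w'⟩ := w
    cases i <;> cases b <;> simp only [InTri, mid, TriEdge, Prod.mk.injEq] <;> rintro ⟨h1, h2, h3⟩
    · have a1 : w ≤ v := aux (by linarith)
      have a2 : w' ≤ v' + 1 := aux (by push_cast; linarith)
      have a3 : v + v' + 1 ≤ w + w' := aux (by push_cast; linarith)
      omega
    · have a1 : v ≤ w := aux (by linarith)
      have a2 : v' ≤ w' := aux (by linarith)
      have a3 : w + w' ≤ v + v' := aux (by push_cast; linarith)
      omega
    · have a1 : w ≤ v + 1 := aux (by push_cast; linarith)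
      have a2 : w' ≤ v' := aux (by linarith)
      have a3 : v + v' + 1 ≤ w + w' := aux (by push_cast; linarith)
      omega
    · have a1 : v ≤ w := aux (by linarith)
      have a2 : v' ≤ w' := aux (by linarith)
      have a3 : w + w' ≤ v + v' := aux (by push_cast; linarith)
      omega
    · have a1 : w ≤ v + 1 := aux (by push_cast; linarith)
      have a2 : w' ≤ v' := aux (by linarith)
      have a3 : v + v' + 1 ≤ w + w' := aux (by push_cast; linarith)
      omega
    · have a1 : v + 1 ≤ w := aux (by push_cast; linarith)
      have a2 : v' ≤ w' := aux (by linarith)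
      have a3 : w + w' ≤ v + v' + 1 := aux (by push_cast; linarith)
      omega
  · refine fun h => InSeg.inTri ?_ h
    cases i <;> refine ⟨?_, ?_, ?_⟩ <;> simp only [mid] <;> linarith

/-- The uncovered part of a free triangle is star-shaped about the centre, and two free triangles
with a common edge both contain its midpoint, which is uncovered. -/
theorem isConnected_of_freeConn {p u : ℂ} (hu : u ≠ 0) {L : Set Loz} (hL : L.Finite)
    (h : FreeConn L) : IsConnected (outside p u L) := by
  set P : free L → Set ℂ := fun t =>
    {z | InTri t.1 (cx p u z) (cy p u z)} ∩ outside p u L with hP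
  have hstar : ∀ t : free L, ∀ z ∈ P t, ∀ s : ℝ, 0 ≤ s → s ≤ 1 →
      pos p u ((1 - s) * (t.1.1.1 + (if t.1.2 then 1 / 3 else 2 / 3)) + s * cx p u z)
        ((1 - s) * (t.1.1.2 + (if t.1.2 then 1 / 3 else 2 / 3)) + s * cy p u z) ∈ P t := by
    rintro ⟨t, ht⟩ z ⟨hz, hz'⟩ s h0 h1
    rcases h1.lt_or_eq with h1 | rfl
    · have hi := inInterior_towards hz h0 h1
      refine ⟨?_, (mem_outside hu).2 ?_⟩
      · obtain ⟨t', ht'⟩ := exists_inTri _ _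
        have := hi.eq ht'
        subst this
        simpa only [Set.mem_ofPred_eq, cx_pos hu, cy_pos hu] using ht'
      · rw [cx_pos hu, cy_pos hu]
        intro t' ht'
        rwa [hi.eq ht']
    · simp only [sub_self, zero_mul, one_mul, zero_add, pos_coord hu]
      exact ⟨hz, hz'⟩
  have hpre : ∀ t, IsPreconnected (P t) := by
    intro t
    refine isPreconnected_of_forall (pos p u (t.1.1.1 + (if t.1.2 then 1 / 3 else 2 / 3))
      (t.1.1.2 + (if t.1.2 then 1 / 3 else 2 / 3))) fun z hz => ?_
    refine ⟨(fun s : ℝ =>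
      pos p u ((1 - s) * (t.1.1.1 + (if t.1.2 then 1 / 3 else 2 / 3)) + s * cx p u z)
        ((1 - s) * (t.1.1.2 + (if t.1.2 then 1 / 3 else 2 / 3)) + s * cy p u z)) '' Set.Icc 0 1,
      ?_, ⟨0, by simp, by simp⟩, ⟨1, by simp, by simp [pos_coord hu]⟩,
      isPreconnected_Icc.image _ (Continuous.continuousOn ?_)⟩
    · rintro _ ⟨s, hs, rfl⟩
      exact hstar t z hz s hs.1 hs.2
    · unfold pos
      fun_prop
  have hunion : outside p u L = ⋃ t, P t := by
    ext z
    simp only [Set.mem_iUnion, hP]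
    constructor
    · intro hz
      obtain ⟨t, ht⟩ := exists_inTri (cx p u z) (cy p u z)
      exact ⟨⟨t, (mem_outside hu).1 hz t ht⟩, ht, hz⟩
    · rintro ⟨t, -, hz⟩
      exact hz
  have hstep : ∀ t t' : free L, TAdj t.1 t'.1 → t.1 ≠ t'.1 → (P t ∩ P t').Nonempty := by
    rintro ⟨t, ht⟩ ⟨t', ht'⟩ ⟨l, h1, h2⟩ hne
    have e1 := inTri_mid.2 h1.triEdge
    have e2 := inTri_mid.2 h2.triEdge
    have hout : pos p u (mid l.2 (lo l.2 l)).1 (mid l.2 (lo l.2 l)).2 ∈ outside p u L := by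
      rw [mem_outside hu, cx_pos hu, cy_pos hu]
      intro s hs
      have hs := (inTri_mid.1 hs).covers
      rcases covers_cases h1.triEdge.covers h2.triEdge.covers hne hs with rfl | rfl
      exacts [ht, ht']
    refine ⟨_, ⟨?_, hout⟩, ?_, hout⟩
    · simpa only [Set.mem_ofPred_eq, cx_pos hu, cy_pos hu] using e1
    · simpa only [Set.mem_ofPred_eq, cx_pos hu, cy_pos hu] using e2
  refine ⟨?_, ?_⟩
  -- By finiteness some first coordinate `n` belongs to no upward triangle of `L`, so the triangle
  -- at `(n, 0)` is free.
  · obtain ⟨n, hn⟩ := (hL.image fun l => l.1.1).exists_notMem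
    refine ⟨pos p u (n + 1 / 3) (1 / 3), (mem_outside hu).2 ?_⟩
    rw [cx_pos hu, cy_pos hu]
    intro t ht
    have := eq_of_centre (t := ((n, 0), true)) (by simp) (by simp) ht
    subst this
    rintro l hl (h | h)
    · exact hn ⟨l, hl, (congrArg (fun t : Tri => t.1.1) h).symm⟩
    · simp at h
  · rw [hunion]
    refine IsPreconnected.iUnion_of_reflTransGen hpre ?_
    rintro ⟨t, ht⟩ ⟨t', ht'⟩
    have key : ∀ t', TLinked (free L) t t' → ∀ ht' : t' ∈ free L,
        Relation.ReflTransGen (fun i j => (P i ∩ P j).Nonempty) ⟨t, ht⟩ ⟨t', ht'⟩ := by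
      intro t' h
      induction h with
      | refl => exact fun _ => Relation.ReflTransGen.refl
      | @tail s s' _ hs ih =>
        intro ht'
        by_cases hss : s = s'
        · subst hss
          exact ih ht'
        · exact (ih hs.1).tail (hstep ⟨s, hs.1⟩ ⟨s', ht'⟩ hs.2.2 hss)
    exact key t' (h t ht t' ht') ht'

/-! ### The tree structure of verdant tilings and its consequences -/

/-- Neighbours in `L` are not linked by other chains. -/
def Bridged (L : Set Loz) : Prop := ∀ A ∈ L, ∀ D ∈ L, LAdj A D →
  ¬ Relation.ReflTransGen (fun X Y => X ∈ L ∧ Y ∈ L ∧ LAdj X Y ∧ s(X, Y) ≠ s(A, D)) A D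

/-- The pairs of neighbours in `L`. -/
def joins (L : Set Loz) : Set (Sym2 Loz) :=
  {e | ∃ i, ∃ A ∈ L, ∃ B ∈ L, StepUp i A B ∧ e = s(A, B)}

theorem mids_finite {L : Set Loz} (hL : L.Finite) : (mids L).Finite :=
  ((Set.Finite.of_surjOn (s := ({.a, .b, .c} : Set Dir)) (t := Set.univ) id
    (fun i _ => ⟨i, by cases i <;> simp, rfl⟩) (by simp)).prod hL).subset
    fun _ hq => ⟨Set.mem_univ _, hq.1⟩

/-- Each run of three accounts for two pairs of neighbours. -/
theorem ncard_joins_le {L : Set Loz} (hf : L.Finite) (hL : Packed L) (hr : RunsOfThree L) :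
    (joins L).Finite ∧ (joins L).ncard ≤ 2 * (mids L).ncard := by
  classical
  -- Sends a middle and a choice of side to the pair formed with its neighbour there; the default
  -- `s(A, A)` does not occur for middles.
  let f : (Dir × Loz) × Bool → Sym2 Loz
    | ((i, A), true) => if h : ∃ X ∈ L, StepUp i A X then s(A, h.choose) else s(A, A)
    | ((i, A), false) => if h : ∃ X ∈ L, StepUp i X A then s(A, h.choose) else s(A, A)
  have hup : ∀ i, ∀ A ∈ L, ∀ B ∈ L, StepUp i A B → f ((i, A), true) = s(A, B) := by
    intro i A hA B hB h
    have hex : ∃ X ∈ L, StepUp i A X := ⟨B, hB, h⟩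
    change (if h : ∃ X ∈ L, StepUp i A X then s(A, h.choose) else s(A, A)) = _
    rw [dif_pos hex]
    rw [hL.up_unique hex.choose_spec.1 hB hex.choose_spec.2 h]
  have hdown : ∀ i, ∀ A ∈ L, ∀ B ∈ L, StepUp i A B → f ((i, B), false) = s(A, B) := by
    intro i A hA B hB h
    have hex : ∃ X ∈ L, StepUp i X B := ⟨A, hA, h⟩
    change (if h : ∃ X ∈ L, StepUp i X B then s(B, h.choose) else s(B, B)) = _
    rw [dif_pos hex]
    rw [hL.down_unique hex.choose_spec.1 hA hex.choose_spec.2 h, Sym2.eq_swap]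
  have hsub : joins L ⊆ f '' (mids L ×ˢ Set.univ) := by
    rintro _ ⟨i, A, hA, B, hB, h, rfl⟩
    rcases hr i A hA B hB h with ⟨hC, -⟩ | ⟨hC, -⟩
    · exact ⟨((i, B), false), ⟨⟨hB, ⟨A, hA, h⟩, hC⟩, Set.mem_univ _⟩, hdown i A hA B hB h⟩
    · exact ⟨((i, A), true), ⟨⟨hA, hC, B, hB, h⟩, Set.mem_univ _⟩, hup i A hA B hB h⟩
  have hfin : (mids L ×ˢ (Set.univ : Set Bool)).Finite := (mids_finite hf).prod Set.finite_univ
  refine ⟨(hfin.image f).subset hsub, ?_⟩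
  calc (joins L).ncard ≤ (f '' (mids L ×ˢ Set.univ)).ncard :=
        Set.ncard_le_ncard hsub (hfin.image f)
    _ ≤ (mids L ×ˢ (Set.univ : Set Bool)).ncard := Set.ncard_image_le hfin
    _ = 2 * (mids L).ncard := by
      rw [Set.ncard_prod, Set.ncard_univ, Nat.card_eq_fintype_card, Fintype.card_bool, mul_comm]

/-- The graph on `L` whose edges are the pairs of neighbours. -/
def latticeGraph (L : Set Loz) : SimpleGraph L where
  Adj A B := LAdj A.1 B.1
  symm := ⟨fun _ _ h => h.symm⟩
  loopless := ⟨fun _ h => h.ne rfl⟩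

/-- If there are one more lozenges than at most there are pairs of neighbours, then the adjacency
graph is a tree. -/
theorem bridged_of_card {L : Set Loz} (hf : L.Finite) (hL : Packed L) (hc : Conn L)
    (hr : RunsOfThree L) (hcard : L.ncard = 2 * (mids L).ncard + 1) : Bridged L := by
  have hfin : Finite L := hf
  have hne : L.Nonempty := by
    rw [Set.nonempty_iff_ne_empty]
    rintro rfl
    simp at hcard
  have hconn : (latticeGraph L).Connected := by
    rw [SimpleGraph.connected_iff]
    refine ⟨?_, hne.to_subtype⟩
    rintro ⟨A, hA⟩ ⟨B, hB⟩
    have key : ∀ B, Linked L A B → ∀ hB : B ∈ L,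
        (latticeGraph L).Reachable ⟨A, hA⟩ ⟨B, hB⟩ := by
      intro B hAB
      induction hAB with
      | refl => exact fun _ => SimpleGraph.Reachable.refl _
      | tail _ h ih =>
        intro hB
        refine (ih h.1).trans (SimpleGraph.Adj.reachable ?_)
        exact h.2.2
    exact key B (hc A hA B hB) hB
  have hedges : Nat.card (latticeGraph L).edgeSet ≤ (joins L).ncard := by
    rw [Nat.card_coe_set_eq, ← Set.ncard_image_of_injective _
      (Sym2.map.injective Subtype.val_injective)]
    refine Set.ncard_le_ncard ?_ (ncard_joins_le hf hL hr).1
    rintro _ ⟨e, he, rfl⟩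
    induction e with
    | h A B =>
      obtain ⟨i, h | h⟩ := he
      · exact ⟨i, A, A.2, B, B.2, h, rfl⟩
      · exact ⟨i, B, B.2, A, A.2, h, Sym2.eq_swap⟩
  -- There are at most `2 * (mids L).ncard = L.ncard - 1` edges, and a connected graph has at least
  -- that many.
  have htree : (latticeGraph L).IsTree := by
    rw [SimpleGraph.isTree_iff_connected_and_card]
    refine ⟨hconn, ?_⟩
    have h1 := hconn.card_vert_le_card_edgeSet_add_one
    have h2 := (ncard_joins_le hf hL hr).2
    rw [Nat.card_coe_set_eq L] at h1 ⊢
    omega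
  intro A hA D hD hAD hpath
  have hb := SimpleGraph.isAcyclic_iff_forall_adj_isBridge.1 htree.isAcyclic
    (show (latticeGraph L).Adj ⟨A, hA⟩ ⟨D, hD⟩ from hAD)
  rw [SimpleGraph.isBridge_iff] at hb
  apply hb
  have key : ∀ B, Relation.ReflTransGen
      (fun X Y => X ∈ L ∧ Y ∈ L ∧ LAdj X Y ∧ s(X, Y) ≠ s(A, D)) A B → ∀ hB : B ∈ L,
      ((latticeGraph L).deleteEdges {s(⟨A, hA⟩, ⟨D, hD⟩)}).Reachable ⟨A, hA⟩ ⟨B, hB⟩ := by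
    intro B hAB
    induction hAB with
    | refl => exact fun _ => SimpleGraph.Reachable.refl _
    | tail _ h ih =>
      intro hB
      refine (ih h.1).trans (SimpleGraph.Adj.reachable ?_)
      rw [SimpleGraph.deleteEdges_adj]
      refine ⟨h.2.2.1, fun h' => h.2.2.2 ?_⟩
      simpa using congrArg (Sym2.map Subtype.val) (Set.mem_singleton_iff.1 h')
  exact key D hpath hD

theorem StepUp.common {i : Dir} {A B : Loz} (h : StepUp i A B) {y : Vtx} (hA : y ∈ verts A)
    (hB : y ∈ verts B) : y = up i A ∨ y = tip i (up i A) := by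
  have h1 := (pt_mem_tile (p := 0) one_ne_zero).2 hA
  have h2 := (pt_mem_tile (p := 0) one_ne_zero).2 hB
  rw [← pt_mem_seg (p := 0) one_ne_zero, ← tile_inter_of_stepUp one_ne_zero h]
  exact ⟨h1, h2⟩

/-- A lozenge next to a connected part of `L` is attached to it along one side only. -/
theorem fresh_of_bridged {L : Set Loz} (hL : Packed L) (hc : Conn L) (hf : FreeConn L)
    (hb : Bridged L) {K : Set Loz} (hK : K ⊆ L) (hKc : Conn K) {A D : Loz} (hA : A ∈ K)
    (hD : D ∈ L) (hDK : D ∉ K) (hAD : LAdj A D) {y : Vtx} (hy : y ∈ verts D) (hyA : y ∉ verts A) :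
    ∀ B ∈ K, y ∉ verts B := by
  intro B hB hyB
  -- A second way from `A` to `D`: inside `K` from `A` to `B`, which avoids `D`, then through
  -- lozenges at `y` from `B` to `D`, which avoids `A`.
  refine hb A (hK hA) D hD hAD ?_
  have h1 := linked_at hL hc hf (hK hB) hD hyB hy
  refine (Relation.ReflTransGen.mono ?_ _ _ (hKc A hA B hB)).trans
    (Relation.ReflTransGen.mono ?_ _ _ h1)
  · rintro X Y ⟨hX, hY, h⟩
    refine ⟨hK hX, hK hY, h, fun h' => ?_⟩
    rcases Sym2.eq_iff.1 h' with ⟨-, rfl⟩ | ⟨rfl, -⟩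
    exacts [hDK hY, hDK hX]
  · rintro X Y ⟨hX, hY, h⟩
    refine ⟨hX.1, hY.1, h, fun h' => ?_⟩
    rcases Sym2.eq_iff.1 h' with ⟨rfl, -⟩ | ⟨-, rfl⟩
    exacts [hyA hX.2, hyA hY.2]

/-- A chain need not pass through an element with only one neighbour. -/
theorem avoid_leaf {α : Type*} {r : α → α → Prop} {S : Set α} {B N : α}
    (hN : ∀ X ∈ S, (r X B ∨ r B X) → X = N) {X Y : α}
    (h : Relation.ReflTransGen (fun X Y => X ∈ S ∧ Y ∈ S ∧ r X Y) X Y) (hX : X ≠ B) (hY : Y ≠ B) :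
    Relation.ReflTransGen (fun X Y => X ∈ S \ {B} ∧ Y ∈ S \ {B} ∧ r X Y) X Y := by
  have key : ∀ Y, Relation.ReflTransGen (fun X Y => X ∈ S ∧ Y ∈ S ∧ r X Y) X Y →
      (Y ≠ B → Relation.ReflTransGen (fun X Y => X ∈ S \ {B} ∧ Y ∈ S \ {B} ∧ r X Y) X Y) ∧
      (Y = B → Relation.ReflTransGen (fun X Y => X ∈ S \ {B} ∧ Y ∈ S \ {B} ∧ r X Y) X N) := by
    intro Y h
    induction h with
    | refl => exact ⟨fun _ => Relation.ReflTransGen.refl, fun h => absurd h hX⟩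
    | @tail Y Z _ hs ih =>
      obtain ⟨h1, h2, h3⟩ := hs
      by_cases hYB : Y = B
      · subst hYB
        obtain rfl := hN Z h2 (Or.inr h3)
        exact ⟨fun _ => ih.2 rfl, fun _ => ih.2 rfl⟩
      · refine ⟨fun hZ => (ih.1 hYB).tail ⟨⟨h1, hYB⟩, ⟨h2, hZ⟩, h3⟩, ?_⟩
        rintro rfl
        obtain rfl := hN Y h1 (Or.inl h3)
        exact ih.1 hYB
  exact (key Y h).1 hY

/-- A middle `B` without cross neighbours has just the neighbours `A` and `C`. When `B` is removed,
`A` and `C` are still linked by contacts, and each contact at a vertex can be replaced by a chain of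
adjacent lozenges at that vertex avoiding `B`. Together with `B` this gives a cycle, against
`Bridged`. -/
theorem braced_of_bridged {L : Set Loz} (hL : Packed L) (hc : Conn L) (hf : FreeConn L)
    (hb : Bridged L) (hrem : ∀ X ∈ L, ∀ A ∈ L \ {X}, ∀ B ∈ L \ {X}, Relation.ReflTransGen
      (fun Y Z => Y ∈ L \ {X} ∧ Z ∈ L \ {X} ∧ Y ≠ Z ∧ Touches Y Z) A B) : Braced L := by
  intro i B hB hmid
  obtain ⟨⟨A, hA, hAB⟩, C, hC, hBC⟩ := hmid
  by_contra hno
  push Not at hno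
  have hi := hAB.2.1
  have hadj : ∀ X ∈ L, LAdj X B → X = A ∨ X = C := by
    rintro X hX ⟨j, hj⟩
    rcases eq_or_eq_oth hi (hj.symm.ne_left) with rfl | rfl
    · rcases hj with hj | hj
      exacts [Or.inl (hL.down_unique hX hA hj hAB), Or.inr (hL.up_unique hX hC hj hBC)]
    · exact absurd hj.symm (hno X hX)
  have hsep : ∀ x, x ∈ verts B → x ∈ verts A → x ∈ verts C → False := by
    intro x h1 h2 h3
    have e1 := hAB.common h2 h1
    have e2 := hBC.common h1 h3
    rw [hAB.2.2] at e1
    have hne := lo_ne_up hi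
    obtain ⟨⟨p, q⟩, m⟩ := B
    cases i <;> cases m <;> rcases e1 with rfl | rfl <;>
      simp [lo, up, tip, dn] at e2 hi
  have hstep : ∀ Y Z, Y ∈ L \ {B} → Z ∈ L \ {B} → Touches Y Z → Linked (L \ {B}) Y Z := by
    rintro Y Z hY hZ ⟨x, hxY, hxZ⟩
    have h := linked_at hL hc hf hY.1 hZ.1 hxY hxZ
    -- If `x` is a vertex of `B`, it belongs to at most one of `A` and `C`, so `B` is a leaf among
    -- the lozenges at `x` and can be bypassed.
    obtain ⟨N, hN⟩ : ∃ N, ∀ X ∈ {Z | Z ∈ L ∧ x ∈ verts Z}, (LAdj X B ∨ LAdj B X) →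
        x ∈ verts B → X = N := by
      by_cases hxA : x ∈ verts A
      · refine ⟨A, fun X hX h hxB => (hadj X hX.1 (h.elim id LAdj.symm)).resolve_right ?_⟩
        rintro rfl
        exact hsep x hxB hxA hX.2
      · refine ⟨C, fun X hX h _ => (hadj X hX.1 (h.elim id LAdj.symm)).resolve_left ?_⟩
        rintro rfl
        exact hxA hX.2
    by_cases hxB : x ∈ verts B
    · have h' : Linked ({Z | Z ∈ L ∧ x ∈ verts Z} \ {B}) Y Z :=
        avoid_leaf (fun X hX h => hN X hX h hxB) h hY.2 hZ.2
      have hsub : {Z | Z ∈ L ∧ x ∈ verts Z} \ {B} ⊆ L \ {B} := fun W hW => ⟨hW.1.1, hW.2⟩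
      exact h'.mono hsub
    · have hsub : {Z | Z ∈ L ∧ x ∈ verts Z} ⊆ L \ {B} := by
        rintro W ⟨hW, hxW⟩
        refine ⟨hW, ?_⟩
        rintro rfl
        exact hxB hxW
      exact h.mono hsub
  have hAC : Linked (L \ {B}) A C := by
    have key : ∀ Z, Relation.ReflTransGen (fun Y Z => Y ∈ L \ {B} ∧ Z ∈ L \ {B} ∧ Y ≠ Z ∧
        Touches Y Z) A Z → Linked (L \ {B}) A Z := by
      intro Z h
      induction h with
      | refl => exact Relation.ReflTransGen.refl
      | tail _ hs ih => exact ih.trans (hstep _ _ hs.1 hs.2.1 hs.2.2.2)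
    exact key C (hrem B hB A ⟨hA, hAB.ne⟩ C ⟨hC, hBC.ne.symm⟩)
  refine hb A hA B hB ⟨i, Or.inl hAB⟩ ?_
  refine Relation.ReflTransGen.tail (b := C) (Relation.ReflTransGen.mono ?_ _ _ hAC) ?_
  · rintro X Y ⟨hX, hY, h⟩
    refine ⟨hX.1, hY.1, h, fun h' => ?_⟩
    rcases Sym2.eq_iff.1 h' with ⟨-, rfl⟩ | ⟨rfl, -⟩
    exacts [hY.2 rfl, hX.2 rfl]
  · refine ⟨hC, hB, ⟨i, Or.inr hBC⟩, fun h' => ?_⟩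
    rcases Sym2.eq_iff.1 h' with ⟨rfl, -⟩ | ⟨rfl, -⟩
    exacts [hAB.trans_ne hBC rfl, hBC.ne rfl]

theorem good_of_bridged {L : Set Loz} (hfin : L.Finite) (hL : Packed L) (hc : Conn L)
    (hr : RunsOfThree L) (hf : FreeConn L) (hb : Bridged L)
    (hrem : ∀ X ∈ L, ∀ A ∈ L \ {X}, ∀ B ∈ L \ {X}, Relation.ReflTransGen
      (fun Y Z => Y ∈ L \ {X} ∧ Z ∈ L \ {X} ∧ Y ≠ Z ∧ Touches Y Z) A B) : Good L where
  finite := hfin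
  packed := hL
  conn := hc
  runs := hr
  braced := braced_of_bridged hL hc hf hb hrem
  fresh_up K hK hKc A hA D hD hDK i h x hx h1 h2 :=
    fresh_of_bridged hL hc hf hb hK hKc hA hD hDK ⟨i, Or.inl h⟩ hx
      fun hxA => (h.common hxA hx).elim h1 h2
  fresh_down K hK hKc A hA D hD hDK i h x hx h1 h2 :=
    fresh_of_bridged hL hc hf hb hK hKc hA hD hDK ⟨i, Or.inr h⟩ hx
      fun hxA => by
        rw [← h.2.2] at h1 h2
        exact (h.common hx hxA).elim h1 h2

/-- The lozenges of a verdant tiling form a good set. -/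
theorem IsTredoku.good {T : Set (Set ℂ)} (hT : IsTredoku T)
    (hcard : T.ncard = 2 * (runs T).ncard + 1) {p u : ℂ} (hu : ‖u‖ = 1) {l₀ : Loz}
    (h₀ : tile p u l₀ ∈ T) : Good {l | tile p u l ∈ T} := by
  have hu0 := ne_zero_of_norm hu
  have hinj := tile_injective (p := p) hu0
  have hT' := hT.eq_image hu h₀
  set L := {l | tile p u l ∈ T} with hLdef
  have hpacked : Packed L := packed_of_touch hu (by rw [← hT']; exact hT.touch)
  have hfin : L.Finite := hT.finite.preimage hinj.injOn
  have hconn : Conn L := ((connected_adjacency_iff hu hpacked).1 (hT' ▸ hT.connected)).2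
  have hruns : RunsOfThree L := runsOfThree_of_runs hu hpacked
    (by rw [← hT']; exact hT.run_extends) (by rw [← hT']; exact hT.run_le)
  have hfree : FreeConn L := freeConn_of_isConnected hu0 (p := p)
    (by rw [outside, ← hT']; exact hT.no_holes)
  have hc : L.ncard = 2 * (mids L).ncard + 1 := by
    rw [← ncard_runs hu hpacked (p := p), ← hT', ← hcard, hT', Set.ncard_image_of_injective _ hinj]
  refine good_of_bridged hfin hpacked hconn hruns hfree
    (bridged_of_card hfin hpacked hconn hruns hc) fun X hX => ?_
  have := hT.connected_remove (tile p u X) hX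
  rw [hT'] at this
  exact ((connected_remove_iff hu0).1 this).2

/-! ### Certifying tilings given by lists -/

theorem exists_third_vertex (t : Tri) (a b : Vtx) : ∃ v ∈ triVerts t, v ≠ a ∧ v ≠ b := by
  obtain ⟨⟨x, y⟩, c⟩ := t
  by_contra h
  push Not at h
  have hd : ∀ v w s : Vtx, v ≠ w → v ≠ s → w ≠ s → v ∈ triVerts ((x, y), c) →
      w ∈ triVerts ((x, y), c) → s ∈ triVerts ((x, y), c) → False := by
    intro v w s h1 h2 h3 hv hw hs
    by_cases e1 : v = a
    · have e2 := h w hw fun h => h1 (e1.trans h.symm)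
      have e3 := h s hs fun h => h2 (e1.trans h.symm)
      exact h3 (e2.trans e3.symm)
    · have e2 := h v hv e1
      by_cases e3 : w = a
      · exact h2 (e2.trans (h s hs fun h => h3 (e3.trans h.symm)).symm)
      · exact h1 (e2.trans (h w hw e3).symm)
  cases c
  · exact hd (x + 1, y) (x, y + 1) (x + 1, y + 1) (by simp) (by simp) (by simp)
      (by simp [triVerts]) (by simp [triVerts]) (by simp [triVerts])
  · exact hd (x, y) (x + 1, y) (x, y + 1) (by simp) (by simp) (by simp)
      (by simp [triVerts]) (by simp [triVerts]) (by simp [triVerts])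

theorem attachable_iff {K : List Loz} {D : Loz} : attachable K D = true ↔ ∃ i, ∃ A ∈ K,
    (StepUp i A D ∧ FreshAt {B | B ∈ K} i (up i A) D) ∨
      (StepUp i D A ∧ FreshAt {B | B ∈ K} i (lo i A) D) := by
  simp only [attachable, List.any_eq_true, Bool.or_eq_true, Bool.and_eq_true, stepUp_iff,
    freshAt_iff]
  constructor
  · rintro ⟨i, -, h⟩
    exact ⟨i, h⟩
  · rintro ⟨i, h⟩
    exact ⟨i, by cases i <;> simp, h⟩

/-- Shellings yield connected sets of lozenges that do not overlap and have no holes. -/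
theorem isShelling_sound {K : List Loz} (hne : K ≠ []) (h : isShelling K = true) :
    K.Nodup ∧ Packed {A | A ∈ K} ∧ Conn {A | A ∈ K} ∧ FreeConn {A | A ∈ K} := by
  induction K with
  | nil => exact absurd rfl hne
  | cons D K ih =>
    cases K with
    | nil =>
      rw [setOf_mem_cons]
      refine ⟨List.nodup_singleton D, ?_, ?_, ?_⟩
      · rintro A (rfl | hA) B (rfl | hB) -
        exacts [rfl, absurd hB (by simp), absurd hA (by simp), absurd hA (by simp)]
      · simpa using Conn.singleton D
      · simpa using freeConn_singleton D
    | cons C K =>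
      rw [isShelling, Bool.and_eq_true, attachable_iff] at h
      · obtain ⟨h, i, A, hA, hAD⟩ := h
        obtain ⟨h1, h2, h3, h4⟩ := ih (by simp) h
        have hAD' : ∃ w, ((StepUp i A D ∧ w = up i A) ∨ (StepUp i D A ∧ w = lo i A)) ∧
            FreshAt {B | B ∈ C :: K} i w D := by
          rcases hAD with ⟨h, h'⟩ | ⟨h, h'⟩
          exacts [⟨_, Or.inl ⟨h, rfl⟩, h'⟩, ⟨_, Or.inr ⟨h, rfl⟩, h'⟩]
        obtain ⟨w, hw, hfresh⟩ := hAD'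
        -- A triangle common to `D` and `B` would have a vertex off the attaching edge, which is
        -- fresh and yet a vertex of `B`.
        have hno : ∀ B ∈ C :: K, ∀ t, Covers B t → ¬ Covers D t := by
          intro B hB t hBt hDt
          obtain ⟨v, hv, h1, h2⟩ := exists_third_vertex t w (tip i w)
          exact hfresh v (hDt.verts hv) h1 h2 B hB (hBt.verts hv)
        have hover : ∀ B ∈ C :: K, ¬ (D.1 = B.1 ∨ dn D = dn B) := by
          rintro B hB (h | h)
          · exact hno B hB _ (Or.inl rfl) (Or.inl (by rw [h]))
          · exact hno B hB _ (Or.inr rfl) (Or.inr (by rw [h]))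
        rw [setOf_mem_cons]
        refine ⟨List.nodup_cons.2 ⟨fun hD => hover D hD (Or.inl rfl), h1⟩, ?_,
          h3.insert hA ⟨i, hw.imp (fun h => h.1) fun h => h.1⟩, h4.attach hA hw hfresh⟩
        rintro X (rfl | hX) Y (rfl | hY) hXY
        · rfl
        · exact absurd hXY (hover Y hY)
        · exact absurd (hXY.imp Eq.symm Eq.symm) (hover X hX)
        · exact h2 X hX Y hY hXY
      · simp

theorem hasUp_iff {K : List Loz} {i : Dir} {A : Loz} :
    hasUp K i A = true ↔ ∃ B ∈ {B | B ∈ K}, StepUp i A B := by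
  simp [hasUp, stepUp_iff]

theorem hasDown_iff {K : List Loz} {i : Dir} {A : Loz} :
    hasDown K i A = true ↔ ∃ B ∈ {B | B ∈ K}, StepUp i B A := by
  simp [hasDown, stepUp_iff]

theorem isMid_iff {K : List Loz} {i : Dir} {A : Loz} :
    isMid K i A = true ↔ IsMid {B | B ∈ K} i A := by
  rw [isMid, Bool.and_eq_true, hasUp_iff, hasDown_iff, IsMid, and_comm]

theorem mem_dirs (i : Dir) : i ∈ dirs := by
  cases i <;> simp [dirs]

theorem runsOfThree_sound {K : List Loz} (h : runsOfThree K = true) : RunsOfThree {A | A ∈ K} := by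
  intro i A hA B hB hAB
  simp only [runsOfThree, List.all_eq_true] at h
  have := h i (mem_dirs i) A hA B hB
  rw [stepUp_iff.2 hAB, Bool.not_true, Bool.false_or] at this
  rw [← hasUp_iff, ← hasDown_iff]
  revert this
  cases hasUp K i B <;> cases hasDown K i A <;> simp

theorem braced_sound {K : List Loz} (h : braced K = true) : Braced {A | A ∈ K} := by
  intro i B hB hmid
  simp only [braced, List.all_eq_true] at h
  have := h i (mem_dirs i) B hB
  rw [isMid_iff.2 hmid, Bool.not_true, Bool.false_or, hasIn, Bool.or_eq_true, hasUp_iff,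
    hasDown_iff] at this
  rcases this with ⟨D, hD, h⟩ | ⟨D, hD, h⟩
  exacts [⟨D, hD, Or.inl h⟩, ⟨D, hD, Or.inr h⟩]

theorem ncard_mids {K : List Loz} (hK : K.Nodup) : (mids {A | A ∈ K}).ncard = midCount K := by
  classical
  have hnd : (dirs.product K).Nodup := List.Nodup.product (by simp [dirs]) hK
  rw [midCount, ← List.toFinset_card_of_nodup (hnd.filter _), ← Set.ncard_coe_finset]
  congr 1
  ext ⟨i, B⟩
  simp only [mids, Set.mem_ofPred_eq, List.coe_toFinset, List.mem_filter, isMid_iff]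
  refine and_congr_left fun _ => ?_
  rw [show ((i, B) ∈ dirs.product K) ↔ i ∈ dirs ∧ B ∈ K from List.mem_product]
  exact (and_iff_right (mem_dirs i)).symm

/-- Two sides of `X` in different directions have an end in common. -/
theorem touches_of_sides {X N N' : Loz} {i j : Dir} (hij : i ≠ j) (h : AdjIn i X N)
    (h' : AdjIn j X N') : Touches N N' := by
  have side : ∀ {i N}, AdjIn i X N → ∃ w, (w = lo i X ∨ w = up i X) ∧ w ∈ verts N ∧
      tip i w ∈ verts N := by
    rintro i N (h | h)
    · exact ⟨up i X, Or.inr rfl, h.2.2 ▸ lo_mem_verts h.2.1, h.2.2 ▸ tip_lo_mem_verts h.2.1⟩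
    · exact ⟨lo i X, Or.inl rfl, h.2.2 ▸ up_mem_verts h.1, h.2.2 ▸ tip_up_mem_verts h.1⟩
  have hi := h.ne_left
  have hj := h'.ne_left
  obtain ⟨w, hw, hw1, hw2⟩ := side h
  obtain ⟨v, hv, hv1, hv2⟩ := side h'
  have key : w = v ∨ w = tip j v ∨ tip i w = v ∨ tip i w = tip j v := by
    obtain ⟨⟨x, y⟩, m⟩ := X
    cases i <;> cases j <;> cases m <;> first
      | exact absurd rfl hij
      | exact absurd rfl hi
      | exact absurd rfl hj
      | (rcases hw with rfl | rfl <;> rcases hv with rfl | rfl <;> simp [lo, up, tip, dn])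
  rcases key with h | h | h | h
  exacts [⟨w, hw1, h ▸ hv1⟩, ⟨w, hw1, h ▸ hv2⟩, ⟨_, hw2, h ▸ hv1⟩, ⟨_, hw2, h ▸ hv2⟩]

/-- Removing a lozenge from a braced set leaves it connected through vertices. -/
theorem Braced.connected_remove {L : Set Loz} (hb : Braced L) (hL : Packed L) (hc : Conn L)
    {X : Loz} (hX : X ∈ L) : ∀ A ∈ L \ {X}, ∀ B ∈ L \ {X}, Relation.ReflTransGen
      (fun Y Z => Y ∈ L \ {X} ∧ Z ∈ L \ {X} ∧ Y ≠ Z ∧ Touches Y Z) A B := by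
  set R : Loz → Loz → Prop := fun Y Z => Y ∈ L \ {X} ∧ Z ∈ L \ {X} ∧ Y ≠ Z ∧ Touches Y Z
  have hsymm : ∀ {Y Z}, Relation.ReflTransGen R Y Z → Relation.ReflTransGen R Z Y := by
    intro Y Z h
    induction h with
    | refl => exact Relation.ReflTransGen.refl
    | tail _ h ih =>
      exact Relation.ReflTransGen.head ⟨h.2.1, h.1, h.2.2.1.symm,
        h.2.2.2.imp fun _ h => h.symm⟩ ih
  have htouch : ∀ {Y Z}, Y ∈ L \ {X} → Z ∈ L \ {X} → Touches Y Z → Relation.ReflTransGen R Y Z := by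
    intro Y Z hY hZ h
    by_cases hYZ : Y = Z
    · rw [hYZ]
    · exact Relation.ReflTransGen.single ⟨hY, hZ, hYZ, h⟩
  have hadj : ∀ {Y Z}, LAdj Y Z → Touches Y Z := by
    rintro Y Z ⟨i, h | h⟩
    · exact ⟨up i Y, up_mem_verts h.1, h.2.2 ▸ lo_mem_verts h.2.1⟩
    · exact ⟨lo i Y, lo_mem_verts h.2.1, h.2.2 ▸ up_mem_verts h.1⟩
  have hreach : ∀ A ∈ L \ {X}, ∃ N ∈ L \ {X}, LAdj X N ∧ Relation.ReflTransGen R A N := by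
    intro A hA
    have key : ∀ Y, Linked L A Y → (Y ≠ X ∧ Relation.ReflTransGen R A Y) ∨
        ∃ N ∈ L \ {X}, LAdj X N ∧ Relation.ReflTransGen R A N := by
      intro Y h
      induction h with
      | refl => exact Or.inl ⟨hA.2, Relation.ReflTransGen.refl⟩
      | @tail Y Z _ hs ih =>
        rcases ih with ⟨hY, ih⟩ | ih
        · by_cases hZ : Z = X
          · subst hZ
            exact Or.inr ⟨Y, ⟨hs.1, hY⟩, hs.2.2.symm, ih⟩
          · exact Or.inl ⟨hZ, ih.trans (htouch ⟨hs.1, hY⟩ ⟨hs.2.1, hZ⟩ (hadj hs.2.2))⟩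
        · exact Or.inr ih
    exact (key X (hc A hA.1 X hX)).resolve_left fun h => h.1 rfl
  have hnbr : ∀ N ∈ L \ {X}, ∀ N' ∈ L \ {X}, LAdj X N → LAdj X N' →
      Relation.ReflTransGen R N N' := by
    rintro N hN N' hN' ⟨i, hi⟩ ⟨j, hj⟩
    by_cases hij : i = j
    · subst hij
      by_cases hNN : N = N'
      · rw [hNN]
      -- Neighbours across opposite sides of `X` need not touch, but the brace `D` touches both.
      obtain ⟨D, hD, hXD⟩ := hb i X hX (isMid_of_adjIn hL hN.1 hN'.1 hNN hi hj)
      have hD' : D ∈ L \ {X} := ⟨hD, hXD.ne.symm⟩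
      have hne := oth_ne_left hi.ne_left
      exact (htouch hN hD' (touches_of_sides hne.symm hi hXD)).trans
        (htouch hD' hN' (touches_of_sides hne hXD hj))
    · exact htouch hN hN' (touches_of_sides hij hi hj)
  intro A hA B hB
  obtain ⟨N, hN, hXN, hAN⟩ := hreach A hA
  obtain ⟨N', hN', hXN', hBN⟩ := hreach B hB
  exact (hAN.trans (hnbr N hN N' hN' hXN hXN')).trans (hsymm hBN)

/-- A set of lozenges with the following properties forms a tredoku tiling. -/
theorem isTredoku_of_lozenges {p u : ℂ} (hu : ‖u‖ = 1) {L : Set Loz} (hfin : L.Finite)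
    (hcard : 4 < L.ncard) (hL : Packed L) (hc : Conn L) (hf : FreeConn L) (hr : RunsOfThree L)
    (hb : Braced L) : IsTredoku (tile p u '' L) := by
  have hu0 := ne_zero_of_norm hu
  have hinj := tile_injective (p := p) hu0
  have hnontrivial : L.Nontrivial :=
    (Set.one_lt_ncard_iff_nontrivial_and_finite.1 (by omega)).1
  exact {
    finite := hfin.image _
    isTile := by
      rintro _ ⟨l, -, rfl⟩
      exact isTile_tile hu l
    four_lt := by rwa [Set.ncard_image_of_injective _ hinj]
    connected := (connected_adjacency_iff hu hL).2 ⟨hnontrivial.nonempty, hc⟩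
    touch := by
      rintro _ ⟨A, hA, rfl⟩ _ ⟨B, hB, rfl⟩ hne hAB
      exact touch_of_packed hu (fun h => hne (by rw [hL A hA B hB h])) hAB
    connected_remove := by
      rintro _ ⟨X, hX, rfl⟩
      obtain ⟨Y, hY, hYX⟩ := hnontrivial.exists_ne X
      exact (connected_remove_iff hu0).2 ⟨⟨Y, hY, hYX⟩, hb.connected_remove hL hc hX⟩
    run_extends := run_extends_of_runsOfThree hu hL hr
    run_le := run_le_of_runsOfThree hu hL hr
    no_holes := isConnected_of_freeConn hu0 hfin hf }

/-- Nothing has to be proved about `grow`: its output is tested by `isShelling` and compared with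
`S` in both directions. -/
theorem isTiling_sound {S : List Loz} {τ ρ : ℕ} (h : isTiling S τ ρ = true) {p u : ℂ}
    (hu : ‖u‖ = 1) : IsTiling τ ρ (tile p u '' {A | A ∈ S}) := by
  simp only [isTiling, Bool.and_eq_true, decide_eq_true_eq, List.all_eq_true, lozMem_iff] at h
  set K := grow S S.length (S.take 1)
  obtain ⟨⟨⟨⟨⟨⟨⟨hτ, hsh⟩, hρ⟩, hr⟩, hb⟩, hKS⟩, hSK⟩, hcard⟩ := h
  have hSK : {A | A ∈ S} = {A | A ∈ K} := Set.ext fun A => ⟨hSK A, hKS A⟩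
  have hne : K ≠ [] := by
    intro h
    simp [h] at hcard
  obtain ⟨hnd, hL, hc, hf⟩ := isShelling_sound hne hsh
  have hn : {A | A ∈ K}.ncard = K.length := by
    classical
    rw [← List.coe_toFinset, Set.ncard_coe_finset, List.toFinset_card_of_nodup hnd]
  rw [hSK]
  refine ⟨isTredoku_of_lozenges hu (List.finite_toSet K) (hn ▸ hcard) hL hc hf
    (runsOfThree_sound hr) (braced_sound hb), ?_, ?_⟩
  · rw [Set.ncard_image_of_injective _ (tile_injective (ne_zero_of_norm hu)), hn, hτ]
  · rw [ncard_runs hu hL, ncard_mids hnd, hρ]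

/-! ### Changes of frame and the conclusions for verdant tilings -/

/-- Rotating a lozenge amounts to rotating the frame. Since `ω³ = -1`, the unit may come out with
the opposite sign, and `rhombus_neg` then describes the rhombus from its other acute corner. -/
theorem tile_rot {p u : ℂ} (l : Loz) : tile p u (rot l) = tile p (u * omega ^ 2) l := by
  have ho := omega_sq
  have h3 : omega ^ 3 = -1 := by linear_combination (omega + 1) * ho
  obtain ⟨⟨x, y⟩, m⟩ := l
  cases m <;> simp only [rot, rotDir, tile]
  · rw [show u * omega ^ 2 * omega = -u by linear_combination u * h3, rhombus_neg]
    congr 1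
    simp only [pt, pos]
    push_cast
    linear_combination (-u * (x + 1) - u * (y - 1) * omega - u * (y - 1)) * ho
  · rw [show u * omega ^ 2 * omega ^ 2 = -(u * omega) by linear_combination u * omega * h3,
      rhombus_neg]
    congr 1
    simp only [pt, pos]
    push_cast
    linear_combination (-u * x - u * y * (omega + 1)) * ho
  · congr 1
    simp only [pt, pos]
    push_cast
    linear_combination (-u * x - u * y * (omega + 1)) * ho

theorem tile_shift {p u : ℂ} (w : Vtx) (l : Loz) :
    tile p u (shift w l) = tile (pt p u w) u l := by
  obtain ⟨⟨x, y⟩, m⟩ := l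
  cases m <;> simp only [shift, tile] <;> congr 1 <;> simp only [pt, pos] <;> push_cast <;> ring

theorem tile_rot_iterate {p u : ℂ} (k : ℕ) (l : Loz) :
    tile p u (rot^[k] l) = tile p (u * omega ^ (2 * k)) l := by
  induction k generalizing u with
  | zero => simp
  | succ k ih =>
    rw [Function.iterate_succ_apply', tile_rot, ih]
    congr 1
    ring

theorem tile_frame {p u : ℂ} (w : Vtx) (k : ℕ) (l : Loz) :
    tile p u (frame w k l) = tile (pt p u w) (u * omega ^ (2 * k)) l := by
  rw [frame, tile_shift, tile_rot_iterate]

theorem norm_mul_omega_pow {u : ℂ} (hu : ‖u‖ = 1) (k : ℕ) : ‖u * omega ^ k‖ = 1 := by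
  rw [norm_mul, norm_pow, hu, norm_omega, one_pow, one_mul]

/-- Verdant tilings are given by lists of lozenges that decompose. -/
theorem IsTredoku.exists_list {T : Set (Set ℂ)} (hT : IsTredoku T)
    (hcard : T.ncard = 2 * (runs T).ncard + 1) : ∃ p u : ℂ, ‖u‖ = 1 ∧ ∃ K : List Loz,
      K.length = T.ncard ∧ T = tile p u '' {A | A ∈ K} ∧ decomposes K = true := by
  obtain ⟨⟨A, hA⟩⟩ := hT.connected.nonempty
  obtain ⟨p, u, hu, rfl⟩ := hT.isTile A hA
  have h₀ : tile p u ((0, 0), .c) ∈ T := by simpa [tile, pt, pos] using hA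
  -- A change of frame relabels the lozenges but leaves the tiling alone, so `IsTredoku.good`
  -- applies in every frame.
  have hL : AllGood {l | tile p u l ∈ T} := by
    intro w k
    obtain ⟨l, hl⟩ := frame_surjective w k ((0, 0), .c)
    have := hT.good hcard (norm_mul_omega_pow hu (2 * k)) (p := pt p u w) (l₀ := l)
      (by rwa [← tile_frame, hl])
    simpa only [Set.mem_ofPred_eq, tile_frame] using this
  have hT' := hT.eq_image hu h₀
  have hinj := tile_injective (p := p) (ne_zero_of_norm hu)
  have hnt : {l | tile p u l ∈ T}.Nontrivial := by
    refine (Set.one_lt_ncard_iff_nontrivial_and_finite.1 ?_).1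
    have := hT.four_lt
    rw [hT', Set.ncard_image_of_injective _ hinj] at this
    omega
  obtain ⟨w, k, K, hnd, hK, hdec⟩ := hL.exists_list hnt
  have hu' := norm_mul_omega_pow hu (2 * k)
  have hTK : T = tile (pt p u w) (u * omega ^ (2 * k)) '' {A | A ∈ K} := by
    rw [← hK]
    refine (Set.Subset.antisymm ?_ ?_)
    · intro B hB
      obtain ⟨l, hl, rfl⟩ := hT'.subset hB
      obtain ⟨l', rfl⟩ := frame_surjective w k l
      exact ⟨l', hl, (tile_frame w k l').symm⟩
    · rintro _ ⟨l, hl, rfl⟩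
      rw [← tile_frame]
      exact hl
  refine ⟨_, _, hu', K, ?_, hTK, hdec⟩
  classical
  rw [hTK, Set.ncard_image_of_injective _ (tile_injective (ne_zero_of_norm hu')),
    ← List.coe_toFinset, Set.ncard_coe_finset, List.toFinset_card_of_nodup hnd]

theorem meetOnce_sound {A B : List Loz} (h : meetOnce A B = true) {p u : ℂ} (hu : u ≠ 0) :
    ∃ X, tile p u '' {l | l ∈ A} ∩ tile p u '' {l | l ∈ B} = {X} := by
  simp only [meetOnce, List.any_eq_true, Bool.and_eq_true, List.all_eq_true, Bool.or_eq_true,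
    Bool.not_eq_true', lozMem_iff, lozEq_iff] at h
  obtain ⟨X, hXA, hXB, h⟩ := h
  refine ⟨tile p u X, ?_⟩
  rw [← Set.image_inter (tile_injective hu), ← Set.image_singleton]
  congr 1
  ext Y
  simp only [Set.mem_inter_iff, Set.mem_ofPred_eq, Set.mem_singleton_iff]
  constructor
  · rintro ⟨hA, hB⟩
    refine (h Y hA).resolve_left fun h' => ?_
    rw [lozMem_iff.2 hB] at h'
    exact absurd h' (by simp)
  · rintro rfl
    exact ⟨hXA, hXB⟩

theorem covers_sound {K A B : List Loz} (h : covers K A B = true) (p u : ℂ) :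
    tile p u '' {l | l ∈ K} = tile p u '' {l | l ∈ A} ∪ tile p u '' {l | l ∈ B} := by
  simp only [covers, Bool.and_eq_true, List.all_eq_true, Bool.or_eq_true, lozMem_iff] at h
  rw [← Set.image_union]
  congr 1
  ext X
  exact ⟨h.1.1 X, fun hX => hX.elim (h.1.2 X) (h.2 X)⟩

theorem image_append (p u : ℂ) (A B : List Loz) : tile p u '' {l | l ∈ A ++ B} =
    tile p u '' {l | l ∈ A} ∪ tile p u '' {l | l ∈ B} := by
  rw [← Set.image_union]
  congr 1
  ext X
  simp

theorem isMerging_sound {K : List Loz} {τ ρ τ' ρ' : ℕ} (h : isMerging K τ ρ τ' ρ' = true)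
    {p u : ℂ} (hu : ‖u‖ = 1) (hT : IsTredoku (tile p u '' {A | A ∈ K})) :
    ∃ A B, IsTiling τ ρ A ∧ IsTiling τ' ρ' B ∧
      IsSingleMerging (tile p u '' {A | A ∈ K}) A B := by
  simp only [isMerging, List.any_eq_true, Bool.and_eq_true] at h
  obtain ⟨A, -, hA, B, -, ⟨hB, hc⟩, hm⟩ := h
  have hA := isTiling_sound hA (p := p) hu
  have hB := isTiling_sound hB (p := p) hu
  exact ⟨_, _, hA, hB, hT, hA.1, hB.1, covers_sound hc p u, meetOnce_sound hm (ne_zero_of_norm hu)⟩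

theorem isDoubleMerging_sound {K : List Loz} (h : isDoubleMerging K = true) {p u : ℂ}
    (hu : ‖u‖ = 1) (hT : IsTredoku (tile p u '' {A | A ∈ K})) :
    ∃ A B C, IsTiling 7 3 A ∧ IsTiling 5 2 B ∧ IsTiling 7 3 C ∧ IsSingleMerging (A ∪ B) A B ∧
      IsSingleMerging (B ∪ C) B C ∧ IsSingleMerging (tile p u '' {A | A ∈ K}) (A ∪ B) C := by
  have hu0 := ne_zero_of_norm hu
  simp only [isDoubleMerging, List.any_eq_true, Bool.and_eq_true] at h
  obtain ⟨B, -, hB, A, -, ⟨⟨hA, hAB⟩, hTAB⟩, C, -, ⟨⟨⟨hC, hTBC⟩, hBC⟩, hcov⟩, hABC⟩ := h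
  have hA := isTiling_sound hA (p := p) hu
  have hB := isTiling_sound hB (p := p) hu
  have hC := isTiling_sound hC (p := p) hu
  have hTAB := isTiling_sound hTAB (p := p) hu
  have hTBC := isTiling_sound hTBC (p := p) hu
  have hcov := covers_sound hcov p u
  have hABC := meetOnce_sound hABC (p := p) hu0
  rw [image_append] at hTAB hTBC hcov hABC
  exact ⟨_, _, _, hA, hB, hC, ⟨hTAB.1, hA.1, hB.1, rfl, meetOnce_sound hAB hu0⟩,
    ⟨hTBC.1, hB.1, hC.1, rfl, meetOnce_sound hBC hu0⟩, ⟨hT, hTAB.1, hC.1, hcov, hABC⟩⟩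

/-- The verdant tilings in terms of lists of lozenges. -/
theorem IsTiling.exists_list {T : Set (Set ℂ)} {τ ρ : ℕ} (hT : IsTiling τ ρ T)
    (h : τ = 2 * ρ + 1) : ∃ p u : ℂ, ‖u‖ = 1 ∧ ∃ K : List Loz,
      K.length = τ ∧ T = tile p u '' {A | A ∈ K} ∧ decomposes K = true := by
  obtain ⟨h1, h2, h3⟩ := hT
  obtain ⟨p, u, hu, K, hK⟩ := h1.exists_list (by rw [h2, h3, h])
  exact ⟨p, u, hu, K, h2 ▸ hK⟩

theorem length_of_decomposes {K : List Loz} (h : decomposes K = true) :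
    K.length ∈ [5, 7, 9, 11, 13, 17] := by
  unfold decomposes at h
  split at h <;> simp_all

theorem exists_isTiling {S : List Loz} {τ ρ : ℕ} (h : isTiling S τ ρ = true) :
    ∃ T, IsTiling τ ρ T :=
  ⟨_, isTiling_sound h (p := 0) (u := 1) norm_one⟩

/-! ### Examples -/

theorem exists_isTiling_5_2 : ∃ T, IsTiling 5 2 T :=
  exists_isTiling (S := [((-1, 0), .c), ((1, 0), .c), ((1, -1), .b), ((0, 1), .b), ((0, 0), .c)])
    (by decide +kernel)

theorem exists_isTiling_7_3 : ∃ T, IsTiling 7 3 T :=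
  exists_isTiling (S := [((2, -1), .b), ((1, 1), .c), ((-1, 0), .c), ((1, 0), .c), ((0, -1), .c),
    ((0, 1), .b), ((0, 0), .c)]) (by decide +kernel)

theorem exists_isTiling_9_4 : ∃ T, IsTiling 9 4 T :=
  exists_isTiling (S := [((-1, 3), .a), ((1, 1), .c), ((0, 3), .a), ((0, 2), .a), ((-1, 0), .c),
    ((1, 0), .a), ((0, -1), .c), ((0, 1), .b), ((0, 0), .c)]) (by decide +kernel)

theorem exists_isTiling_11_5 : ∃ T, IsTiling 11 5 T :=
  exists_isTiling (S := [((-2, -2), .c), ((-2, 0), .b), ((-3, -1), .c), ((-2, -1), .c),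
    ((0, -2), .b), ((-1, -1), .c), ((-1, 0), .c), ((1, 0), .c), ((1, -1), .b), ((0, 1), .b),
    ((0, 0), .c)]) (by decide +kernel)

theorem exists_isTiling_13_6 : ∃ T, IsTiling 13 6 T :=
  exists_isTiling (S := [((3, -2), .a), ((5, -2), .b), ((5, -3), .b), ((4, -2), .b), ((3, 0), .a),
    ((3, -1), .b), ((2, -1), .b), ((1, 1), .c), ((-1, 0), .c), ((1, 0), .c), ((0, -1), .c),
    ((0, 1), .b), ((0, 0), .c)]) (by decide +kernel)

/-- The list contains the one for `11.5`, which contains the one for `5.2`. The six further lozenges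
form the second `7.3` part together with `((1, 0), .c)`. -/
theorem exists_isTiling_17_8 : ∃ T, IsTiling 17 8 T :=
  exists_isTiling (S := [((-2, -2), .c), ((-2, 0), .b), ((-3, -1), .c), ((-2, -1), .c),
    ((0, -2), .b), ((-1, -1), .c), ((3, 0), .b), ((2, 2), .c), ((3, 1), .c), ((2, 1), .c),
    ((1, 2), .b), ((1, 1), .c), ((-1, 0), .c), ((1, 0), .c), ((1, -1), .b), ((0, 1), .b),
    ((0, 0), .c)]) (by decide +kernel)

end Tredoku

theorem mainTheorem3 :
    (∀ τ ρ : ℕ, (τ = 2 * ρ + 1 ∧ ∃ T, Tredoku.IsTiling τ ρ T) ↔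
      (τ, ρ) ∈ ({(5, 2), (7, 3), (9, 4), (11, 5), (13, 6), (17, 8)} : Set (ℕ × ℕ))) ∧
    (∀ T, Tredoku.IsTiling 9 4 T →
      ∃ A B, Tredoku.IsTiling 5 2 A ∧ Tredoku.IsTiling 5 2 B ∧ Tredoku.IsSingleMerging T A B) ∧
    (∀ T, Tredoku.IsTiling 11 5 T →
      ∃ A B, Tredoku.IsTiling 5 2 A ∧ Tredoku.IsTiling 7 3 B ∧ Tredoku.IsSingleMerging T A B) ∧
    (∀ T, Tredoku.IsTiling 13 6 T →
      ∃ A B, Tredoku.IsTiling 7 3 A ∧ Tredoku.IsTiling 7 3 B ∧ Tredoku.IsSingleMerging T A B) ∧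
    (∀ T, Tredoku.IsTiling 17 8 T →
      ∃ A B C, Tredoku.IsTiling 7 3 A ∧ Tredoku.IsTiling 5 2 B ∧ Tredoku.IsTiling 7 3 C ∧
        Tredoku.IsSingleMerging (A ∪ B) A B ∧ Tredoku.IsSingleMerging (B ∪ C) B C ∧
        Tredoku.IsSingleMerging T (A ∪ B) C) := by
  refine ⟨fun τ ρ => ⟨?_, ?_⟩, fun T hT => ?_, fun T hT => ?_, fun T hT => ?_, fun T hT => ?_⟩
  · rintro ⟨h, T, hT⟩
    obtain ⟨p, u, -, K, hlen, -, hdec⟩ := hT.exists_list h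
    have := Tredoku.length_of_decomposes hdec
    rw [hlen] at this
    simp only [List.mem_cons, List.not_mem_nil, or_false] at this
    simp only [Set.mem_insert_iff, Set.mem_singleton_iff, Prod.mk.injEq]
    omega
  · simp only [Set.mem_insert_iff, Set.mem_singleton_iff, Prod.mk.injEq]
    rintro (⟨rfl, rfl⟩ | ⟨rfl, rfl⟩ | ⟨rfl, rfl⟩ | ⟨rfl, rfl⟩ | ⟨rfl, rfl⟩ | ⟨rfl, rfl⟩)
    exacts [⟨rfl, Tredoku.exists_isTiling_5_2⟩, ⟨rfl, Tredoku.exists_isTiling_7_3⟩,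
      ⟨rfl, Tredoku.exists_isTiling_9_4⟩, ⟨rfl, Tredoku.exists_isTiling_11_5⟩,
      ⟨rfl, Tredoku.exists_isTiling_13_6⟩, ⟨rfl, Tredoku.exists_isTiling_17_8⟩]
  · obtain ⟨p, u, hu, K, hlen, rfl, hdec⟩ := hT.exists_list rfl
    simp only [Tredoku.decomposes, hlen] at hdec
    exact Tredoku.isMerging_sound hdec hu hT.1
  · obtain ⟨p, u, hu, K, hlen, rfl, hdec⟩ := hT.exists_list rfl
    simp only [Tredoku.decomposes, hlen] at hdec
    exact Tredoku.isMerging_sound hdec hu hT.1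
  · obtain ⟨p, u, hu, K, hlen, rfl, hdec⟩ := hT.exists_list rfl
    simp only [Tredoku.decomposes, hlen] at hdec
    exact Tredoku.isMerging_sound hdec hu hT.1
  · obtain ⟨p, u, hu, K, hlen, rfl, hdec⟩ := hT.exists_list rfl
    simp only [Tredoku.decomposes, hlen] at hdec
    exact Tredoku.isDoubleMerging_sound hdec hu hT.1
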